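/- Let $0<q<1$, let $k_1,k_2>0$, let $\varepsilon\in\frac12\mathbb Z$, and let $\mathbb N=\{0,1,2,\dots\}$. **The algebra.** $\mathcal U_q$ is the unital associative complex algebra generated by $K,K^{-1},E,F$ with relations $KK^{-1}=1=K^{-1}K$, $KE=qEK$, $KF=q^{-1}FK$, $EF-FE=\frac{K^2-K^{-2}}{q-q^{-1}}$. Its Casimir element is $\Omega=\frac{q^{-1}K^2+qK^{-2}-2}{(q^{-1}-q)^2}+EF$, and its comultiplication $\Delta:\mathcal U_q\to\mathcal U_q\otimes\mathcal U_q$ is the algebra homomorphism with $\Delta(K^{\pm1})=K^{\pm1}\otimes K^{\pm1}$, $\Delta(E)=K\otimes E+E\otimes K^{-1}$, $\Delta(F)=K\otimes F+F\otimes K^{-1}$. **The representations.** The following representations act on the finite linear combinations of the standard orthonormal basis vectors $e_n$ of $\ell^2(\mathbb N)$ (for $\pi_k^\pm$, $k>0$, with $e_{-1}=0$) or of $\ell^2(\mathbb Z)$ (for $\pi^{\mathrm S}_{\sigma,\epsilon}$, $\sigma,\epsilon\in\mathbb R$); $K^{-1}$ acts by the inverse of $K$. - $\pi_k^+$: $Ke_n=q^{k+n}e_n$,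 $(q^{-1}-q)Ee_n=q^{-\frac12-k-n}\sqrt{(1-q^{2n+2})(1-q^{4k+2n})}\,e_{n+1}$, $(q^{-1}-q)Fe_n=-q^{\frac12-k-n}\sqrt{(1-q^{2n})(1-q^{4k+2n-2})}\,e_{n-1}$. - $\pi_k^-$: $Ke_n=q^{-(k+n)}e_n$, $(q^{-1}-q)Ee_n=-q^{\frac12-k-n}\sqrt{(1-q^{2n})(1-q^{4k+2n-2})}\,e_{n-1}$, $(q^{-1}-q)Fe_n=q^{-\frac12-k-n}\sqrt{(1-q^{2n+2})(1-q^{4k+2n})}\,e_{n+1}$. - $\pi^{\mathrm S}_{\sigma,\epsilon}$: $Ke_n=q^{n+\epsilon}e_n$, $(q^{-1}-q)Ee_n=q^{-\frac12-n-\epsilon}\sqrt{(1+q^{2n+2\epsilon+2\sigma+1})(1+q^{2n+2\epsilon-2\sigma+1})}\,e_{n+1}$, $(q^{-1}-q)Fe_n=-q^{\frac12-n-\epsilon}\sqrt{(1+q^{2n+2\epsilon+2\sigma-1})(1+q^{2n+2\epsilon-2\sigma-1})}\,e_{n-1}$. Define $$\mathcal T'=\Big(\big(\pi^-_{k_1}\otimes\pi^{\mathrm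 S}_{k_2-\frac12,\varepsilon+k_2}\big)\oplus\big(\pi^{\mathrm S}_{k_1-\frac12,-\varepsilon-k_1}\otimes\pi^+_{k_2}\big)\Big)\Delta ,$$ acting on the finite linear combinations of the vectors $e_i\otimes e_j$ in $\ell^2(\mathbb N)\otimes\ell^2(\mathbb Z)\oplus\ell^2(\mathbb Z)\otimes\ell^2(\mathbb N)$. For $p\in\mathbb Z$ and $n\in\mathbb N$ let $f^-_{p,n}=e_n\otimes e_{n+p}$ (in the first summand), $f^+_{p,n}=e_{2\varepsilon-n+p}\otimes e_n$ (in the second summand), and $\mathcal A_p=\mathrm{span}\{f^-_{p,n}\mid n\in\mathbb N\}\oplus\mathrm{span}\{f^+_{p,n}\mid n\in\mathbb N\}$. **The functions $r_x$.** For a base $q\in(0,1)$ write $(x;q)_n=\prod_{k=0}^{n-1}(1-xq^k)$ for $n\in\mathbb N\cup\{\infty\}$, $(x_1,\dots,x_j;q)_n=\prod_i(x_i;q)_n$, $\theta(x;q)=(x,q/x;q)_\infty$, and let $$P_m(x;a,b,c;q)=\sum_{k=0}^{\infty}\frac{(q^{-m},abq^{m+1},x;q)_k}{(q,aq,cq;q)_k}\,q^k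 ,\qquad u(x;a,b,c;q)=\frac{(x/a,x/c;q)_\infty}{(x,bx/c;q)_\infty},$$ $$v(m;a,b,c;q)=\frac{1-abq^{2m+1}}{aq(1-abq)}\,\frac{(aq,bq,cq,abq/c;q)_\infty}{(q,abq^2;q)_\infty\,\theta(c/a;q)}\,\frac{(aq,abq,cq;q)_m}{(q,bq,abq/c;q)_m}\,(-acq^2)^{-m}q^{-\frac12m(m-1)},$$ where the common factor $1-abq$ of $(1-abq^{2m+1})(abq;q)_m$ and $1-abq$ is cancelled, so that $v$ is also defined when $abq=1$. Put $$r_x(m;a,b,c;q)=\sqrt{|x|\,u(x;a,b,c;q)\,v(m;a,b,c;q)}\;P_m(x;a,b,c;q).$$ **Proposition.** Let $p\in\mathbb Z$ and define the linear map $\Theta$ on $\mathcal A_p$ by $$f^-_{p,n}\mapsto\Big(m\mapsto r_{q^{2n+4k_1}}\big(m;q^{4k_1-2},q^{4k_2-2},-q^{4k_1-2p-2\varepsilon-2};q^2\big)\Big),$$ $$f^+_{p,n}\mapsto\Big(m\mapsto(-1)^n\,r_{-q^{2n+4k_1-2p-2\varepsilon}}\big(m;q^{4k_1-2},q^{4k_2-2},-q^{4k_1-2p-2\varepsilon-2};q^2\big)\Big).$$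 Then $\Theta$ maps $\mathcal A_p$ into $\ell^2(\mathbb N)$ and extends to a unitary operator from the closure $\overline{\mathcal A_p}$ onto $\ell^2(\mathbb N)$. Furthermore, $\mathcal A_p$ is invariant under $\mathcal T'(\Omega)$, and for all $f\in\mathcal A_p$ and $m\in\mathbb N$ $$\big(\Theta\,\mathcal T'(\Omega)f\big)(m)=-(q^{-1}-q)^{-2}\Big(q^{2k_1+2k_2-1+2m}+q^{-(2k_1+2k_2-1+2m)}+2\Big)\,(\Theta f)(m).$$ -/

import Mathlib

open scoped TensorProduct

noncomputable section

namespace QSU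

/-! ### The quantum algebra `U_q(su(1,1))` -/

/-- The generators `K`, `K⁻¹`, `E`, `F`. -/
inductive Gen
  | K
  | Kinv
  | E
  | F

/-- The defining relations for four elements `k, k', e, f` of a complex algebra
(standing for `K, K⁻¹, E, F`). -/
structure Relations (q : ℝ) {A : Type*} [Ring A] [Algebra ℂ A] (k k' e f : A) : Prop where
  k_mul_k' : k * k' = 1
  k'_mul_k : k' * k = 1
  k_mul_e : k * e = (q : ℂ) • (e * k)
  k_mul_f : k * f = ((q⁻¹ : ℝ) : ℂ) • (f * k)
  e_mul_f : e * f - f * e = (((q - q⁻¹)⁻¹ : ℝ) : ℂ) • (k * k - k' * k')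

/-- The relations imposed on the free algebra. -/
inductive Rel (q : ℝ) : FreeAlgebra ℂ Gen → FreeAlgebra ℂ Gen → Prop
  | k_mul_k' : Rel q (FreeAlgebra.ι ℂ Gen.K * FreeAlgebra.ι ℂ Gen.Kinv) 1
  | k'_mul_k : Rel q (FreeAlgebra.ι ℂ Gen.Kinv * FreeAlgebra.ι ℂ Gen.K) 1
  | k_mul_e : Rel q (FreeAlgebra.ι ℂ Gen.K * FreeAlgebra.ι ℂ Gen.E)
      ((q : ℂ) • (FreeAlgebra.ι ℂ Gen.E * FreeAlgebra.ι ℂ Gen.K))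
  | k_mul_f : Rel q (FreeAlgebra.ι ℂ Gen.K * FreeAlgebra.ι ℂ Gen.F)
      (((q⁻¹ : ℝ) : ℂ) • (FreeAlgebra.ι ℂ Gen.F * FreeAlgebra.ι ℂ Gen.K))
  | e_mul_f : Rel q
      (FreeAlgebra.ι ℂ Gen.E * FreeAlgebra.ι ℂ Gen.F -
        FreeAlgebra.ι ℂ Gen.F * FreeAlgebra.ι ℂ Gen.E)
      ((((q - q⁻¹)⁻¹ : ℝ) : ℂ) • (FreeAlgebra.ι ℂ Gen.K * FreeAlgebra.ι ℂ Gen.K -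
        FreeAlgebra.ι ℂ Gen.Kinv * FreeAlgebra.ι ℂ Gen.Kinv))

/-- The unital associative complex algebra `U_q` given by generators and relations. -/
abbrev Uq (q : ℝ) : Type := RingQuot (Rel q)

/-- The class of a generator in `U_q`. -/
def gen (q : ℝ) (g : Gen) : Uq q := RingQuot.mkAlgHom ℂ (Rel q) (FreeAlgebra.ι ℂ g)

theorem gen_relations (q : ℝ) :
    Relations q (gen q .K) (gen q .Kinv) (gen q .E) (gen q .F) where
  k_mul_k' := by simpa [gen] using RingQuot.mkAlgHom_rel ℂ (Rel.k_mul_k' (q := q))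
  k'_mul_k := by simpa [gen] using RingQuot.mkAlgHom_rel ℂ (Rel.k'_mul_k (q := q))
  k_mul_e := by
    have h := RingQuot.mkAlgHom_rel ℂ (Rel.k_mul_e (q := q))
    simp only [map_mul, map_smul] at h
    exact h
  k_mul_f := by
    have h := RingQuot.mkAlgHom_rel ℂ (Rel.k_mul_f (q := q))
    simp only [map_mul, map_smul] at h
    exact h
  e_mul_f := by
    have h := RingQuot.mkAlgHom_rel ℂ (Rel.e_mul_f (q := q))
    simp only [map_mul, map_smul, map_sub] at h
    exact h

/-- Images of the generators. -/
def genImage {A : Type*} (k k' e f : A) : Gen → A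
  | .K => k
  | .Kinv => k'
  | .E => e
  | .F => f

/-- The algebra homomorphism out of `U_q` determined by elements satisfying the relations. -/
def Uq.lift {q : ℝ} {A : Type*} [Ring A] [Algebra ℂ A] {k k' e f : A}
    (h : Relations q k k' e f) : Uq q →ₐ[ℂ] A :=
  RingQuot.liftAlgHom ℂ ⟨FreeAlgebra.lift ℂ (genImage k k' e f), by
    intro x y hxy
    cases hxy
    · simpa [genImage] using h.k_mul_k'
    · simpa [genImage] using h.k'_mul_k
    · simpa only [map_mul, map_smul, FreeAlgebra.lift_ι_apply, genImage] using h.k_mul_e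
    · simpa only [map_mul, map_smul, FreeAlgebra.lift_ι_apply, genImage] using h.k_mul_f
    · simpa only [map_mul, map_smul, map_sub, FreeAlgebra.lift_ι_apply, genImage]
        using h.e_mul_f⟩

theorem Uq.lift_gen {q : ℝ} {A : Type*} [Ring A] [Algebra ℂ A] {k k' e f : A}
    (h : Relations q k k' e f) (g : Gen) : Uq.lift h (gen q g) = genImage k k' e f g := by
  simp [Uq.lift, gen]

/-- The Casimir element `Ω = (q⁻¹K² + qK⁻² - 2)/(q⁻¹ - q)² + EF`. -/
def casimir (q : ℝ) : Uq q :=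
  ((((q⁻¹ - q) ^ 2)⁻¹ : ℝ) : ℂ) •
      (((q⁻¹ : ℝ) : ℂ) • gen q .K ^ 2 + (q : ℂ) • gen q .Kinv ^ 2 - 2) +
    gen q .E * gen q .F

theorem comul_relations {q : ℝ} (hq : q ≠ 0) :
    Relations q (A := Uq q ⊗[ℂ] Uq q)
      (gen q .K ⊗ₜ gen q .K) (gen q .Kinv ⊗ₜ gen q .Kinv)
      (gen q .K ⊗ₜ gen q .E + gen q .E ⊗ₜ gen q .Kinv)
      (gen q .K ⊗ₜ gen q .F + gen q .F ⊗ₜ gen q .Kinv) := by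
  have h := gen_relations q
  generalize gen q .K = k at h ⊢
  generalize gen q .Kinv = k' at h ⊢
  generalize gen q .E = e at h ⊢
  generalize gen q .F = f at h ⊢
  obtain ⟨h1, h2, h3, h4, h5⟩ := h
  have hqc : (q : ℂ) ≠ 0 := by exact_mod_cast hq
  have h3' : e * k' = (q : ℂ) • (k' * e) := by
    calc e * k' = k' * (k * e) * k' := by rw [← mul_assoc, h2, one_mul]
      _ = (q : ℂ) • (k' * e) := by
        rw [h3, mul_smul_comm, smul_mul_assoc, mul_assoc k', mul_assoc e, h1, mul_one]
  have h4' : f * k' = ((q⁻¹ : ℝ) : ℂ) • (k' * f) := by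
    calc f * k' = k' * (k * f) * k' := by rw [← mul_assoc, h2, one_mul]
      _ = ((q⁻¹ : ℝ) : ℂ) • (k' * f) := by
        rw [h4, mul_smul_comm, smul_mul_assoc, mul_assoc k', mul_assoc f, h1, mul_one]
  refine ⟨?_, ?_, ?_, ?_, ?_⟩
  · rw [Algebra.TensorProduct.tmul_mul_tmul, h1, Algebra.TensorProduct.one_def]
  · rw [Algebra.TensorProduct.tmul_mul_tmul, h2, Algebra.TensorProduct.one_def]
  · simp only [mul_add, add_mul, Algebra.TensorProduct.tmul_mul_tmul, h3, h1, h2,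
      TensorProduct.tmul_smul, TensorProduct.smul_tmul', smul_add]
  · simp only [mul_add, add_mul, Algebra.TensorProduct.tmul_mul_tmul, h4, h1, h2,
      TensorProduct.tmul_smul, TensorProduct.smul_tmul', smul_add]
  · have h5' : e * f = f * e + (((q - q⁻¹)⁻¹ : ℝ) : ℂ) • (k * k - k' * k') := by
      rw [← h5]; abel
    simp only [mul_add, add_mul, Algebra.TensorProduct.tmul_mul_tmul, h4, h3, h3', h4', h5',
      TensorProduct.tmul_smul, ← TensorProduct.smul_tmul', TensorProduct.tmul_add,
      TensorProduct.add_tmul, TensorProduct.tmul_sub, TensorProduct.sub_tmul, smul_smul]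
    have e1 : (q : ℂ) * ((q⁻¹ : ℝ) : ℂ) = 1 := by push_cast; exact mul_inv_cancel₀ hqc
    have e2 : ((q⁻¹ : ℝ) : ℂ) * (q : ℂ) = 1 := by rw [mul_comm]; exact e1
    simp only [e1, e2, one_smul, smul_sub]
    abel

/-- The comultiplication `Δ : U_q → U_q ⊗ U_q`, with `Δ(K^{±1}) = K^{±1} ⊗ K^{±1}`,
`Δ(E) = K ⊗ E + E ⊗ K⁻¹` and `Δ(F) = K ⊗ F + F ⊗ K⁻¹`. -/
def comul {q : ℝ} (hq : q ≠ 0) : Uq q →ₐ[ℂ] Uq q ⊗[ℂ] Uq q := Uq.lift (comul_relations hq)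

/-! ### Representations on finite linear combinations of basis vectors -/

/-- The linear map with `e_n ↦ c n • e_{s n}` on finite linear combinations of the basis `e`. -/
def wmap {ι : Type*} (s : ι → ι) (c : ι → ℝ) : Module.End ℂ (ι →₀ ℂ) :=
  Finsupp.linearCombination ℂ fun n => Finsupp.single (s n) (c n : ℂ)

theorem wmap_single {ι : Type*} (s : ι → ι) (c : ι → ℝ) (n : ι) :
    wmap s c (Finsupp.single n 1) = Finsupp.single (s n) (c n : ℂ) := by
  simp [wmap]

theorem wmap_ext {ι : Type*} {s t : ι → ι} {c d : ι → ℝ} (h : ∀ n, c n = d n)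
    (h' : ∀ n, c n ≠ 0 → s n = t n) : wmap s c = wmap t d := by
  refine Finsupp.lhom_ext' fun n => LinearMap.ext_ring ?_
  simp only [LinearMap.comp_apply, Finsupp.lsingle_apply, wmap_single, h n]
  by_cases hc : c n = 0
  · rw [h n] at hc; simp [hc]
  · rw [h' n hc]

theorem wmap_mul {ι : Type*} (s t : ι → ι) (c d : ι → ℝ) :
    wmap s c * wmap t d = wmap (fun n => s (t n)) (fun n => d n * c (t n)) := by
  refine Finsupp.lhom_ext' fun n => LinearMap.ext_ring ?_
  simp [wmap]

theorem wmap_smul {ι : Type*} (s : ι → ι) (a : ℝ) (c : ι → ℝ) :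
    (a : ℂ) • wmap s c = wmap s (fun n => a * c n) := by
  refine Finsupp.lhom_ext' fun n => LinearMap.ext_ring ?_
  simp [wmap_single]

theorem wmap_sub {ι : Type*} (s : ι → ι) (c d : ι → ℝ) :
    wmap s c - wmap s d = wmap s (fun n => c n - d n) := by
  refine Finsupp.lhom_ext' fun n => LinearMap.ext_ring ?_
  simp [wmap_single]

theorem wmap_id {ι : Type*} : wmap (fun n : ι => n) (fun _ => 1) = 1 := by
  refine Finsupp.lhom_ext' fun n => LinearMap.ext_ring ?_
  simp [wmap_single]

theorem neg_eq_smul {A : Type*} [Ring A] [Algebra ℂ A] {x y z : A} {c : ℂ}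
    (h : x = c • (y - z)) : -x = c • (z - y) := by
  rw [h, ← smul_neg, neg_sub]

theorem ladder_relations {ι : Type*} {q ω : ℝ} (hq : 0 < q) (hq1 : q < 1) {s t : ι → ι}
    {w u d : ι → ℝ} (hw : ∀ n, w n ≠ 0) (hs : ∀ n, w (s n) = q * w n)
    (ht : ∀ n, d n ≠ 0 → s (t n) = n) (hts : ∀ n, t (s n) = n)
    (hdu : ∀ n, d n * u (t n) =
      -((q⁻¹ - q) ^ 2)⁻¹ * (q⁻¹ * w n ^ 2 + q * (w n ^ 2)⁻¹ - ω))
    (hud : ∀ n, u n * d (s n) =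
      -((q⁻¹ - q) ^ 2)⁻¹ * (q * w n ^ 2 + q⁻¹ * (w n ^ 2)⁻¹ - ω)) :
    Relations q (wmap (fun n => n) w) (wmap (fun n => n) fun n => (w n)⁻¹)
        (wmap s u) (wmap t d) ∧
      Relations q (wmap (fun n => n) fun n => (w n)⁻¹) (wmap (fun n => n) w)
        (wmap t d) (wmap s u) := by
  have hq0 : q ≠ 0 := hq.ne'
  have htw : ∀ n, d n ≠ 0 → w (t n) = q⁻¹ * w n := by
    intro n hn
    have := hs (t n)
    rw [ht n hn] at this
    rw [this]; field_simp
  have hne : q⁻¹ - q ≠ 0 := by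
    have : 1 < q⁻¹ := (one_lt_inv₀ hq).2 hq1
    linarith
  have hne' : q - q⁻¹ ≠ 0 := by intro h; apply hne; linarith
  have hef : wmap s u * wmap t d - wmap t d * wmap s u =
      (((q - q⁻¹)⁻¹ : ℝ) : ℂ) • (wmap (fun n => n) w * wmap (fun n => n) w -
        wmap (fun n => n) (fun n => (w n)⁻¹) * wmap (fun n => n) (fun n => (w n)⁻¹)) := by
    have e1 : wmap s u * wmap t d = wmap (fun n => n) (fun n => d n * u (t n)) := by
      rw [wmap_mul]
      exact wmap_ext (fun _ => rfl) fun n hn => ht n (left_ne_zero_of_mul hn)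
    have e2 : wmap t d * wmap s u = wmap (fun n => n) (fun n => u n * d (s n)) := by
      rw [wmap_mul]
      exact wmap_ext (fun _ => rfl) fun n _ => hts n
    rw [e1, e2, wmap_mul, wmap_mul, wmap_sub, wmap_sub, wmap_smul]
    refine wmap_ext (fun n => ?_) fun _ _ => rfl
    rw [hdu, hud]
    have e3 : (q - q⁻¹)⁻¹ = ((q⁻¹ - q) ^ 2)⁻¹ * (q - q⁻¹) := by
      rw [show (q⁻¹ - q) ^ 2 = (q - q⁻¹) ^ 2 by ring]; field_simp
    rw [e3]
    ring
  have hkk : wmap (fun n : ι => n) w * wmap (fun n => n) (fun n => (w n)⁻¹) = 1 := by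
    rw [wmap_mul, ← wmap_id]
    exact wmap_ext (fun n => by simp [hw n]) fun _ _ => rfl
  have hkk' : wmap (fun n : ι => n) (fun n => (w n)⁻¹) * wmap (fun n => n) w = 1 := by
    rw [wmap_mul, ← wmap_id]
    exact wmap_ext (fun n => by simp [hw n]) fun _ _ => rfl
  refine ⟨⟨hkk, hkk', ?_, ?_, hef⟩, ⟨hkk', hkk, ?_, ?_, ?_⟩⟩
  · rw [wmap_mul, wmap_mul, wmap_smul]
    exact wmap_ext (fun n => by rw [hs]; ring) fun _ _ => rfl
  · rw [wmap_mul, wmap_mul, wmap_smul]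
    refine wmap_ext (fun n => ?_) fun _ _ => rfl
    by_cases hn : d n = 0
    · simp [hn]
    · rw [htw n hn]; ring
  · rw [wmap_mul, wmap_mul, wmap_smul]
    refine wmap_ext (fun n => ?_) fun _ _ => rfl
    by_cases hn : d n = 0
    · simp [hn]
    · rw [htw n hn, mul_inv, inv_inv]; ring
  · rw [wmap_mul, wmap_mul, wmap_smul]
    exact wmap_ext (fun n => by rw [hs, mul_inv]; ring) fun _ _ => rfl
  · rw [← neg_sub (wmap s u * wmap t d)]
    exact neg_eq_smul (A := Module.End ℂ (ι →₀ ℂ)) hef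

/-! #### Discrete series -/

/-- `q^{k+n}`. -/
def discWeight (q k : ℝ) (n : ℕ) : ℝ := q ^ (k + n)

/-- `(q⁻¹ - q)⁻¹ q^{-1/2-k-n} √((1 - q^{2n+2})(1 - q^{4k+2n}))`. -/
def discUp (q k : ℝ) (n : ℕ) : ℝ :=
  (q⁻¹ - q)⁻¹ * (q ^ (-(1 / 2) - k - n) *
    √((1 - q ^ (2 * n + 2 : ℝ)) * (1 - q ^ (4 * k + 2 * n))))

/-- `-(q⁻¹ - q)⁻¹ q^{1/2-k-n} √((1 - q^{2n})(1 - q^{4k+2n-2}))`; this vanishes for `n = 0`. -/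
def discDown (q k : ℝ) (n : ℕ) : ℝ :=
  -((q⁻¹ - q)⁻¹ * (q ^ (1 / 2 - k - n) *
    √((1 - q ^ (2 * n : ℝ)) * (1 - q ^ (4 * k + 2 * n - 2)))))

theorem disc_up_down {q k : ℝ} (hq : 0 < q) (hq1 : q < 1) (hk : 0 < k) (n : ℕ) :
    discUp q k n * discDown q k (n + 1) = -((q⁻¹ - q) ^ 2)⁻¹ *
      (q * discWeight q k n ^ 2 + q⁻¹ * (discWeight q k n ^ 2)⁻¹ -
        (q ^ (2 * k - 1) + q ^ (1 - 2 * k))) := by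
  have hx : 0 < q ^ k := Real.rpow_pos_of_pos hq k
  have hy : 0 < q ^ (n : ℝ) := Real.rpow_pos_of_pos hq _
  have hr : 0 ≤ (1 - q ^ (2 * n + 2 : ℝ)) * (1 - q ^ (4 * k + 2 * n)) := by
    refine mul_nonneg ?_ ?_ <;>
    · rw [sub_nonneg]
      exact Real.rpow_le_one hq.le hq1.le (by positivity)
  have hw : discWeight q k n = q ^ k * q ^ (n : ℝ) := Real.rpow_add hq _ _
  have e1 : q ^ (-(1 / 2) - k - n) * q ^ (1 / 2 - k - ((n + 1 : ℕ) : ℝ)) =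
      (q * (q ^ k) ^ 2 * (q ^ (n : ℝ)) ^ 2)⁻¹ := by
    rw [← Real.rpow_add hq, ← Real.rpow_two, ← Real.rpow_two, ← Real.rpow_mul hq.le,
      ← Real.rpow_mul hq.le]
    nth_rewrite 2 [← Real.rpow_one q]
    rw [← Real.rpow_add hq, ← Real.rpow_add hq, ← Real.rpow_neg hq.le]
    congr 1; push_cast; ring
  have e2 : q ^ (2 * n + 2 : ℝ) = (q ^ (n : ℝ)) ^ 2 * q ^ 2 := by
    rw [Real.rpow_add hq, mul_comm 2 (n : ℝ), Real.rpow_mul hq.le, Real.rpow_two, Real.rpow_two]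
  have e3 : q ^ (4 * k + 2 * n) = (q ^ k) ^ 4 * (q ^ (n : ℝ)) ^ 2 := by
    rw [Real.rpow_add hq, mul_comm 2 (n : ℝ), Real.rpow_mul hq.le (n : ℝ), Real.rpow_two,
      mul_comm 4 k, Real.rpow_mul hq.le k]
    norm_cast
  have e4 : q ^ (2 * k - 1) = (q ^ k) ^ 2 * q⁻¹ := by
    rw [Real.rpow_sub hq, mul_comm 2 k, Real.rpow_mul hq.le, Real.rpow_two, Real.rpow_one]; rfl
  have e5 : q ^ (1 - 2 * k) = q * ((q ^ k) ^ 2)⁻¹ := by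
    rw [Real.rpow_sub hq, mul_comm 2 k, Real.rpow_mul hq.le, Real.rpow_two, Real.rpow_one]; rfl
  have e6 : discDown q k (n + 1) = -((q⁻¹ - q)⁻¹ * (q ^ (1 / 2 - k - ((n + 1 : ℕ) : ℝ)) *
      √((1 - q ^ (2 * n + 2 : ℝ)) * (1 - q ^ (4 * k + 2 * n))))) := by
    unfold discDown
    congr 6 <;> push_cast <;> ring_nf
  rw [e6, discUp]
  calc _ = -((q⁻¹ - q) ^ 2)⁻¹ *
        ((q ^ (-(1 / 2) - k - n) * q ^ (1 / 2 - k - ((n + 1 : ℕ) : ℝ))) *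
        (√((1 - q ^ (2 * n + 2 : ℝ)) * (1 - q ^ (4 * k + 2 * n))) *
        √((1 - q ^ (2 * n + 2 : ℝ)) * (1 - q ^ (4 * k + 2 * n))))) := by
        rw [← inv_pow]; ring
    _ = _ := by
      rw [Real.mul_self_sqrt hr, e1, e2, e3, e4, e5, hw]
      congr 1
      field_simp
      ring

theorem disc_relations {q k : ℝ} (hq : 0 < q) (hq1 : q < 1) (hk : 0 < k) :
    Relations q (wmap (fun n => n) (discWeight q k))
        (wmap (fun n => n) fun n => (discWeight q k n)⁻¹)
        (wmap (fun n => n + 1) (discUp q k)) (wmap (fun n => n - 1) (discDown q k)) ∧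
      Relations q (wmap (fun n => n) fun n => (discWeight q k n)⁻¹)
        (wmap (fun n => n) (discWeight q k))
        (wmap (fun n => n - 1) (discDown q k)) (wmap (fun n => n + 1) (discUp q k)) := by
  have hd0 : discDown q k 0 = 0 := by simp [discDown]
  have hw : ∀ n, discWeight q k n ≠ 0 := fun n => (Real.rpow_pos_of_pos hq _).ne'
  have hs : ∀ n, discWeight q k (n + 1) = q * discWeight q k n := by
    intro n
    rw [discWeight, discWeight, mul_comm, ← Real.rpow_add_one hq.ne']
    congr 1; push_cast; ring
  refine ladder_relations hq hq1 (ω := q ^ (2 * k - 1) + q ^ (1 - 2 * k)) hw hs ?_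
    (fun n => by simp) ?_ (disc_up_down hq hq1 hk)
  · rintro (_ | n) hn
    · exact absurd hd0 hn
    · simp
  · rintro (_ | n)
    · have e4 : q ^ (2 * k - 1) = (q ^ k) ^ 2 * q⁻¹ := by
        rw [Real.rpow_sub hq, mul_comm 2 k, Real.rpow_mul hq.le, Real.rpow_two,
          Real.rpow_one]; rfl
      have e5 : q ^ (1 - 2 * k) = q * ((q ^ k) ^ 2)⁻¹ := by
        rw [Real.rpow_sub hq, mul_comm 2 k, Real.rpow_mul hq.le, Real.rpow_two,
          Real.rpow_one]; rfl
      have e6 : discWeight q k 0 = q ^ k := by simp [discWeight]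
      rw [hd0, e4, e5, e6]; ring
    · have hq0 := hq.ne'
      have := hw n
      rw [mul_comm, Nat.add_sub_cancel, disc_up_down hq hq1 hk n, hs]
      congr 1
      field_simp

/-- The positive discrete series `π⁺_k`, `k > 0`. -/
def posRep {q k : ℝ} (hq : 0 < q) (hq1 : q < 1) (hk : 0 < k) :
    Uq q →ₐ[ℂ] Module.End ℂ (ℕ →₀ ℂ) :=
  Uq.lift (disc_relations hq hq1 hk).1

/-- The negative discrete series `π⁻_k`, `k > 0`: `K` acts by `q^{-(k+n)}`, `E` lowers and
`F` raises the index. -/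
def negRep {q k : ℝ} (hq : 0 < q) (hq1 : q < 1) (hk : 0 < k) :
    Uq q →ₐ[ℂ] Module.End ℂ (ℕ →₀ ℂ) :=
  Uq.lift (disc_relations hq hq1 hk).2

/-! #### Strange series -/

/-- `q^{n+ε}`. -/
def strangeWeight (q ε : ℝ) (n : ℤ) : ℝ := q ^ (n + ε)

/-- `(q⁻¹ - q)⁻¹ q^{-1/2-n-ε} √((1 + q^{2n+2ε+2σ+1})(1 + q^{2n+2ε-2σ+1}))`. -/
def strangeUp (q σ ε : ℝ) (n : ℤ) : ℝ :=
  (q⁻¹ - q)⁻¹ * (q ^ (-(1 / 2) - n - ε) *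
    √((1 + q ^ (2 * n + 2 * ε + 2 * σ + 1)) * (1 + q ^ (2 * n + 2 * ε - 2 * σ + 1))))

/-- `-(q⁻¹ - q)⁻¹ q^{1/2-n-ε} √((1 + q^{2n+2ε+2σ-1})(1 + q^{2n+2ε-2σ-1}))`. -/
def strangeDown (q σ ε : ℝ) (n : ℤ) : ℝ :=
  -((q⁻¹ - q)⁻¹ * (q ^ (1 / 2 - n - ε) *
    √((1 + q ^ (2 * n + 2 * ε + 2 * σ - 1)) * (1 + q ^ (2 * n + 2 * ε - 2 * σ - 1)))))

theorem strange_up_down {q : ℝ} (hq : 0 < q) (σ ε : ℝ) (n : ℤ) :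
    strangeUp q σ ε n * strangeDown q σ ε (n + 1) = -((q⁻¹ - q) ^ 2)⁻¹ *
      (q * strangeWeight q ε n ^ 2 + q⁻¹ * (strangeWeight q ε n ^ 2)⁻¹ -
        -(q ^ (2 * σ) + q ^ (-(2 * σ)))) := by
  have hw : 0 < strangeWeight q ε n := Real.rpow_pos_of_pos hq _
  have hx : 0 < q ^ (2 * σ) := Real.rpow_pos_of_pos hq _
  have hr : 0 ≤ (1 + q ^ (2 * n + 2 * ε + 2 * σ + 1)) *
      (1 + q ^ (2 * n + 2 * ε - 2 * σ + 1)) := by positivity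
  have hw2 : strangeWeight q ε n ^ 2 = q ^ (2 * n + 2 * ε) := by
    rw [strangeWeight, ← Real.rpow_two, ← Real.rpow_mul hq.le]; congr 1; ring
  have e1 : q ^ (-(1 / 2) - n - ε) * q ^ (1 / 2 - ((n + 1 : ℤ) : ℝ) - ε) =
      (q * strangeWeight q ε n ^ 2)⁻¹ := by
    rw [hw2, ← Real.rpow_add hq]
    nth_rewrite 2 [← Real.rpow_one q]
    rw [← Real.rpow_add hq, ← Real.rpow_neg hq.le]
    congr 1; push_cast; ring
  have e2 : q ^ (2 * n + 2 * ε + 2 * σ + 1) = strangeWeight q ε n ^ 2 * q ^ (2 * σ) * q := by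
    rw [hw2, Real.rpow_add hq, Real.rpow_add hq, Real.rpow_one]
  have e3 : q ^ (2 * n + 2 * ε - 2 * σ + 1) =
      strangeWeight q ε n ^ 2 * (q ^ (2 * σ))⁻¹ * q := by
    rw [hw2, Real.rpow_add hq, Real.rpow_sub hq, Real.rpow_one]; rfl
  have e4 : q ^ (-(2 * σ)) = (q ^ (2 * σ))⁻¹ := Real.rpow_neg hq.le _
  have e6 : strangeDown q σ ε (n + 1) =
      -((q⁻¹ - q)⁻¹ * (q ^ (1 / 2 - ((n + 1 : ℤ) : ℝ) - ε) *
      √((1 + q ^ (2 * n + 2 * ε + 2 * σ + 1)) * (1 + q ^ (2 * n + 2 * ε - 2 * σ + 1))))) := by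
    unfold strangeDown
    congr 6 <;> push_cast <;> ring_nf
  rw [e6, strangeUp]
  calc _ = -((q⁻¹ - q) ^ 2)⁻¹ *
        ((q ^ (-(1 / 2) - n - ε) * q ^ (1 / 2 - ((n + 1 : ℤ) : ℝ) - ε)) *
        (√((1 + q ^ (2 * n + 2 * ε + 2 * σ + 1)) * (1 + q ^ (2 * n + 2 * ε - 2 * σ + 1))) *
        √((1 + q ^ (2 * n + 2 * ε + 2 * σ + 1)) *
          (1 + q ^ (2 * n + 2 * ε - 2 * σ + 1))))) := by
        rw [← inv_pow]; ring
    _ = _ := by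
      rw [Real.mul_self_sqrt hr, e1, e2, e3, e4]
      congr 1
      field_simp
      ring

theorem strange_relations {q : ℝ} (hq : 0 < q) (hq1 : q < 1) (σ ε : ℝ) :
    Relations q (wmap (fun n => n) (strangeWeight q ε))
      (wmap (fun n => n) fun n => (strangeWeight q ε n)⁻¹)
      (wmap (fun n => n + 1) (strangeUp q σ ε)) (wmap (fun n => n - 1) (strangeDown q σ ε)) := by
  have hw : ∀ n, strangeWeight q ε n ≠ 0 := fun n => (Real.rpow_pos_of_pos hq _).ne'
  have hs : ∀ n, strangeWeight q ε (n + 1) = q * strangeWeight q ε n := by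
    intro n
    rw [strangeWeight, strangeWeight, mul_comm, ← Real.rpow_add_one hq.ne']
    congr 1; push_cast; ring
  refine (ladder_relations hq hq1 (ω := -(q ^ (2 * σ) + q ^ (-(2 * σ)))) hw hs
    (fun n _ => by simp) (fun n => by simp) ?_ (strange_up_down hq σ ε)).1
  intro n
  obtain ⟨m, rfl⟩ : ∃ m, n = m + 1 := ⟨n - 1, by ring⟩
  have hq0 := hq.ne'
  have := hw m
  rw [mul_comm, show m + 1 - 1 = m by ring, strange_up_down hq σ ε m, hs]
  congr 1
  field_simp

/-- The strange series `π^S_{σ,ε}`; the formulas make sense for all real `σ` and `ε`. -/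
def strangeRep {q : ℝ} (hq : 0 < q) (hq1 : q < 1) (σ ε : ℝ) :
    Uq q →ₐ[ℂ] Module.End ℂ (ℤ →₀ ℂ) :=
  Uq.lift (strange_relations hq hq1 σ ε)

/-! #### The representation `T'` -/

/-- `(π₁ ⊗ π₂) Δ` on the algebraic tensor product. -/
def tensorRep {q : ℝ} (hq : q ≠ 0) {V W : Type} [AddCommGroup V] [Module ℂ V]
    [AddCommGroup W] [Module ℂ W] (π₁ : Uq q →ₐ[ℂ] Module.End ℂ V)
    (π₂ : Uq q →ₐ[ℂ] Module.End ℂ W) : Uq q →ₐ[ℂ] Module.End ℂ (V ⊗[ℂ] W) :=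
  ((Module.endTensorEndAlgHom (R := ℂ) (S := ℂ) (A := ℂ) (M := V) (N := W)).comp
    (Algebra.TensorProduct.map π₁ π₂)).comp (comul hq)

/-- The common domain of the operators `T'(X)`: the finite linear combinations of the vectors
`e_i ⊗ e_j` of `ℓ²(ℕ) ⊗ ℓ²(ℤ) ⊕ ℓ²(ℤ) ⊗ ℓ²(ℕ)`. -/
abbrev Dom : Type := ((ℕ →₀ ℂ) ⊗[ℂ] (ℤ →₀ ℂ)) × ((ℤ →₀ ℂ) ⊗[ℂ] (ℕ →₀ ℂ))

/-- `T'_{k₁,k₂,ε} =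
((π⁻_{k₁} ⊗ π^S_{k₂-1/2, ε+k₂}) ⊕ (π^S_{k₁-1/2, -ε-k₁} ⊗ π⁺_{k₂})) Δ`. -/
def repT' {q k₁ k₂ : ℝ} (hq : 0 < q) (hq1 : q < 1) (hk₁ : 0 < k₁) (hk₂ : 0 < k₂) (ε : ℝ) :
    Uq q →ₐ[ℂ] Module.End ℂ Dom :=
  (LinearMap.prodMapAlgHom ℂ ((ℕ →₀ ℂ) ⊗[ℂ] (ℤ →₀ ℂ)) ((ℤ →₀ ℂ) ⊗[ℂ] (ℕ →₀ ℂ))).comp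
    ((tensorRep hq.ne' (negRep hq hq1 hk₁) (strangeRep hq hq1 (k₂ - 1 / 2) (ε + k₂))).prod
      (tensorRep hq.ne' (strangeRep hq hq1 (k₁ - 1 / 2) (-ε - k₁)) (posRep hq hq1 hk₂)))

/-! ### The Hilbert space and the subspaces `A_p` -/

/-- The space `ℓ²(ℕ)`. -/
abbrev L2N : Type := lp (fun _ : ℕ => ℂ) 2

/-- The Hilbert space `ℓ²(ℕ) ⊗ ℓ²(ℤ) ⊕ ℓ²(ℤ) ⊗ ℓ²(ℕ)`, realised as the `ℓ²`-space on the disjoint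
union of `ℕ × ℤ` and `ℤ × ℕ`; `e_i ⊗ e_j` is the standard basis vector with index `(i, j)`. -/
abbrev Hilb : Type := lp (fun _ : (ℕ × ℤ) ⊕ (ℤ × ℕ) => ℂ) 2

/-- The inclusion of the domain in the Hilbert space. -/
def toHilb : Dom →ₗ[ℂ] Hilb :=
  LinearMap.coprod
    (Finsupp.linearCombination ℂ (fun i : ℕ × ℤ => (lp.single 2 (Sum.inl i) (1 : ℂ) : Hilb)) ∘ₗ
      (finsuppTensorFinsupp' ℂ ℕ ℤ).toLinearMap)
    (Finsupp.linearCombination ℂ (fun i : ℤ × ℕ => (lp.single 2 (Sum.inr i) (1 : ℂ) : Hilb)) ∘ₗ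
      (finsuppTensorFinsupp' ℂ ℤ ℕ).toLinearMap)

/-- `f⁻_{p,n} = e_n ⊗ e_{n+p}` in the first summand. -/
def vecMinus (p : ℤ) (n : ℕ) : Dom :=
  (Finsupp.single n 1 ⊗ₜ[ℂ] Finsupp.single ((n : ℤ) + p) 1, 0)

/-- `f⁺_{p,n} = e_{2ε-n+p} ⊗ e_n` in the second summand; `l` stands for the integer `2ε`. -/
def vecPlus (l p : ℤ) (n : ℕ) : Dom :=
  (0, Finsupp.single (l - (n : ℤ) + p) 1 ⊗ₜ[ℂ] Finsupp.single n 1)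

/-- The subspace `A_p = span {f⁻_{p,n}} ⊕ span {f⁺_{p,n}}`. -/
def subA (l p : ℤ) : Submodule ℂ Dom :=
  Submodule.span ℂ (Set.range (vecMinus p)) ⊔ Submodule.span ℂ (Set.range (vecPlus l p))

/-- `f⁻_{p,n}` as an element of `A_p`. -/
def fMinus (l p : ℤ) (n : ℕ) : subA l p :=
  ⟨vecMinus p n, Submodule.mem_sup_left (Submodule.subset_span ⟨n, rfl⟩)⟩

/-- `f⁺_{p,n}` as an element of `A_p`. -/
def fPlus (l p : ℤ) (n : ℕ) : subA l p :=
  ⟨vecPlus l p n, Submodule.mem_sup_right (Submodule.subset_span ⟨n, rfl⟩)⟩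

/-- The closure of `A_p` in the Hilbert space. -/
abbrev closureA (l p : ℤ) : Submodule ℂ Hilb := ((subA l p).map toHilb).topologicalClosure

/-- The inclusion of `A_p` in its closure. -/
def inclA (l p : ℤ) : subA l p →ₗ[ℂ] closureA l p :=
  (toHilb ∘ₗ (subA l p).subtype).codRestrict (closureA l p) fun x =>
    Submodule.le_topologicalClosure _ (Submodule.mem_map_of_mem x.2)

/-! ### `q`-series and big `q`-Jacobi polynomials -/

/-- `(x; q)_n`. -/
def qPoch (x q : ℝ) (n : ℕ) : ℝ := ∏ k ∈ Finset.range n, (1 - x * q ^ k)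

/-- `(x; q)_∞`. -/
def qPochInf (x q : ℝ) : ℝ := ∏' k : ℕ, (1 - x * q ^ k)

/-- The normalized Jacobi theta function `θ(x; q) = (x; q)_∞ (q/x; q)_∞`. -/
def qTheta (x q : ℝ) : ℝ := qPochInf x q * qPochInf (q / x) q

/-- The basic hypergeometric series `₃φ₂(a, b, c; d, e; q, z)`. -/
def phi32 (a b c d e q z : ℝ) : ℝ :=
  ∑' k : ℕ, qPoch a q k * qPoch b q k * qPoch c q k /
    (qPoch q q k * qPoch d q k * qPoch e q k) * z ^ k

/-- The big `q`-Jacobi polynomial `P_m(x; a, b, c; q)`. -/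
def bigJacobi (m : ℕ) (x a b c q : ℝ) : ℝ :=
  phi32 ((q ^ m)⁻¹) (a * b * q ^ (m + 1)) x (a * q) (c * q) q q

/-- The weight `u(x; a, b, c; q)`. -/
def uWeight (x a b c q : ℝ) : ℝ :=
  qPochInf (x / a) q * qPochInf (x / c) q / (qPochInf x q * qPochInf (b * x / c) q)

/-- The quotient `(1 - abq^{2m+1}) (abq; q)_m / (1 - abq)`, with the common factor `1 - abq`
cancelled (so that it also makes sense for `abq = 1`); `s` stands for `ab`. -/
def vFactor (m : ℕ) (s q : ℝ) : ℝ :=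
  if m = 0 then 1 else (1 - s * q ^ (2 * m + 1)) * qPoch (s * q ^ 2) q (m - 1)

theorem vFactor_eq (m : ℕ) (s q : ℝ) (h : 1 - s * q ≠ 0) :
    vFactor m s q = (1 - s * q ^ (2 * m + 1)) * qPoch (s * q) q m / (1 - s * q) := by
  rcases m with _ | m
  · simp [vFactor, qPoch, h]
  · have : qPoch (s * q) q (m + 1) = (1 - s * q) * qPoch (s * q ^ 2) q m := by
      rw [qPoch, Finset.prod_range_succ', mul_comm, qPoch]
      simp only [pow_zero, mul_one]
      congr 1
      exact Finset.prod_congr rfl fun k _ => by ring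
    rw [this, vFactor]
    simp only [Nat.add_sub_cancel, Nat.succ_ne_zero, if_false]
    field_simp

/-- The weight `v(m; a, b, c; q)`. -/
def vWeight (m : ℕ) (a b c q : ℝ) : ℝ :=
  vFactor m (a * b) q / (a * q) *
    (qPochInf (a * q) q * qPochInf (b * q) q * qPochInf (c * q) q * qPochInf (a * b * q / c) q /
      (qPochInf q q * qPochInf (a * b * q ^ 2) q * qTheta (c / a) q)) *
    (qPoch (a * q) q m * qPoch (c * q) q m /
      (qPoch q q m * qPoch (b * q) q m * qPoch (a * b * q / c) q m)) *
    ((-(a * c * q ^ 2)) ^ m)⁻¹ * q ^ (-(1 / 2 : ℝ) * m * (m - 1))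

/-- `r_x(m; a, b, c; q) = √(|x| u(x; a, b, c; q) v(m; a, b, c; q)) P_m(x; a, b, c; q)`. -/
def rFun (x : ℝ) (m : ℕ) (a b c q : ℝ) : ℝ :=
  √(|x| * uWeight x a b c q * vWeight m a b c q) * bigJacobi m x a b c q

end QSU

end

/-!
The Casimir element acts on each of the two families `f⁻_{p,n}` and `f⁺_{p,n}` by a Jacobi matrix.
Up to scaling and an additive constant, its entries are those of the symmetrised second order
`q`-difference equation of the big `q`-Jacobi polynomials, in base `q²`, at the points
`q^{2n+4k₁}` and `-q^{2n+4k₁-2p-2ε}` of their orthogonality measure; hence the functions `r_x(m)`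
are eigenvectors, with eigenvalue determined by the degree `m`. The sign `(-1)^n` in the second
family compensates its negative off-diagonal entries.

The functions `x ↦ r_x(m)` are orthonormal by the Andrews–Askey integral, evaluated in closed form
and combined with the `q`-Chu–Vandermonde sum. They form a Hilbert basis because the support of the
measure is bounded and all its points except `0` are isolated and carry positive mass: by the
Weierstrass approximation theorem a function orthogonal to all polynomials vanishes. The coordinates
with respect to this basis give the unitary operator.
-/

noncomputable section

open scoped Topology
open Filter Polynomial

namespace QSU

section QShiftedFactorial

variable {q : ℝ}

lemma qPoch_zero (x q : ℝ) : qPoch x q 0 = 1 := by simp [qPoch]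

lemma qPoch_succ (x q : ℝ) (n : ℕ) : qPoch x q (n + 1) = qPoch x q n * (1 - x * q ^ n) :=
  Finset.prod_range_succ _ _

lemma qPoch_succ' (x q : ℝ) (n : ℕ) : qPoch x q (n + 1) = (1 - x) * qPoch (x * q) q n := by
  simp only [qPoch, Finset.prod_range_succ', pow_succ', pow_zero, mul_one, mul_assoc,
    mul_comm (1 - x)]

lemma qPoch_eq_zero {x : ℝ} {i n : ℕ} (hi : i < n) (h : x * q ^ i = 1) : qPoch x q n = 0 :=
  Finset.prod_eq_zero (Finset.mem_range.2 hi) (by rw [h, sub_self])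

lemma qPoch_ne_zero {x : ℝ} (hx : ∀ k : ℕ, x * q ^ k ≠ 1) (n : ℕ) : qPoch x q n ≠ 0 :=
  Finset.prod_ne_zero_iff.2 fun k _ => sub_ne_zero.2 (hx k).symm

lemma mul_pow_lt_one (hq : 0 < q) (hq1 : q < 1) {x : ℝ} (hx : x < 1) (k : ℕ) :
    x * q ^ k < 1 := by
  rcases le_total x 0 with h | h
  · exact (mul_nonpos_of_nonpos_of_nonneg h (pow_nonneg hq.le k)).trans_lt one_pos
  · exact (mul_le_of_le_one_right h (pow_le_one₀ hq.le hq1.le)).trans_lt hx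

lemma qPoch_pos (hq : 0 < q) (hq1 : q < 1) {x : ℝ} (hx : x < 1) (n : ℕ) : 0 < qPoch x q n :=
  Finset.prod_pos fun k _ => sub_pos.2 (mul_pow_lt_one hq hq1 hx k)

lemma summable_mul_pow (hq : 0 < q) (hq1 : q < 1) (x : ℝ) : Summable fun k : ℕ => x * q ^ k :=
  (summable_geometric_of_lt_one hq.le hq1).mul_left x

lemma multipliable_one_sub_mul_pow (hq : 0 < q) (hq1 : q < 1) (x : ℝ) :
    Multipliable fun k : ℕ => 1 - x * q ^ k := by
  simpa only [sub_eq_add_neg] using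
    multipliable_one_add_of_summable (summable_mul_pow hq hq1 x).neg.norm

lemma tendsto_qPoch (hq : 0 < q) (hq1 : q < 1) (x : ℝ) :
    Tendsto (qPoch x q) atTop (𝓝 (qPochInf x q)) :=
  (multipliable_one_sub_mul_pow hq hq1 x).tendsto_prod_tprod_nat

lemma qPochInf_zero (q : ℝ) : qPochInf 0 q = 1 := by simp [qPochInf]

lemma qPochInf_eq_qPoch_mul (hq : 0 < q) (hq1 : q < 1) (x : ℝ) (n : ℕ) :
    qPochInf x q = qPoch x q n * qPochInf (x * q ^ n) q := by
  have h := multipliable_one_sub_mul_pow hq hq1 (x * q ^ n)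
  have shift : (fun k : ℕ => 1 - x * q ^ n * q ^ k) = fun k : ℕ => 1 - x * q ^ (k + n) := by
    ext k; ring
  rw [shift] at h
  rw [qPochInf, qPoch, qPochInf, shift]
  exact (h.prod_mul_tprod_nat_mul' (f := fun k => 1 - x * q ^ k)).symm

lemma qPochInf_eq_one_sub_mul (hq : 0 < q) (hq1 : q < 1) (x : ℝ) :
    qPochInf x q = (1 - x) * qPochInf (x * q) q := by
  simpa [qPoch] using qPochInf_eq_qPoch_mul hq hq1 x 1

lemma qPochInf_pos (hq : 0 < q) (hq1 : q < 1) {x : ℝ} (hx : x < 1) : 0 < qPochInf x q := by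
  have hne : ∏' k : ℕ, (1 + -(x * q ^ k)) ≠ 0 :=
    tprod_one_add_ne_zero_of_summable
      (fun k => by rw [← sub_eq_add_neg]; exact (sub_pos.2 (mul_pow_lt_one hq hq1 hx k)).ne')
      (summable_mul_pow hq hq1 x).neg.norm
  simp only [← sub_eq_add_neg] at hne
  exact (ge_of_tendsto' (tendsto_qPoch hq hq1 x) fun n => (qPoch_pos hq hq1 hx n).le).lt_of_ne'
    hne

lemma one_le_qPochInf (hq : 0 < q) (hq1 : q < 1) {x : ℝ} (hx : x ≤ 0) : 1 ≤ qPochInf x q :=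
  ge_of_tendsto' (tendsto_qPoch hq hq1 x) fun _ => Finset.one_le_prod fun k _ => by
    have := mul_nonpos_of_nonpos_of_nonneg hx (pow_nonneg hq.le k)
    linarith

lemma inv_qPochInf_mul_pow_le (hq : 0 < q) (hq1 : q < 1) {x : ℝ} (hx : x < 1) (n : ℕ) :
    (qPochInf (x * q ^ n) q)⁻¹ ≤ 1 + (qPochInf x q)⁻¹ := by
  have hpos := qPochInf_pos hq hq1 hx
  rcases le_total x 0 with h | h
  · have hle : (qPochInf (x * q ^ n) q)⁻¹ ≤ 1 := inv_le_one_of_one_le₀ <|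
      one_le_qPochInf hq hq1 (mul_nonpos_of_nonpos_of_nonneg h (pow_nonneg hq.le n))
    exact hle.trans (le_add_of_nonneg_right (inv_nonneg.2 hpos.le))
  · have hpoch : qPoch x q n ≤ 1 := Finset.prod_le_one
      (fun k _ => (sub_pos.2 (mul_pow_lt_one hq hq1 hx k)).le)
      fun k _ => sub_le_self _ (mul_nonneg h (pow_nonneg hq.le k))
    have hle : qPochInf x q ≤ qPochInf (x * q ^ n) q := by
      rw [qPochInf_eq_qPoch_mul hq hq1 x n]
      exact mul_le_of_le_one_left (qPochInf_pos hq hq1 (mul_pow_lt_one hq hq1 hx n)).le hpoch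
    exact (inv_anti₀ hpos hle).trans (le_add_of_nonneg_left zero_le_one)

lemma continuous_qPochInf (hq : 0 < q) (hq1 : q < 1) : Continuous fun x => qPochInf x q := by
  rw [continuous_iff_continuousAt]
  intro x
  have h := tendsto_tprod_one_add_of_dominated_convergence (𝓕 := 𝓝 x)
    (f := fun y (k : ℕ) => -(y * q ^ k)) (g := fun k => -(x * q ^ k))
    (bound := fun k => (|x| + 1) * q ^ k) (summable_mul_pow hq hq1 _)
    (fun k => Continuous.tendsto (by fun_prop) x) ?_
  · simpa only [← sub_eq_add_neg, qPochInf, ContinuousAt] using h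
  · filter_upwards [(continuous_abs.tendsto x).eventually_lt_const (lt_add_one _)] with y hy k
    rw [norm_neg, norm_mul, norm_pow, Real.norm_of_nonneg hq.le, Real.norm_eq_abs]
    exact mul_le_mul_of_nonneg_right hy.le (pow_nonneg hq.le k)

lemma qPoch_inv_pow_eq_zero (hq : q ≠ 0) {m k : ℕ} (h : m < k) : qPoch ((q ^ m)⁻¹) q k = 0 :=
  qPoch_eq_zero h (inv_mul_cancel₀ (pow_ne_zero m hq))

lemma qPoch_inv_pow_succ (hq : q ≠ 0) (m k : ℕ) :
    qPoch ((q ^ (m + 1))⁻¹) q (k + 1) = qPoch ((q ^ m)⁻¹) q (k + 1) -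
      (q ^ (m + 1))⁻¹ * (1 - q ^ (k + 1)) * qPoch ((q ^ m)⁻¹) q k := by
  have h : (q ^ (m + 1))⁻¹ * q = (q ^ m)⁻¹ := by rw [pow_succ]; field_simp
  rw [qPoch_succ', qPoch_succ, h, ← h]
  ring

/-- The terminating basic hypergeometric series `₂φ₁(q⁻ᵐ, B; C; q, q)`. -/
def vandermondeSum (q : ℝ) (m : ℕ) (B C : ℝ) : ℝ :=
  ∑ k ∈ Finset.range (m + 1),
    qPoch ((q ^ m)⁻¹) q k * qPoch B q k / (qPoch q q k * qPoch C q k) * q ^ k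

lemma vandermondeSum_eq_sum_range (hq : q ≠ 0) {m M : ℕ} (h : m ≤ M) (B C : ℝ) :
    vandermondeSum q m B C = ∑ k ∈ Finset.range (M + 1),
      qPoch ((q ^ m)⁻¹) q k * qPoch B q k / (qPoch q q k * qPoch C q k) * q ^ k := by
  refine Finset.sum_subset (Finset.range_mono (by lia)) fun k _ hk => ?_
  rw [Finset.mem_range, not_lt] at hk
  simp only [qPoch_inv_pow_eq_zero hq (show m < k by lia), zero_mul, zero_div]

lemma vandermondeSum_succ (hq : 0 < q) (hq1 : q < 1) (m : ℕ) (B : ℝ) {C : ℝ}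
    (hC : ∀ k : ℕ, C * q ^ k ≠ 1) :
    vandermondeSum q (m + 1) B C = vandermondeSum q m B C -
      (q ^ m)⁻¹ * ((1 - B) / (1 - C)) * vandermondeSum q m (B * q) (C * q) := by
  have hq0 := hq.ne'
  rw [vandermondeSum_eq_sum_range hq0 (Nat.le_succ m) B C, vandermondeSum, vandermondeSum,
    Finset.sum_range_succ', Finset.sum_range_succ' _ (m + 1)]
  simp only [qPoch_zero]
  rw [add_sub_right_comm, Finset.mul_sum, ← Finset.sum_sub_distrib]
  congr 1
  refine Finset.sum_congr rfl fun k _ => ?_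
  have hC0 : 1 - C ≠ 0 := sub_ne_zero.2 (by simpa using (hC 0).symm)
  have hqk := (qPoch_pos hq hq1 hq1 k).ne'
  have hqk' : 1 - q ^ (k + 1) ≠ 0 := (sub_pos.2 (pow_lt_one₀ hq.le hq1 k.succ_ne_zero)).ne'
  rw [qPoch_inv_pow_succ hq0, qPoch_succ' B, qPoch_succ' C, qPoch_succ q, ← pow_succ']
  field_simp
  ring

theorem vandermondeSum_eq (hq : 0 < q) (hq1 : q < 1) (m : ℕ) {B C : ℝ} (hB : B ≠ 0)
    (hC : ∀ k : ℕ, C * q ^ k ≠ 1) :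
    vandermondeSum q m B C = qPoch (C / B) q m / qPoch C q m * B ^ m := by
  have hq0 := hq.ne'
  induction m generalizing B C with
  | zero => simp [vandermondeSum, qPoch]
  | succ m ih =>
    have hCq : ∀ k : ℕ, C * q * q ^ k ≠ 1 := fun k => by
      rw [mul_assoc, ← pow_succ']; exact hC (k + 1)
    have hCq0 := qPoch_ne_zero hCq m
    have hC0 : 1 - C ≠ 0 := sub_ne_zero.2 (by simpa using (hC 0).symm)
    have hCm : 1 - C * q ^ m ≠ 0 := sub_ne_zero.2 (hC m).symm
    have hsplit : qPoch C q m = (1 - C) * qPoch (C * q) q m / (1 - C * q ^ m) := by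
      rw [eq_div_iff hCm, ← qPoch_succ, qPoch_succ']
    rw [vandermondeSum_succ hq hq1 m B hC, ih hB hC, ih (mul_ne_zero hB hq0) hCq,
      mul_div_mul_right _ _ hq0, qPoch_succ (C / B), qPoch_succ' C, hsplit]
    field_simp
    ring

end QShiftedFactorial

section JacksonIntegral

variable {q : ℝ}

/-- The one-sided Jackson integral `∫_0^{sq} h(x) d_q x`, divided by `1 - q`. -/
def jacksonHalf (q s : ℝ) (h : ℝ → ℝ) : ℝ := ∑' n : ℕ, s * q ^ (n + 1) * h (s * q ^ (n + 1))

/-- The Jackson integral `∫_{cq}^{aq} h(x) d_q x`, divided by `1 - q`. -/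
def jackson (a c q : ℝ) (h : ℝ → ℝ) : ℝ := jacksonHalf q a h - jacksonHalf q c h

lemma tendsto_mul_pow_succ (hq : 0 < q) (hq1 : q < 1) (s : ℝ) :
    Tendsto (fun n : ℕ => s * q ^ (n + 1)) atTop (𝓝 0) := by
  simpa using ((tendsto_add_atTop_iff_nat 1).2
    (tendsto_pow_atTop_nhds_zero_of_lt_one hq.le hq1)).const_mul s

lemma summable_jacksonHalf (hq : 0 < q) (hq1 : q < 1) {h : ℝ → ℝ} (hh : ContinuousAt h 0)
    (s : ℝ) : Summable fun n : ℕ => s * q ^ (n + 1) * h (s * q ^ (n + 1)) := by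
  have hs : Summable fun n : ℕ => s * q ^ (n + 1) :=
    (summable_mul_pow hq hq1 (s * q)).congr fun n => by ring
  have hbdd : (fun n : ℕ => h (s * q ^ (n + 1))) =O[atTop] fun _ => (1 : ℝ) :=
    (hh.tendsto.comp (tendsto_mul_pow_succ hq hq1 s)).isBigO_one ℝ
  refine summable_of_isBigO_nat hs.norm ?_
  simpa using (Asymptotics.isBigO_refl (fun n : ℕ => s * q ^ (n + 1)) atTop).norm_right.mul hbdd

lemma jacksonHalf_congr {s : ℝ} {h g : ℝ → ℝ}
    (hg : ∀ n : ℕ, h (s * q ^ (n + 1)) = g (s * q ^ (n + 1))) :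
    jacksonHalf q s h = jacksonHalf q s g :=
  tsum_congr fun n => by rw [hg n]

lemma jacksonHalf_add (hq : 0 < q) (hq1 : q < 1) {h g : ℝ → ℝ} (hh : ContinuousAt h 0)
    (hg : ContinuousAt g 0) (s : ℝ) :
    jacksonHalf q s (fun x => h x + g x) = jacksonHalf q s h + jacksonHalf q s g := by
  simp only [jacksonHalf, mul_add]
  exact (summable_jacksonHalf hq hq1 hh s).tsum_add (summable_jacksonHalf hq hq1 hg s)

lemma jacksonHalf_const_mul (q s r : ℝ) (h : ℝ → ℝ) :
    jacksonHalf q s (fun x => r * h x) = r * jacksonHalf q s h := by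
  simp only [jacksonHalf, ← tsum_mul_left, mul_left_comm]

lemma jacksonHalf_one (hq : 0 < q) (hq1 : q < 1) (s : ℝ) :
    jacksonHalf q s (fun _ => 1) = s * q / (1 - q) := by
  simp only [jacksonHalf, mul_one, pow_succ', ← mul_assoc]
  rw [tsum_mul_left, tsum_geometric_of_lt_one hq.le hq1, div_eq_mul_inv]

lemma jackson_congr {a c : ℝ} {h g : ℝ → ℝ}
    (ha : ∀ n : ℕ, h (a * q ^ (n + 1)) = g (a * q ^ (n + 1)))
    (hc : ∀ n : ℕ, h (c * q ^ (n + 1)) = g (c * q ^ (n + 1))) :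
    jackson a c q h = jackson a c q g := by
  rw [jackson, jackson, jacksonHalf_congr ha, jacksonHalf_congr hc]

lemma jacksonHalf_of_qDeriv (hq : 0 < q) (hq1 : q < 1) {s : ℝ} {G h : ℝ → ℝ}
    (hG : ContinuousAt G 0) (hh : ContinuousAt h 0)
    (hGh : ∀ n : ℕ, s * q ^ (n + 1) * h (s * q ^ (n + 1)) =
      G (s * q ^ (n + 1)) - G (q * (s * q ^ (n + 1)))) :
    jacksonHalf q s h = G (s * q) - G 0 := by
  have hpartial (N : ℕ) : ∑ n ∈ Finset.range N, s * q ^ (n + 1) * h (s * q ^ (n + 1)) =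
      G (s * q) - G (s * q ^ (N + 1)) := by
    simp only [hGh, mul_left_comm q s, ← pow_succ']
    simpa using Finset.sum_range_sub' (fun n => G (s * q ^ (n + 1))) N
  refine tendsto_nhds_unique (summable_jacksonHalf hq hq1 hh s).hasSum.tendsto_sum_nat ?_
  simp only [hpartial]
  exact (hG.tendsto.comp (tendsto_mul_pow_succ hq hq1 s)).const_sub _

end JacksonIntegral

section AndrewsAskey

variable {q : ℝ}

/-- The weight `(x/a, x/c; q)_∞ / (αx, βx; q)_∞`. -/
def askeyWeight (a c q α β x : ℝ) : ℝ :=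
  qPochInf (x / a) q * qPochInf (x / c) q / (qPochInf (α * x) q * qPochInf (β * x) q)

/-- `(αx; q)_∞` is positive at all points `aq^{n+1}` and `cq^{n+1}` of the Jackson integral. -/
structure PoleFree (a c q α : ℝ) : Prop where
  left : α * (a * q) < 1
  right : α * (c * q) < 1

lemma PoleFree.mul_pow (hq : 0 < q) (hq1 : q < 1) {a c α : ℝ} (hα : PoleFree a c q α) (N : ℕ) :
    PoleFree a c q (α * q ^ N) where
  left := by rw [mul_right_comm]; exact mul_pow_lt_one hq hq1 hα.left N
  right := by rw [mul_right_comm]; exact mul_pow_lt_one hq hq1 hα.right N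

lemma PoleFree.of_mem (hq : 0 < q) (hq1 : q < 1) {a c α s : ℝ} (hα : PoleFree a c q α)
    (hs : s = a ∨ s = c) (n : ℕ) : α * (s * q ^ (n + 1)) < 1 := by
  rw [pow_succ', ← mul_assoc s, ← mul_assoc α]
  rcases hs with rfl | rfl
  exacts [mul_pow_lt_one hq hq1 hα.left n, mul_pow_lt_one hq hq1 hα.right n]

lemma poleFree_zero (a c q : ℝ) : PoleFree a c q 0 := by constructor <;> simp

lemma askeyWeight_comm (a c q α β x : ℝ) :
    askeyWeight a c q α β x = askeyWeight a c q β α x := by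
  rw [askeyWeight, askeyWeight, mul_comm (qPochInf (α * x) q)]

lemma askeyWeight_zero_right (a c q α β : ℝ) : askeyWeight a c q α β 0 = 1 := by
  simp [askeyWeight, qPochInf_zero]

lemma continuousAt_askeyWeight (hq : 0 < q) (hq1 : q < 1) (a c α β : ℝ) :
    ContinuousAt (askeyWeight a c q α β) 0 := by
  have h := continuous_qPochInf hq hq1
  refine ContinuousAt.div (Continuous.continuousAt ?_) (Continuous.continuousAt ?_) ?_
  · exact (h.comp (continuous_id.div_const a)).mul (h.comp (continuous_id.div_const c))
  · exact (h.comp (continuous_const_mul α)).mul (h.comp (continuous_const_mul β))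
  · simp [qPochInf_zero]

lemma askeyWeight_shift_pow (hq : 0 < q) (hq1 : q < 1) (a c β : ℝ) {α x : ℝ} (hx : α * x < 1)
    (k : ℕ) : askeyWeight a c q (α * q ^ k) β x = qPoch (α * x) q k * askeyWeight a c q α β x := by
  have hk : qPoch (α * x) q k ≠ 0 := (qPoch_pos hq hq1 hx k).ne'
  rw [askeyWeight, askeyWeight, qPochInf_eq_qPoch_mul hq hq1 (α * x) k, mul_right_comm α,
    mul_assoc (qPoch _ _ _), ← mul_div_assoc, mul_div_mul_left _ _ hk]

lemma askeyWeight_shift (hq : 0 < q) (hq1 : q < 1) (a c β : ℝ) {α x : ℝ} (hx : α * x < 1) :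
    askeyWeight a c q (α * q) β x = (1 - α * x) * askeyWeight a c q α β x := by
  simpa [qPoch] using askeyWeight_shift_pow hq hq1 a c β hx 1

lemma askeyWeight_mul_sub (hq : 0 < q) (hq1 : q < 1) {a c α β x : ℝ} (ha : a ≠ 0) (hc : c ≠ 0)
    (hα : α * x < 1) (hβ : β * x < 1) :
    askeyWeight (a * q) (c * q) q α β x - askeyWeight (a * q) (c * q) q α β (q * x) =
      x * ((α + β - (a * q)⁻¹ - (c * q)⁻¹ + ((a * c * q ^ 2)⁻¹ - α * β) * x) *
        askeyWeight a c q α β x) := by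
  have hq0 := hq.ne'
  have numer (s : ℝ) :
      qPochInf (x / (s * q)) q = (1 - x / (s * q)) * qPochInf (x / s) q := by
    rw [qPochInf_eq_one_sub_mul hq hq1 (x / (s * q)), div_mul_eq_mul_div, mul_div_mul_right _ _ hq0]
  have at_x : askeyWeight (a * q) (c * q) q α β x =
      (1 - x / (a * q)) * (1 - x / (c * q)) * askeyWeight a c q α β x := by
    rw [askeyWeight, askeyWeight, numer, numer]; ring
  have at_qx : askeyWeight (a * q) (c * q) q α β (q * x) =
      (1 - α * x) * ((1 - β * x) * askeyWeight a c q α β x) := by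
    rw [askeyWeight_comm a c q α β x, ← askeyWeight_shift hq hq1 a c α hβ,
      askeyWeight_comm a c q (β * q), ← askeyWeight_shift hq hq1 a c _ hα]
    simp only [askeyWeight, mul_comm q x, mul_div_mul_right _ _ hq0, mul_right_comm _ q, mul_assoc]
  rw [at_x, at_qx]
  field_simp
  ring

lemma askeyWeight_mul_eq_zero (hq : 0 < q) (hq1 : q < 1) {a c s : ℝ} (ha : a ≠ 0) (hc : c ≠ 0)
    (hs : s = a ∨ s = c) (α β : ℝ) : askeyWeight (a * q) (c * q) q α β (s * q) = 0 := by
  have hone : qPochInf 1 q = 0 := by rw [qPochInf_eq_one_sub_mul hq hq1, sub_self, zero_mul]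
  rcases hs with rfl | rfl
  · rw [askeyWeight, div_self (mul_ne_zero ha hq.ne'), hone, zero_mul, zero_div]
  · rw [askeyWeight, div_self (mul_ne_zero hc hq.ne'), hone, mul_zero, zero_div]

/-- The inhomogeneous term does not depend on the side, so it cancels in the two-sided integral. -/
lemma jacksonHalf_askeyWeight_shift (hq : 0 < q) (hq1 : q < 1) {a c α β s : ℝ} (ha : a ≠ 0)
    (hc : c ≠ 0) (hα : PoleFree a c q α) (hβ : PoleFree a c q β) (hs : s = a ∨ s = c) :
    (1 - a * c * q ^ 2 * α * β) * jacksonHalf q s (askeyWeight a c q (α * q) β) =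
      (1 - a * q * α) * (1 - c * q * α) * jacksonHalf q s (askeyWeight a c q α β) +
        a * c * q ^ 2 * α := by
  have hq0 := hq.ne'
  set w := askeyWeight a c q α β
  set A := α + β - (a * q)⁻¹ - (c * q)⁻¹ with hA
  set B := (a * c * q ^ 2)⁻¹ - α * β with hB
  have hw : ContinuousAt w 0 := continuousAt_askeyWeight hq hq1 a c α β
  have hxw : ContinuousAt (fun x => x * w x) 0 := continuousAt_id.mul hw
  have hshift : jacksonHalf q s (askeyWeight a c q (α * q) β) =
      jacksonHalf q s w - α * jacksonHalf q s fun x => x * w x := by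
    rw [sub_eq_add_neg, ← neg_mul, ← jacksonHalf_const_mul,
      ← jacksonHalf_add hq hq1 hw (hxw.const_mul (-α))]
    refine jacksonHalf_congr fun n => ?_
    rw [askeyWeight_shift hq hq1 a c β (hα.of_mem hq hq1 hs n)]
    ring
  have hderiv : A * jacksonHalf q s w + B * jacksonHalf q s (fun x => x * w x) = -1 := by
    rw [← jacksonHalf_const_mul, ← jacksonHalf_const_mul,
      ← jacksonHalf_add hq hq1 (hw.const_mul A) (hxw.const_mul B),
      jacksonHalf_of_qDeriv hq hq1 (G := askeyWeight (a * q) (c * q) q α β)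
        (h := fun x => A * w x + B * (x * w x)) (continuousAt_askeyWeight hq hq1 _ _ _ _)
        ((hw.const_mul A).add (hxw.const_mul B)),
      askeyWeight_mul_eq_zero hq hq1 ha hc hs, askeyWeight_zero_right, zero_sub]
    intro n
    rw [askeyWeight_mul_sub hq hq1 ha hc (hα.of_mem hq hq1 hs n) (hβ.of_mem hq hq1 hs n)]
    ring
  have hfactorB : 1 - a * c * q ^ 2 * α * β = a * c * q ^ 2 * B := by rw [hB]; field_simp
  have hfactorA : (1 - a * q * α) * (1 - c * q * α) = a * c * q ^ 2 * (B + α * A) := by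
    rw [hB, hA]; field_simp; ring
  rw [hshift, hfactorB, hfactorA]
  linear_combination (-(a * c * q ^ 2 * α)) * hderiv

lemma jackson_askeyWeight_shift (hq : 0 < q) (hq1 : q < 1) {a c α β : ℝ} (ha : a ≠ 0)
    (hc : c ≠ 0) (hα : PoleFree a c q α) (hβ : PoleFree a c q β) :
    (1 - a * c * q ^ 2 * α * β) * jackson a c q (askeyWeight a c q (α * q) β) =
      (1 - a * q * α) * (1 - c * q * α) * jackson a c q (askeyWeight a c q α β) := by
  rw [jackson, jackson]
  linear_combination jacksonHalf_askeyWeight_shift hq hq1 ha hc hα hβ (.inl rfl) -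
    jacksonHalf_askeyWeight_shift hq hq1 ha hc hα hβ (.inr rfl)

lemma jackson_askeyWeight_shift_pow (hq : 0 < q) (hq1 : q < 1) {a c α β : ℝ} (ha : a ≠ 0)
    (hc : c ≠ 0) (hα : PoleFree a c q α) (hβ : PoleFree a c q β) (N : ℕ) :
    qPoch (a * c * q ^ 2 * α * β) q N * jackson a c q (askeyWeight a c q (α * q ^ N) β) =
      qPoch (a * q * α) q N * qPoch (c * q * α) q N *
        jackson a c q (askeyWeight a c q α β) := by
  induction N with
  | zero => simp [qPoch]
  | succ N ih =>
    have h := jackson_askeyWeight_shift hq hq1 ha hc (hα.mul_pow hq hq1 N) hβ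
    rw [qPoch_succ, qPoch_succ, qPoch_succ, pow_succ q N, ← mul_assoc α]
    linear_combination (1 - a * q * (α * q ^ N)) * (1 - c * q * (α * q ^ N)) * ih +
      qPoch (a * c * q ^ 2 * α * β) q N * h

lemma askeyWeight_eq_zero_mul (a c q α β x : ℝ) :
    askeyWeight a c q α β x = askeyWeight a c q 0 β x * (qPochInf (α * x) q)⁻¹ := by
  rw [askeyWeight, askeyWeight, zero_mul, qPochInf_zero, one_mul, ← div_eq_mul_inv, div_div,
    mul_comm (qPochInf (α * x) q)]

lemma tendsto_askeyWeight_mul_pow (hq : 0 < q) (hq1 : q < 1) (a c α β x : ℝ) :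
    Tendsto (fun N : ℕ => askeyWeight a c q (α * q ^ N) β x) atTop
      (𝓝 (askeyWeight a c q 0 β x)) := by
  have harg : Tendsto (fun N : ℕ => α * q ^ N * x) atTop (𝓝 0) := by
    simpa using ((tendsto_pow_atTop_nhds_zero_of_lt_one hq.le hq1).const_mul α).mul_const x
  have hpoch := (continuous_qPochInf hq hq1).continuousAt.tendsto.comp harg
  rw [qPochInf_zero] at hpoch
  simp only [askeyWeight_eq_zero_mul a c q (α * q ^ _)]
  simpa using (hpoch.inv₀ one_ne_zero).const_mul (askeyWeight a c q 0 β x)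

lemma norm_askeyWeight_mul_pow_le (hq : 0 < q) (hq1 : q < 1) (a c β : ℝ) {α x : ℝ}
    (hx : α * x < 1) (N : ℕ) :
    ‖askeyWeight a c q (α * q ^ N) β x‖ ≤
      ‖askeyWeight a c q 0 β x‖ + ‖askeyWeight a c q α β x‖ := by
  have hpos {y : ℝ} (hy : y < 1) : 0 ≤ (qPochInf y q)⁻¹ :=
    inv_nonneg.2 (qPochInf_pos hq hq1 hy).le
  rw [askeyWeight_eq_zero_mul a c q (α * q ^ N), askeyWeight_eq_zero_mul a c q α, norm_mul,
    norm_mul, mul_right_comm α, Real.norm_of_nonneg (hpos (mul_pow_lt_one hq hq1 hx N)),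
    Real.norm_of_nonneg (hpos hx), ← mul_one_add]
  exact mul_le_mul_of_nonneg_left (inv_qPochInf_mul_pow_le hq hq1 hx N) (norm_nonneg _)

lemma tendsto_jackson_askeyWeight (hq : 0 < q) (hq1 : q < 1) {a c α : ℝ} (β : ℝ)
    (hα : PoleFree a c q α) :
    Tendsto (fun N : ℕ => jackson a c q (askeyWeight a c q (α * q ^ N) β)) atTop
      (𝓝 (jackson a c q (askeyWeight a c q 0 β))) := by
  have hside {s : ℝ} (hs : s = a ∨ s = c) :
      Tendsto (fun N : ℕ => jacksonHalf q s (askeyWeight a c q (α * q ^ N) β)) atTop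
        (𝓝 (jacksonHalf q s (askeyWeight a c q 0 β))) := by
    have hsum (γ : ℝ) :=
      (summable_jacksonHalf hq hq1 (continuousAt_askeyWeight hq hq1 a c γ β) s).norm
    refine tendsto_tsum_of_dominated_convergence ((hsum 0).add (hsum α))
      (fun n => (tendsto_askeyWeight_mul_pow hq hq1 a c α β _).const_mul _)
      (.of_forall fun N n => ?_)
    simp only [norm_mul (s * q ^ (n + 1)), ← mul_add]
    exact mul_le_mul_of_nonneg_left
      (norm_askeyWeight_mul_pow_le hq hq1 a c β (hα.of_mem hq hq1 hs n) N) (norm_nonneg _)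
  exact (hside (.inl rfl)).sub (hside (.inr rfl))

lemma jackson_askeyWeight_eliminate (hq : 0 < q) (hq1 : q < 1) {a c α β : ℝ} (ha : a ≠ 0)
    (hc : c ≠ 0) (hα : PoleFree a c q α) (hβ : PoleFree a c q β) :
    qPochInf (a * c * q ^ 2 * α * β) q * jackson a c q (askeyWeight a c q 0 β) =
      qPochInf (a * q * α) q * qPochInf (c * q * α) q *
        jackson a c q (askeyWeight a c q α β) := by
  refine tendsto_nhds_unique
    ((tendsto_qPoch hq hq1 _).mul (tendsto_jackson_askeyWeight hq hq1 β hα))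
    ((((tendsto_qPoch hq hq1 (a * q * α)).mul (tendsto_qPoch hq hq1 (c * q * α))).mul_const
      _).congr fun N => ?_)
  exact (jackson_askeyWeight_shift_pow hq hq1 ha hc hα hβ N).symm

lemma jackson_askeyWeight_eliminate_both (hq : 0 < q) (hq1 : q < 1) {a c α β : ℝ} (ha : a ≠ 0)
    (hc : c ≠ 0) (hα : PoleFree a c q α) (hβ : PoleFree a c q β) :
    qPochInf (a * c * q ^ 2 * α * β) q * jackson a c q (askeyWeight a c q 0 0) =
      qPochInf (a * q * α) q * qPochInf (c * q * α) q *
        (qPochInf (a * q * β) q * qPochInf (c * q * β) q) *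
        jackson a c q (askeyWeight a c q α β) := by
  have hαβ := jackson_askeyWeight_eliminate hq hq1 ha hc hα hβ
  have hβ0 := jackson_askeyWeight_eliminate hq hq1 ha hc hβ (poleFree_zero a c q)
  rw [mul_zero, qPochInf_zero, one_mul, funext (askeyWeight_comm a c q β 0)] at hβ0
  rw [hβ0]
  linear_combination (qPochInf (a * q * β) q * qPochInf (c * q * β) q) * hαβ

/-- For `α = 1/a` and `β = 1/c` the weight is identically `1` on the lattice. -/
lemma jackson_askeyWeight_inv_inv (hq : 0 < q) (hq1 : q < 1) {a c : ℝ}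
    (ha : PoleFree a c q a⁻¹) (hc : PoleFree a c q c⁻¹) :
    jackson a c q (askeyWeight a c q a⁻¹ c⁻¹) = (a - c) * q / (1 - q) := by
  have hone {s : ℝ} (hs : s = a ∨ s = c) (n : ℕ) :
      askeyWeight a c q a⁻¹ c⁻¹ (s * q ^ (n + 1)) = 1 := by
    have hpos := mul_pos (qPochInf_pos hq hq1 (ha.of_mem hq hq1 hs n))
      (qPochInf_pos hq hq1 (hc.of_mem hq hq1 hs n))
    rw [askeyWeight, div_eq_inv_mul _ a, div_eq_inv_mul _ c, div_self hpos.ne']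
  rw [jackson_congr (g := fun _ => 1) (hone (.inl rfl)) (hone (.inr rfl)), jackson,
    jacksonHalf_one hq hq1, jacksonHalf_one hq hq1]
  ring

lemma poleFree_inv (hq : 0 < q) (hq1 : q < 1) {a c : ℝ} (ha : 0 < a) (hc : c < 0) :
    PoleFree a c q a⁻¹ ∧ PoleFree a c q c⁻¹ := by
  have hneg {s t : ℝ} (hs : 0 < s ∧ t < 0 ∨ s < 0 ∧ 0 < t) : s⁻¹ * (t * q) < 1 := by
    rw [inv_mul_eq_div]
    rcases hs with ⟨hs, ht⟩ | ⟨hs, ht⟩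
    · exact (div_neg_of_neg_of_pos (mul_neg_of_neg_of_pos ht hq) hs).trans one_pos
    · exact (div_neg_of_pos_of_neg (mul_pos ht hq) hs).trans one_pos
  exact ⟨⟨by rwa [inv_mul_cancel_left₀ ha.ne'], hneg (.inl ⟨ha, hc⟩)⟩,
    ⟨hneg (.inr ⟨hc, ha⟩), by rwa [inv_mul_cancel_left₀ hc.ne]⟩⟩

lemma jackson_askeyWeight_zero_zero (hq : 0 < q) (hq1 : q < 1) {a c : ℝ} (ha : 0 < a)
    (hc : c < 0) :
    jackson a c q (askeyWeight a c q 0 0) = a * q * (qPochInf q q * qTheta (c / a) q) := by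
  have hq0 := hq.ne'
  have ha0 := ha.ne'
  have hc0 := hc.ne
  have hqq : qPochInf (q * q) q ≠ 0 := (qPochInf_pos hq hq1 (by nlinarith)).ne'
  have hq' : 1 - q ≠ 0 := (sub_pos.2 hq1).ne'
  obtain ⟨hα, hβ⟩ := poleFree_inv hq hq1 ha hc
  have h := jackson_askeyWeight_eliminate_both hq hq1 ha0 hc0 hα hβ
  rw [jackson_askeyWeight_inv_inv hq hq1 hα hβ,
    show a * c * q ^ 2 * a⁻¹ * c⁻¹ = q * q by field_simp,
    show a * q * a⁻¹ = q by field_simp, show c * q * c⁻¹ = q by field_simp,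
    show c * q * a⁻¹ = c / a * q by ring,
    show a * q * c⁻¹ = q / (c / a) by field_simp] at h
  rw [qTheta, qPochInf_eq_one_sub_mul hq hq1 (c / a)]
  rw [qPochInf_eq_one_sub_mul hq hq1 q] at h ⊢
  apply mul_left_cancel₀ hqq
  rw [h]
  field_simp

/-- The Andrews–Askey integral. -/
theorem jackson_askeyWeight (hq : 0 < q) (hq1 : q < 1) {a c α β : ℝ} (ha : 0 < a)
    (hc : c < 0) (hα : PoleFree a c q α) (hβ : PoleFree a c q β) :
    jackson a c q (askeyWeight a c q α β) =
      a * q * (qPochInf q q * qTheta (c / a) q) * qPochInf (a * c * q ^ 2 * α * β) q /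
      (qPochInf (a * q * α) q * qPochInf (c * q * α) q *
        (qPochInf (a * q * β) q * qPochInf (c * q * β) q)) := by
  have hpos {s γ : ℝ} (h : γ * (s * q) < 1) : qPochInf (s * q * γ) q ≠ 0 :=
    (qPochInf_pos hq hq1 (by rwa [mul_comm])).ne'
  have hD := mul_ne_zero (mul_ne_zero (hpos hα.left) (hpos hα.right))
    (mul_ne_zero (hpos hβ.left) (hpos hβ.right))
  rw [eq_div_iff hD, mul_comm, ← jackson_askeyWeight_eliminate_both hq hq1 ha.ne' hc.ne hα hβ,
    jackson_askeyWeight_zero_zero hq hq1 ha hc, mul_comm]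

end AndrewsAskey

section BigJacobi

variable {a b c q : ℝ}

/-- The parameter range in which the big `q`-Jacobi polynomials are orthogonal on the lattice
`{aq^{n+1}} ∪ {cq^{n+1}}`. -/
structure Admissible (a b c q : ℝ) : Prop where
  q_pos : 0 < q
  q_lt_one : q < 1
  a_pos : 0 < a
  aq_lt_one : a * q < 1
  b_pos : 0 < b
  bq_lt_one : b * q < 1
  c_neg : c < 0

namespace Admissible

lemma cq_lt_one (h : Admissible a b c q) : c * q < 1 :=
  (mul_neg_of_neg_of_pos h.c_neg h.q_pos).trans one_pos

lemma ab_pos (h : Admissible a b c q) : 0 < a * b := mul_pos h.a_pos h.b_pos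

lemma b_div_c_neg (h : Admissible a b c q) : b / c < 0 := div_neg_of_pos_of_neg h.b_pos h.c_neg

lemma abq_div_c_lt_one (h : Admissible a b c q) : a * b * q / c < 1 :=
  (div_neg_of_pos_of_neg (mul_pos h.ab_pos h.q_pos) h.c_neg).trans one_pos

lemma ab_mul_pow_lt_one (h : Admissible a b c q) {j : ℕ} (hj : 2 ≤ j) : a * b * q ^ j < 1 := by
  obtain ⟨i, rfl⟩ := Nat.exists_eq_add_of_le hj
  have habq : a * q * (b * q) < 1 :=
    mul_lt_one_of_nonneg_of_lt_one_left (mul_pos h.a_pos h.q_pos).le h.aq_lt_one h.bq_lt_one.le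
  calc a * b * q ^ (2 + i) = a * q * (b * q) * q ^ i := by ring
    _ < 1 := mul_pow_lt_one h.q_pos h.q_lt_one habq i

lemma qPoch_ne_zero (h : Admissible a b c q) {x : ℝ} (hx : x < 1) (n : ℕ) : qPoch x q n ≠ 0 :=
  (qPoch_pos h.q_pos h.q_lt_one hx n).ne'

lemma qPochInf_ne_zero (h : Admissible a b c q) {x : ℝ} (hx : x < 1) : qPochInf x q ≠ 0 :=
  (qPochInf_pos h.q_pos h.q_lt_one hx).ne'

lemma qPochInf_mul_pow (h : Admissible a b c q) {x : ℝ} (hx : x < 1) (n : ℕ) :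
    qPochInf (x * q ^ n) q = qPochInf x q / qPoch x q n := by
  rw [qPochInf_eq_qPoch_mul h.q_pos h.q_lt_one x n, mul_div_cancel_left₀ _ (h.qPoch_ne_zero hx n)]

lemma poleFree_one (h : Admissible a b c q) : PoleFree a c q 1 where
  left := by rw [one_mul]; exact h.aq_lt_one
  right := by rw [one_mul]; exact h.cq_lt_one

lemma poleFree_b_div_c (h : Admissible a b c q) : PoleFree a c q (b / c) where
  left := (mul_neg_of_neg_of_pos h.b_div_c_neg (mul_pos h.a_pos h.q_pos)).trans one_pos
  right := by rw [← mul_assoc, div_mul_cancel₀ _ h.c_neg.ne]; exact h.bq_lt_one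

end Admissible

/-- The polynomial `(sX; q)_k`. -/
def qPochPoly (s q : ℝ) (k : ℕ) : ℝ[X] := ∏ i ∈ Finset.range k, (1 - C (s * q ^ i) * X)

lemma eval_qPochPoly (s q x : ℝ) (k : ℕ) : (qPochPoly s q k).eval x = qPoch (s * x) q k := by
  simp only [qPochPoly, qPoch, eval_prod, eval_sub, eval_one, eval_mul, eval_C, eval_X,
    mul_right_comm]

lemma one_sub_C_mul_X (r : ℝ) : (1 - C r * X : ℝ[X]) = C (-r) * X + C 1 := by
  rw [C_neg, C_1]; ring

lemma degree_qPochPoly {s : ℝ} (hs : s ≠ 0) (hq : q ≠ 0) (k : ℕ) :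
    (qPochPoly s q k).degree = k := by
  have hfactor (i : ℕ) : (1 - C (s * q ^ i) * X : ℝ[X]).degree = 1 := by
    rw [one_sub_C_mul_X]
    exact degree_linear (neg_ne_zero.2 (mul_ne_zero hs (pow_ne_zero i hq)))
  simp only [qPochPoly, degree_prod, hfactor, Finset.sum_const, Finset.card_range, nsmul_one]

lemma leadingCoeff_qPochPoly {s : ℝ} (hs : s ≠ 0) (hq : q ≠ 0) (k : ℕ) :
    (qPochPoly s q k).leadingCoeff = (-s) ^ k * q ^ k.choose 2 := by
  have hfactor (i : ℕ) : (1 - C (s * q ^ i) * X : ℝ[X]).leadingCoeff = -s * q ^ i := by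
    rw [one_sub_C_mul_X, leadingCoeff_linear (neg_ne_zero.2 (mul_ne_zero hs (pow_ne_zero i hq))),
      neg_mul]
  rw [qPochPoly, leadingCoeff_prod, Finset.prod_congr rfl fun i _ => hfactor i,
    Finset.prod_mul_distrib, Finset.prod_const, Finset.card_range, Finset.prod_pow_eq_pow_sum,
    Finset.sum_range_id, Nat.choose_two_right]

/-- The coefficient of `(x; q)_k` in `P_m(x; a, b, c; q)`. -/
def jacobiCoeff (a b c q : ℝ) (m k : ℕ) : ℝ :=
  qPoch ((q ^ m)⁻¹) q k * qPoch (a * b * q ^ (m + 1)) q k /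
    (qPoch q q k * qPoch (a * q) q k * qPoch (c * q) q k) * q ^ k

/-- `P_m(X; a, b, c; q)` as a polynomial. -/
def jacobiPoly (a b c q : ℝ) (m : ℕ) : ℝ[X] :=
  ∑ k ∈ Finset.range (m + 1), C (jacobiCoeff a b c q m k) * qPochPoly 1 q k

lemma eval_jacobiPoly_eq_sum (a b c q x : ℝ) (m : ℕ) : (jacobiPoly a b c q m).eval x =
    ∑ k ∈ Finset.range (m + 1), jacobiCoeff a b c q m k * qPoch x q k := by
  simp [jacobiPoly, eval_finsetSum, eval_qPochPoly]

lemma eval_jacobiPoly (hq : q ≠ 0) (a b c x : ℝ) (m : ℕ) :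
    (jacobiPoly a b c q m).eval x = bigJacobi m x a b c q := by
  rw [eval_jacobiPoly_eq_sum, bigJacobi, phi32, tsum_eq_sum (s := Finset.range (m + 1))]
  · refine Finset.sum_congr rfl fun k _ => ?_
    rw [jacobiCoeff]; ring
  · intro k hk
    rw [Finset.mem_range, not_lt] at hk
    rw [qPoch_inv_pow_eq_zero hq (show m < k by lia)]
    simp only [zero_mul, zero_div]

lemma qPoch_inv_pow_self (hq : q ≠ 0) (m : ℕ) :
    qPoch ((q ^ m)⁻¹) q m = (-1) ^ m * (q ^ (m + 1).choose 2)⁻¹ * qPoch q q m := by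
  induction m with
  | zero => simp [qPoch]
  | succ m ih =>
    have hshift : (q ^ (m + 1))⁻¹ * q = (q ^ m)⁻¹ := by rw [pow_succ]; field_simp
    rw [qPoch_succ', qPoch_succ, hshift, ih, Nat.choose_succ_succ (m + 1) 1,
      Nat.choose_one_right, pow_add, ← pow_succ']
    field_simp
    ring

namespace Admissible

lemma jacobiCoeff_self_ne_zero (h : Admissible a b c q) (m : ℕ) :
    jacobiCoeff a b c q m m ≠ 0 := by
  have hq0 := h.q_pos.ne'
  have hqm := h.qPoch_ne_zero h.q_lt_one m
  have haqm := h.qPoch_ne_zero h.aq_lt_one m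
  have hcqm := h.qPoch_ne_zero h.cq_lt_one m
  have habm : qPoch (a * b * q ^ (m + 1)) q m ≠ 0 := by
    rcases m with _ | m
    · simp [qPoch]
    · exact h.qPoch_ne_zero (h.ab_mul_pow_lt_one (by lia)) _
  rw [jacobiCoeff, qPoch_inv_pow_self hq0]
  exact mul_ne_zero (div_ne_zero (mul_ne_zero (mul_ne_zero (mul_ne_zero
    (pow_ne_zero _ (neg_ne_zero.2 one_ne_zero)) (inv_ne_zero (pow_ne_zero _ hq0))) hqm) habm)
    (mul_ne_zero (mul_ne_zero hqm haqm) hcqm)) (pow_ne_zero _ hq0)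

lemma degree_jacobiPoly_tail (h : Admissible a b c q) (m : ℕ) :
    (∑ k ∈ Finset.range m, C (jacobiCoeff a b c q m k) * qPochPoly 1 q k).degree < m := by
  rw [← mem_degreeLT]
  refine Submodule.sum_mem _ fun k hk => mem_degreeLT.2 ?_
  refine (degree_mul_le_of_le degree_C_le le_rfl).trans_lt ?_
  rw [degree_qPochPoly one_ne_zero h.q_pos.ne', zero_add]
  exact_mod_cast Finset.mem_range.1 hk

lemma degree_jacobiPoly_head (h : Admissible a b c q) (m : ℕ) :
    (C (jacobiCoeff a b c q m m) * qPochPoly 1 q m).degree = m := by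
  rw [degree_C_mul (h.jacobiCoeff_self_ne_zero m), degree_qPochPoly one_ne_zero h.q_pos.ne']

lemma degree_jacobiPoly (h : Admissible a b c q) (m : ℕ) : (jacobiPoly a b c q m).degree = m := by
  rw [jacobiPoly, Finset.sum_range_succ, degree_add_eq_right_of_degree_lt,
    h.degree_jacobiPoly_head]
  rw [h.degree_jacobiPoly_head]
  exact h.degree_jacobiPoly_tail m

lemma leadingCoeff_jacobiPoly (h : Admissible a b c q) (m : ℕ) :
    (jacobiPoly a b c q m).leadingCoeff =
      jacobiCoeff a b c q m m * ((-1) ^ m * q ^ m.choose 2) := by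
  rw [jacobiPoly, Finset.sum_range_succ, leadingCoeff_add_of_degree_lt, leadingCoeff_mul,
    leadingCoeff_C, leadingCoeff_qPochPoly one_ne_zero h.q_pos.ne']
  rw [h.degree_jacobiPoly_head]
  exact h.degree_jacobiPoly_tail m

/-- The big `q`-Jacobi polynomials as a polynomial sequence. -/
def jacobiSeq (h : Admissible a b c q) : Polynomial.Sequence ℝ :=
  ⟨jacobiPoly a b c q, h.degree_jacobiPoly⟩

lemma span_jacobiPoly (h : Admissible a b c q) :
    Submodule.span ℝ (Set.range (jacobiPoly a b c q)) = ⊤ :=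
  h.jacobiSeq.span fun i => (leadingCoeff_ne_zero.2 (h.jacobiSeq.ne_zero i)).isUnit

/-- The polynomials `((b/c)X; q)_k` as a polynomial sequence; integrating them against the weight
of the big `q`-Jacobi polynomials only shifts a parameter of the weight. -/
def companionSeq (h : Admissible a b c q) : Polynomial.Sequence ℝ :=
  ⟨qPochPoly (b / c) q, degree_qPochPoly h.b_div_c_neg.ne h.q_pos.ne'⟩

lemma degree_jacobiPoly_sub_companion (h : Admissible a b c q) (m : ℕ) :
    (jacobiPoly a b c q m - C (jacobiCoeff a b c q m m * (c / b) ^ m) *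
      qPochPoly (b / c) q m).degree < m := by
  have hb := h.b_pos.ne'
  have hc := h.c_neg.ne
  have hdeg := h.degree_jacobiPoly m
  rw [← hdeg]
  refine degree_sub_lt_left ?_ (fun h0 => by simp [h0] at hdeg) ?_
  · rw [hdeg, degree_C_mul (mul_ne_zero (h.jacobiCoeff_self_ne_zero m)
      (pow_ne_zero _ (div_ne_zero hc hb))), degree_qPochPoly h.b_div_c_neg.ne h.q_pos.ne']
  · have hpow : (c / b) ^ m * (-(b / c)) ^ m = (-1) ^ m := by rw [← mul_pow]; field_simp
    rw [h.leadingCoeff_jacobiPoly, leadingCoeff_mul, leadingCoeff_C,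
      leadingCoeff_qPochPoly h.b_div_c_neg.ne h.q_pos.ne', ← hpow]
    ring

lemma continuousAt_askeyWeight_mul_eval (h : Admissible a b c q) (p : ℝ[X]) :
    ContinuousAt (fun x => askeyWeight a c q 1 (b / c) x * p.eval x) 0 :=
  (continuousAt_askeyWeight h.q_pos h.q_lt_one a c 1 (b / c)).mul p.continuousAt

/-- Integration against the orthogonality weight of the big `q`-Jacobi polynomials. -/
def jacobiInt (h : Admissible a b c q) : ℝ[X] →ₗ[ℝ] ℝ where
  toFun p := jackson a c q fun x => askeyWeight a c q 1 (b / c) x * p.eval x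
  map_add' p r := by
    have hp := h.continuousAt_askeyWeight_mul_eval p
    have hr := h.continuousAt_askeyWeight_mul_eval r
    simp only [jackson, eval_add, mul_add]
    rw [jacksonHalf_add h.q_pos h.q_lt_one hp hr, jacksonHalf_add h.q_pos h.q_lt_one hp hr,
      add_sub_add_comm]
  map_smul' s p := by
    simp only [jackson, eval_smul, smul_eq_mul, mul_left_comm _ s, jacksonHalf_const_mul,
      RingHom.id_apply]
    ring

lemma jacobiInt_apply (h : Admissible a b c q) (p : ℝ[X]) : h.jacobiInt p =
    jackson a c q fun x => askeyWeight a c q 1 (b / c) x * p.eval x := rfl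

end Admissible

/-- The total mass of the orthogonality weight of the big `q`-Jacobi polynomials. -/
def jacobiMass (a b c q : ℝ) : ℝ :=
  a * q * (qPochInf q q * qTheta (c / a) q) * qPochInf (a * b * q ^ 2) q /
    (qPochInf (a * q) q * qPochInf (c * q) q *
      (qPochInf (a * b * q / c) q * qPochInf (b * q) q))

lemma qPoch_add (x q : ℝ) (m n : ℕ) :
    qPoch x q (m + n) = qPoch x q m * qPoch (x * q ^ m) q n := by
  simp only [qPoch, Finset.prod_range_add, pow_add, mul_assoc]

namespace Admissible

lemma jacobiMass_ne_zero (h : Admissible a b c q) : jacobiMass a b c q ≠ 0 := by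
  have hca : c / a < 0 := div_neg_of_neg_of_pos h.c_neg h.a_pos
  have hθ : qTheta (c / a) q ≠ 0 := mul_ne_zero (h.qPochInf_ne_zero (hca.trans one_pos))
    (h.qPochInf_ne_zero ((div_neg_of_pos_of_neg h.q_pos hca).trans one_pos))
  refine div_ne_zero (mul_ne_zero (mul_ne_zero (mul_pos h.a_pos h.q_pos).ne'
    (mul_ne_zero (h.qPochInf_ne_zero h.q_lt_one) hθ))
    (h.qPochInf_ne_zero (h.ab_mul_pow_lt_one le_rfl))) (mul_ne_zero (mul_ne_zero ?_ ?_)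
    (mul_ne_zero ?_ ?_)) <;> apply h.qPochInf_ne_zero
  exacts [h.aq_lt_one, h.cq_lt_one, h.abq_div_c_lt_one, h.bq_lt_one]

lemma jacobiInt_qPochPoly_mul_eq_jackson (h : Admissible a b c q) (k j : ℕ) :
    h.jacobiInt (qPochPoly 1 q k * qPochPoly (b / c) q j) =
      jackson a c q (askeyWeight a c q (1 * q ^ k) (b / c * q ^ j)) := by
  have hq := h.q_pos
  have hq1 := h.q_lt_one
  have hpoint {s : ℝ} (hs : s = a ∨ s = c) (n : ℕ) :
      askeyWeight a c q 1 (b / c) (s * q ^ (n + 1)) *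
        (qPochPoly 1 q k * qPochPoly (b / c) q j).eval (s * q ^ (n + 1)) =
      askeyWeight a c q (1 * q ^ k) (b / c * q ^ j) (s * q ^ (n + 1)) := by
    rw [askeyWeight_shift_pow hq hq1 a c _ (h.poleFree_one.of_mem hq hq1 hs n),
      askeyWeight_comm a c q 1 (b / c * q ^ j),
      askeyWeight_shift_pow hq hq1 a c _ (h.poleFree_b_div_c.of_mem hq hq1 hs n),
      askeyWeight_comm a c q (b / c), eval_mul, eval_qPochPoly, eval_qPochPoly]
    ring
  exact jackson_congr (hpoint (.inl rfl)) (hpoint (.inr rfl))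

lemma jacobiInt_qPochPoly_mul (h : Admissible a b c q) (k j : ℕ) :
    h.jacobiInt (qPochPoly 1 q k * qPochPoly (b / c) q j) =
      jacobiMass a b c q * (qPoch (a * q) q k * qPoch (c * q) q k *
        (qPoch (a * b * q / c) q j * qPoch (b * q) q j) / qPoch (a * b * q ^ 2) q (j + k)) := by
  have hq := h.q_pos
  have hq1 := h.q_lt_one
  have hc := h.c_neg.ne
  rw [jacobiInt_qPochPoly_mul_eq_jackson, jackson_askeyWeight hq hq1 h.a_pos h.c_neg
      (h.poleFree_one.mul_pow hq hq1 k) (h.poleFree_b_div_c.mul_pow hq hq1 j),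
    show a * c * q ^ 2 * (1 * q ^ k) * (b / c * q ^ j) = a * b * q ^ 2 * q ^ (j + k) by
      field_simp; ring,
    show a * q * (b / c * q ^ j) = a * b * q / c * q ^ j by ring,
    show c * q * (b / c * q ^ j) = b * q * q ^ j by field_simp, one_mul,
    h.qPochInf_mul_pow h.aq_lt_one, h.qPochInf_mul_pow h.cq_lt_one,
    h.qPochInf_mul_pow h.abq_div_c_lt_one, h.qPochInf_mul_pow h.bq_lt_one,
    h.qPochInf_mul_pow (h.ab_mul_pow_lt_one le_rfl)]
  simp only [jacobiMass, div_eq_mul_inv, mul_inv, inv_inv]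
  ring

lemma jacobiInt_jacobiPoly_mul (h : Admissible a b c q) (m j : ℕ) :
    h.jacobiInt (jacobiPoly a b c q m * qPochPoly (b / c) q j) =
      jacobiMass a b c q *
        (qPoch (a * b * q / c) q j * qPoch (b * q) q j / qPoch (a * b * q ^ 2) q j) *
        vandermondeSum q m (a * b * q ^ (m + 1)) (a * b * q ^ (j + 2)) := by
  rw [jacobiPoly, Finset.sum_mul, map_sum, vandermondeSum, Finset.mul_sum]
  refine Finset.sum_congr rfl fun k _ => ?_
  rw [mul_assoc (C _), C_mul', map_smul, smul_eq_mul, h.jacobiInt_qPochPoly_mul, jacobiCoeff,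
    qPoch_add, show a * b * q ^ 2 * q ^ j = a * b * q ^ (j + 2) by ring]
  have haq := h.qPoch_ne_zero h.aq_lt_one k
  have hcq := h.qPoch_ne_zero h.cq_lt_one k
  generalize qPoch (a * q) q k = u at haq ⊢
  generalize qPoch (c * q) q k = v at hcq ⊢
  field_simp

lemma vandermondeSum_ab_eq (h : Admissible a b c q) (m j : ℕ) :
    vandermondeSum q m (a * b * q ^ (m + 1)) (a * b * q ^ (j + 2)) =
      qPoch (q ^ (j + 1) / q ^ m) q m / qPoch (a * b * q ^ (j + 2)) q m *
        (a * b * q ^ (m + 1)) ^ m := by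
  have hq0 := h.q_pos.ne'
  rw [vandermondeSum_eq h.q_pos h.q_lt_one m (mul_ne_zero h.ab_pos.ne' (pow_ne_zero _ hq0))
    fun k => (mul_pow_lt_one h.q_pos h.q_lt_one (h.ab_mul_pow_lt_one (by lia)) k).ne,
    mul_div_mul_left _ _ h.ab_pos.ne', pow_succ q (j + 1), pow_succ q m, mul_div_mul_right _ _ hq0]

lemma jacobiInt_jacobiPoly_mul_companion_eq_zero (h : Admissible a b c q) {m j : ℕ} (hj : j < m) :
    h.jacobiInt (jacobiPoly a b c q m * qPochPoly (b / c) q j) = 0 := by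
  have hzero : qPoch (q ^ (j + 1) / q ^ m) q m = 0 := by
    refine qPoch_eq_zero (i := m - 1 - j) (by lia) ?_
    rw [div_mul_eq_mul_div, ← pow_add, show j + 1 + (m - 1 - j) = m by lia,
      div_self (pow_ne_zero _ h.q_pos.ne')]
  rw [h.jacobiInt_jacobiPoly_mul, h.vandermondeSum_ab_eq, hzero, zero_div, zero_mul, mul_zero]

lemma jacobiInt_jacobiPoly_mul_eq_zero (h : Admissible a b c q) {m : ℕ} {p : ℝ[X]}
    (hp : p.degree < m) : h.jacobiInt (jacobiPoly a b c q m * p) = 0 := by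
  rw [← mem_degreeLT, ← h.companionSeq.span_degreeLT (m := m)
    fun i _ => (leadingCoeff_ne_zero.2 (h.companionSeq.ne_zero i)).isUnit] at hp
  induction hp using Submodule.span_induction with
  | mem _ hx =>
    obtain ⟨j, hj, rfl⟩ := hx
    exact h.jacobiInt_jacobiPoly_mul_companion_eq_zero hj
  | zero => rw [mul_zero, map_zero]
  | add x y _ _ hx hy => rw [mul_add, map_add, hx, hy, add_zero]
  | smul r x _ hx => rw [mul_smul_comm, map_smul, hx, smul_zero]

theorem jacobiInt_jacobiPoly_mul_jacobiPoly_of_ne (h : Admissible a b c q) {m n : ℕ}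
    (hmn : m ≠ n) : h.jacobiInt (jacobiPoly a b c q m * jacobiPoly a b c q n) = 0 := by
  wlog hlt : n < m generalizing m n
  · rw [mul_comm]
    exact this hmn.symm (hmn.lt_or_gt.resolve_right hlt)
  exact h.jacobiInt_jacobiPoly_mul_eq_zero (by rw [h.degree_jacobiPoly]; exact_mod_cast hlt)

/-- Modulo lower degree, one factor `P_m` may be replaced by a multiple of the companion
polynomial. -/
lemma jacobiInt_jacobiPoly_mul_self (h : Admissible a b c q) (m : ℕ) :
    h.jacobiInt (jacobiPoly a b c q m * jacobiPoly a b c q m) =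
      jacobiMass a b c q * (jacobiCoeff a b c q m m * (c / b) ^ m *
        (qPoch (a * b * q / c) q m * qPoch (b * q) q m / qPoch (a * b * q ^ 2) q m) *
        (qPoch q q m / qPoch (a * b * q ^ (m + 2)) q m * (a * b * q ^ (m + 1)) ^ m)) := by
  have hsub := h.jacobiInt_jacobiPoly_mul_eq_zero (h.degree_jacobiPoly_sub_companion m)
  rw [mul_sub, map_sub, sub_eq_zero] at hsub
  rw [hsub, mul_left_comm, C_mul', map_smul, smul_eq_mul, h.jacobiInt_jacobiPoly_mul,
    h.vandermondeSum_ab_eq, pow_succ' q m, mul_div_cancel_right₀ _ (pow_ne_zero _ h.q_pos.ne')]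
  ring

end Admissible

lemma vFactor_mul_qPoch (s q : ℝ) (m : ℕ) : vFactor m s q * qPoch (s * q ^ (m + 1)) q m =
    qPoch (s * q ^ 2) q m * qPoch (s * q ^ (m + 2)) q m := by
  rcases m with _ | m
  · simp [vFactor, qPoch]
  · simp only [vFactor, Nat.succ_ne_zero, if_false, Nat.add_sub_cancel]
    rw [qPoch_succ' (s * q ^ (m + 1 + 1)), qPoch_succ (s * q ^ 2), qPoch_succ (s * q ^ (m + 1 + 2)),
      show s * q ^ (m + 1 + 1) * q = s * q ^ (m + 1 + 2) by ring]
    ring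

lemma vWeight_eq_inv_jacobiMass_mul (a b c q : ℝ) (m : ℕ) : vWeight m a b c q =
    (jacobiMass a b c q)⁻¹ * (vFactor m (a * b) q * (qPoch (a * q) q m * qPoch (c * q) q m /
      (qPoch q q m * qPoch (b * q) q m * qPoch (a * b * q / c) q m)) *
      ((-(a * c * q ^ 2)) ^ m)⁻¹ * q ^ (-(1 / 2 : ℝ) * m * (m - 1))) := by
  simp only [vWeight, jacobiMass, div_eq_mul_inv, mul_inv, inv_inv]
  ring

lemma rpow_neg_half_mul (hq : 0 < q) (m : ℕ) :
    q ^ (-(1 / 2 : ℝ) * m * (m - 1)) = (q ^ m.choose 2)⁻¹ := by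
  rw [← Real.rpow_natCast q (m.choose 2), ← Real.rpow_neg hq.le, Nat.cast_choose_two]
  congr 1; ring

lemma choose_two_succ_add_choose_two (m : ℕ) : (m + 1).choose 2 + m.choose 2 = m * m := by
  induction m with
  | zero => rfl
  | succ m ih =>
    rw [Nat.choose_succ_succ (m + 1) 1, Nat.choose_one_right]
    have := Nat.choose_succ_succ m 1
    rw [Nat.choose_one_right] at this
    lia

namespace Admissible

lemma norm_power_identity (h : Admissible a b c q) (m : ℕ) :
    (-1) ^ m * (q ^ (m + 1).choose 2)⁻¹ * q ^ m * (c / b) ^ m * (a * b * q ^ (m + 1)) ^ m *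
      ((-(a * c * q ^ 2)) ^ m)⁻¹ * (q ^ m.choose 2)⁻¹ = 1 := by
  have hq0 := h.q_pos.ne'
  have ha := h.a_pos.ne'
  have hb := h.b_pos.ne'
  have hc := h.c_neg.ne
  have hbase : c / b * (a * b * q ^ (m + 1)) * (-(a * c * q ^ 2))⁻¹ * (-1) * q = q ^ m := by
    field_simp
    ring
  calc _ = (c / b * (a * b * q ^ (m + 1)) * (-(a * c * q ^ 2))⁻¹ * (-1) * q) ^ m *
        (q ^ (m + 1).choose 2 * q ^ m.choose 2)⁻¹ := by
        simp only [mul_pow, inv_pow, mul_inv]; ring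
    _ = 1 := by
      rw [hbase, ← pow_mul, ← pow_add, choose_two_succ_add_choose_two]
      exact mul_inv_cancel₀ (pow_ne_zero _ hq0)

theorem jacobiInt_jacobiPoly_mul_self_mul_vWeight (h : Admissible a b c q) (m : ℕ) :
    h.jacobiInt (jacobiPoly a b c q m * jacobiPoly a b c q m) * vWeight m a b c q = 1 := by
  have hmass := h.jacobiMass_ne_zero
  have hs₂ := h.qPoch_ne_zero (h.ab_mul_pow_lt_one le_rfl) m
  have hs₃ := h.qPoch_ne_zero (h.ab_mul_pow_lt_one (show 2 ≤ m + 2 by lia)) m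
  have hqq := h.qPoch_ne_zero h.q_lt_one m
  have haq := h.qPoch_ne_zero h.aq_lt_one m
  have hcq := h.qPoch_ne_zero h.cq_lt_one m
  have hbq := h.qPoch_ne_zero h.bq_lt_one m
  have habc := h.qPoch_ne_zero h.abq_div_c_lt_one m
  have hpow := h.norm_power_identity m
  have hvFactor := vFactor_mul_qPoch (a * b) q m
  rw [h.jacobiInt_jacobiPoly_mul_self, vWeight_eq_inv_jacobiMass_mul, jacobiCoeff,
    qPoch_inv_pow_self h.q_pos.ne', rpow_neg_half_mul h.q_pos]
  calc _ = (-1) ^ m * (q ^ (m + 1).choose 2)⁻¹ * q ^ m * (c / b) ^ m * (a * b * q ^ (m + 1)) ^ m *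
        ((-(a * c * q ^ 2)) ^ m)⁻¹ * (q ^ m.choose 2)⁻¹ *
        (vFactor m (a * b) q * qPoch (a * b * q ^ (m + 1)) q m) /
        (qPoch (a * b * q ^ 2) q m * qPoch (a * b * q ^ (m + 2)) q m) := by
          clear hpow hvFactor
          generalize jacobiMass a b c q = M, vFactor m (a * b) q = v, qPoch q q m = u₁,
            qPoch (a * q) q m = u₂, qPoch (b * q) q m = u₃, qPoch (c * q) q m = u₄,
            qPoch (a * b * q / c) q m = u₅, qPoch (a * b * q ^ (m + 1)) q m = s₁,
            qPoch (a * b * q ^ 2) q m = s₂, qPoch (a * b * q ^ (m + 2)) q m = s₃,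
            (q ^ (m + 1).choose 2)⁻¹ = r₁, (q ^ m.choose 2)⁻¹ = r₂,
            ((-(a * c * q ^ 2)) ^ m)⁻¹ = r₃, (a * b * q ^ (m + 1)) ^ m = r₄, (c / b) ^ m = r₅,
            q ^ m = r₆, (-1 : ℝ) ^ m = r₇ at *
          field_simp
    _ = 1 := by rw [hpow, hvFactor, one_mul, div_self (mul_ne_zero hs₂ hs₃)]

end Admissible

end BigJacobi

section Moments

variable {ι : Type*} {pt : ι → ℝ} {α β : ℝ} {h : ι → ℂ}

lemma summable_mul_continuous (hpt : ∀ i, pt i ∈ Set.Icc α β) (hh : Summable fun i => ‖h i‖)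
    {f : ℝ → ℝ} (hf : Continuous f) : Summable fun i => h i * (f (pt i) : ℂ) := by
  obtain ⟨C, hC⟩ := isCompact_Icc.exists_bound_of_continuousOn (hf.continuousOn (s := Set.Icc α β))
  refine Summable.of_norm_bounded (hh.mul_right C) fun i => ?_
  rw [norm_mul, Complex.norm_real]
  exact mul_le_mul_of_nonneg_left (hC _ (hpt i)) (norm_nonneg _)

/-- The moment functional `p ↦ ∑ hᵢ p(xᵢ)` of the point masses `hᵢ` at the points `xᵢ` of a bounded
interval. -/
def moment (hpt : ∀ i, pt i ∈ Set.Icc α β) (hh : Summable fun i => ‖h i‖) : ℝ[X] →ₗ[ℝ] ℂ where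
  toFun p := ∑' i, h i * ((p.eval (pt i) : ℝ) : ℂ)
  map_add' p r := by
    rw [← (summable_mul_continuous hpt hh p.continuous).tsum_add
      (summable_mul_continuous hpt hh r.continuous)]
    simp only [eval_add, Complex.ofReal_add, mul_add]
  map_smul' r p := by
    simp only [eval_smul, smul_eq_mul, Complex.ofReal_mul, RingHom.id_apply, Complex.real_smul,
      mul_left_comm (h _), tsum_mul_left]

lemma moment_apply (hpt : ∀ i, pt i ∈ Set.Icc α β) (hh : Summable fun i => ‖h i‖) (p : ℝ[X]) :
    moment hpt hh p = ∑' i, h i * ((p.eval (pt i) : ℝ) : ℂ) := rfl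

/-- By the Weierstrass approximation theorem the moments determine the integrals of all continuous
functions. -/
lemma tsum_mul_continuous_eq_zero (hpt : ∀ i, pt i ∈ Set.Icc α β) (hh : Summable fun i => ‖h i‖)
    (hmom : moment hpt hh = 0) {f : ℝ → ℝ} (hf : Continuous f) :
    ∑' i, h i * (f (pt i) : ℂ) = 0 := by
  rw [← norm_le_zero_iff]
  refine le_of_forall_pos_le_add fun ε hε => ?_
  set S := ∑' i, ‖h i‖
  have : 0 ≤ S := tsum_nonneg fun _ => norm_nonneg _
  obtain ⟨p, hp⟩ := exists_polynomial_near_of_continuousOn α β f hf.continuousOn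
    (ε / (S + 1)) (by positivity)
  have hsub : ∑' i, h i * (f (pt i) : ℂ) = ∑' i, h i * ((f (pt i) - p.eval (pt i) : ℝ) : ℂ) := by
    rw [← sub_zero (∑' i, h i * (f (pt i) : ℂ)), ← LinearMap.zero_apply (σ₁₂ := RingHom.id ℝ) p,
      ← hmom, moment_apply, ← (summable_mul_continuous hpt hh hf).tsum_sub
        (summable_mul_continuous hpt hh p.continuous)]
    simp only [Complex.ofReal_sub, mul_sub]
  have hle (i) : ‖h i * ((f (pt i) - p.eval (pt i) : ℝ) : ℂ)‖ ≤ ‖h i‖ * (ε / (S + 1)) := by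
    rw [norm_mul, Complex.norm_real, Real.norm_eq_abs, abs_sub_comm]
    exact mul_le_mul_of_nonneg_left (hp _ (hpt i)).le (norm_nonneg _)
  calc ‖∑' i, h i * (f (pt i) : ℂ)‖ ≤ S * (ε / (S + 1)) := by
        rw [hsub, ← tsum_mul_right]
        exact tsum_of_norm_bounded (hh.mul_right _).hasSum hle
    _ ≤ 0 + ε := by
        rw [zero_add, mul_div_assoc', div_le_iff₀ (by positivity)]
        nlinarith

lemma eq_zero_of_moment_eq_zero (hpt : ∀ i, pt i ∈ Set.Icc α β) (hh : Summable fun i => ‖h i‖)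
    (hmom : moment hpt hh = 0) {i : ι} {δ : ℝ} (hδ : 0 < δ)
    (hiso : ∀ j, j ≠ i → δ ≤ |pt j - pt i|) : h i = 0 := by
  let bump : ℝ → ℝ := fun x => max 0 (1 - |x - pt i| / δ)
  have bump_self : bump (pt i) = 1 := by simp [bump]
  have bump_of_ne (j) (hj : j ≠ i) : bump (pt j) = 0 :=
    max_eq_left (sub_nonpos.2 ((one_le_div hδ).2 (hiso j hj)))
  calc h i = ∑' j, h j * (bump (pt j) : ℂ) := by
        rw [tsum_eq_single i fun j hj => by rw [bump_of_ne j hj, Complex.ofReal_zero, mul_zero],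
          bump_self, Complex.ofReal_one, mul_one]
    _ = 0 := tsum_mul_continuous_eq_zero hpt hh hmom (by fun_prop)

end Moments

section Lattice

variable {a b c q : ℝ}

/-- The lattice points `aq^{n+1}` and `cq^{n+1}`. -/
def latticePt (a c q : ℝ) : ℕ ⊕ ℕ → ℝ :=
  Sum.elim (fun n => a * q ^ (n + 1)) fun n => c * q ^ (n + 1)

/-- The masses of the orthogonality measure of the big `q`-Jacobi polynomials. -/
def latticeWt (a b c q : ℝ) (i : ℕ ⊕ ℕ) : ℝ :=
  |latticePt a c q i| * uWeight (latticePt a c q i) a b c q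

/-- The sign `1` on the first and `(-1)^n` on the second half of the lattice. -/
def latticeSign : ℕ ⊕ ℕ → ℝ := Sum.elim (fun _ => 1) fun n => (-1) ^ n

lemma latticeSign_mul_self (i : ℕ ⊕ ℕ) : latticeSign i * latticeSign i = 1 := by
  rcases i with n | n <;> simp [latticeSign, ← mul_pow]

/-- The functions `x ↦ r_x(m)` on the lattice, with the signs of `Θ`. -/
def jacobiCol (a b c q : ℝ) (m : ℕ) (i : ℕ ⊕ ℕ) : ℝ :=
  latticeSign i * rFun (latticePt a c q i) m a b c q

lemma uWeight_eq_askeyWeight (a b c q x : ℝ) :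
    uWeight x a b c q = askeyWeight a c q 1 (b / c) x := by
  rw [uWeight, askeyWeight, one_mul, mul_div_right_comm b]

lemma PoleFree.mul_latticePt_lt_one (hq : 0 < q) (hq1 : q < 1) {α : ℝ} (hα : PoleFree a c q α)
    (i : ℕ ⊕ ℕ) : α * latticePt a c q i < 1 := by
  rcases i with n | n
  exacts [hα.of_mem hq hq1 (.inl rfl) n, hα.of_mem hq hq1 (.inr rfl) n]

lemma mul_one_sub_le_abs_sub_pow (hq : 0 < q) (hq1 : q < 1) (s : ℝ) {j n : ℕ} (hj : j ≠ n) :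
    |s| * q ^ (n + 1) * (1 - q) ≤ |s * q ^ (j + 1) - s * q ^ (n + 1)| := by
  have hpow {k l : ℕ} (hkl : k ≤ l) : q ^ l ≤ q ^ k := pow_le_pow_of_le_one hq.le hq1.le hkl
  rw [← mul_sub, abs_mul, mul_assoc]
  refine mul_le_mul_of_nonneg_left ?_ (abs_nonneg s)
  rcases lt_or_gt_of_ne hj with h | h
  · refine le_trans ?_ (le_abs_self _)
    nlinarith [hpow (show j + 1 ≤ n from h), pow_pos hq n, pow_succ q n, sq_nonneg (1 - q)]
  · refine le_trans ?_ (neg_le_abs _)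
    nlinarith [hpow (show n + 1 + 1 ≤ j + 1 by omega), pow_succ q (n + 1)]

namespace Admissible

lemma latticePt_inl_pos (h : Admissible a b c q) (n : ℕ) : 0 < latticePt a c q (.inl n) :=
  mul_pos h.a_pos (pow_pos h.q_pos _)

lemma latticePt_inr_neg (h : Admissible a b c q) (n : ℕ) : latticePt a c q (.inr n) < 0 :=
  mul_neg_of_neg_of_pos h.c_neg (pow_pos h.q_pos _)

lemma latticePt_ne_zero (h : Admissible a b c q) (i : ℕ ⊕ ℕ) : latticePt a c q i ≠ 0 := by
  rcases i with n | n
  exacts [(h.latticePt_inl_pos n).ne', (h.latticePt_inr_neg n).ne]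

lemma latticePt_mem_Icc (h : Admissible a b c q) (i : ℕ ⊕ ℕ) :
    latticePt a c q i ∈ Set.Icc c a := by
  have pow_le (n : ℕ) : q ^ (n + 1) ≤ 1 := pow_le_one₀ h.q_pos.le h.q_lt_one.le
  rcases i with n | n
  · exact ⟨(h.c_neg.trans (h.latticePt_inl_pos n)).le,
      mul_le_of_le_one_right h.a_pos.le (pow_le n)⟩
  · exact ⟨le_mul_of_le_one_right h.c_neg.le (pow_le n),
      ((h.latticePt_inr_neg n).trans h.a_pos).le⟩

lemma latticePt_isolated (h : Admissible a b c q) (i : ℕ ⊕ ℕ) :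
    ∃ δ > 0, ∀ j, j ≠ i → δ ≤ |latticePt a c q j - latticePt a c q i| := by
  refine ⟨|latticePt a c q i| * (1 - q), mul_pos (abs_pos.2 (h.latticePt_ne_zero i))
    (sub_pos.2 h.q_lt_one), fun j hj => ?_⟩
  have opposite {x y : ℝ} (hxy : 0 < x ∧ y < 0 ∨ x < 0 ∧ 0 < y) : |x| * (1 - q) ≤ |y - x| := by
    refine (mul_le_of_le_one_right (abs_nonneg x) (by linarith [h.q_pos])).trans ?_
    rcases hxy with ⟨hx, hy⟩ | ⟨hx, hy⟩
    · rw [abs_of_pos hx, abs_of_neg] <;> linarith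
    · rw [abs_of_neg hx, abs_of_pos] <;> linarith
  have sameSide (s : ℝ) {m n : ℕ} (hmn : m ≠ n) :
      |s * q ^ (n + 1)| * (1 - q) ≤ |s * q ^ (m + 1) - s * q ^ (n + 1)| := by
    rw [abs_mul s, abs_of_pos (pow_pos h.q_pos _)]
    exact mul_one_sub_le_abs_sub_pow h.q_pos h.q_lt_one s hmn
  rcases i with n | n <;> rcases j with m | m
  · exact sameSide a fun e => hj (congrArg Sum.inl e)
  · exact opposite (.inl ⟨h.latticePt_inl_pos n, h.latticePt_inr_neg m⟩)
  · exact opposite (.inr ⟨h.latticePt_inr_neg n, h.latticePt_inl_pos m⟩)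
  · exact sameSide c fun e => hj (congrArg Sum.inr e)

lemma uWeight_latticePt_pos (h : Admissible a b c q) (i : ℕ ⊕ ℕ) :
    0 < uWeight (latticePt a c q i) a b c q := by
  have hfactor {α : ℝ} (hα : PoleFree a c q α) : 0 < qPochInf (α * latticePt a c q i) q :=
    qPochInf_pos h.q_pos h.q_lt_one (hα.mul_latticePt_lt_one h.q_pos h.q_lt_one i)
  obtain ⟨hinv_a, hinv_c⟩ := poleFree_inv h.q_pos h.q_lt_one h.a_pos h.c_neg
  rw [uWeight_eq_askeyWeight, askeyWeight, ← inv_mul_eq_div a, ← inv_mul_eq_div c]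
  exact div_pos (mul_pos (hfactor hinv_a) (hfactor hinv_c))
    (mul_pos (hfactor h.poleFree_one) (hfactor h.poleFree_b_div_c))

lemma latticeWt_pos (h : Admissible a b c q) (i : ℕ ⊕ ℕ) : 0 < latticeWt a b c q i :=
  mul_pos (abs_pos.2 (h.latticePt_ne_zero i)) (h.uWeight_latticePt_pos i)

lemma hasSum_latticeWt_mul_eval (h : Admissible a b c q) (p : ℝ[X]) :
    HasSum (fun i => latticeWt a b c q i * p.eval (latticePt a c q i)) (h.jacobiInt p) := by
  have hside (s) := (summable_jacksonHalf h.q_pos h.q_lt_one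
    (h.continuousAt_askeyWeight_mul_eval p) s).hasSum
  rw [jacobiInt_apply, jackson, sub_eq_add_neg]
  refine HasSum.sum ((hside a).congr_fun fun n => ?_) ((hside c).neg.congr_fun fun n => ?_)
  · rw [Function.comp_apply, latticeWt, abs_of_pos (h.latticePt_inl_pos n),
      uWeight_eq_askeyWeight, mul_assoc]
    rfl
  · rw [Function.comp_apply, latticeWt, abs_of_neg (h.latticePt_inr_neg n),
      uWeight_eq_askeyWeight, mul_assoc, neg_mul]
    rfl

lemma vWeight_pos (h : Admissible a b c q) (m : ℕ) : 0 < vWeight m a b c q := by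
  refine pos_of_mul_pos_right (h.jacobiInt_jacobiPoly_mul_self_mul_vWeight m ▸ one_pos) ?_
  refine (h.hasSum_latticeWt_mul_eval _).nonneg fun i => ?_
  rw [eval_mul]
  exact mul_nonneg (h.latticeWt_pos i).le (mul_self_nonneg _)

lemma rFun_latticePt (h : Admissible a b c q) (m : ℕ) (i : ℕ ⊕ ℕ) :
    rFun (latticePt a c q i) m a b c q =
      √(latticeWt a b c q i) * √(vWeight m a b c q) *
        (jacobiPoly a b c q m).eval (latticePt a c q i) := by
  rw [rFun, eval_jacobiPoly h.q_pos.ne', ← Real.sqrt_mul (h.latticeWt_pos i).le, latticeWt]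

end Admissible

end Lattice

section Completeness

variable {a b c q : ℝ}

namespace Admissible

lemma sqrt_vWeight_mul_jacobiInt (h : Admissible a b c q) (m n : ℕ) :
    √(vWeight m a b c q) * √(vWeight n a b c q) *
      h.jacobiInt (jacobiPoly a b c q m * jacobiPoly a b c q n) = if m = n then 1 else 0 := by
  split_ifs with hmn
  · rw [hmn, Real.mul_self_sqrt (h.vWeight_pos n).le, mul_comm,
      h.jacobiInt_jacobiPoly_mul_self_mul_vWeight]
  · rw [h.jacobiInt_jacobiPoly_mul_jacobiPoly_of_ne hmn, mul_zero]

lemma hasSum_jacobiCol_mul (h : Admissible a b c q) (m n : ℕ) :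
    HasSum (fun i => jacobiCol a b c q m i * jacobiCol a b c q n i) (if m = n then 1 else 0) := by
  rw [← h.sqrt_vWeight_mul_jacobiInt m n]
  refine ((h.hasSum_latticeWt_mul_eval _).mul_left _).congr_fun fun i => ?_
  rw [jacobiCol, jacobiCol, h.rFun_latticePt, h.rFun_latticePt, eval_mul]
  calc _ = (latticeSign i * latticeSign i) * (√(latticeWt a b c q i) * √(latticeWt a b c q i)) *
        (√(vWeight m a b c q) * √(vWeight n a b c q)) *
        ((jacobiPoly a b c q m).eval (latticePt a c q i) *
          (jacobiPoly a b c q n).eval (latticePt a c q i)) := by ring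
    _ = _ := by
      rw [Real.mul_self_sqrt (h.latticeWt_pos i).le, latticeSign_mul_self]
      ring

lemma memℓp_jacobiCol (h : Admissible a b c q) (m : ℕ) :
    Memℓp (fun i : ℕ ⊕ ℕ => (jacobiCol a b c q m i : ℂ)) 2 := by
  refine memℓp_gen ((h.hasSum_jacobiCol_mul m m).summable.congr fun i => ?_)
  rw [Complex.norm_real, ENNReal.toReal_ofNat, Real.rpow_two, Real.norm_eq_abs, sq_abs, sq]

/-- The function `jacobiCol a b c q m` as a vector of `ℓ²(ℕ ⊕ ℕ)`. -/
def colVec (h : Admissible a b c q) (m : ℕ) : lp (fun _ : ℕ ⊕ ℕ => ℂ) 2 :=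
  ⟨fun i => (jacobiCol a b c q m i : ℂ), h.memℓp_jacobiCol m⟩

lemma colVec_apply (h : Admissible a b c q) (m : ℕ) (i : ℕ ⊕ ℕ) :
    h.colVec m i = (jacobiCol a b c q m i : ℂ) := rfl

lemma orthonormal_colVec (h : Admissible a b c q) : Orthonormal ℂ h.colVec := by
  classical
  rw [orthonormal_iff_ite]
  intro m n
  have hsum := Complex.hasSum_ofReal.2 (h.hasSum_jacobiCol_mul m n)
  rw [lp.inner_eq_tsum, ← Complex.ofReal_one, ← Complex.ofReal_zero, ← apply_ite, ← hsum.tsum_eq]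
  refine tsum_congr fun i => ?_
  rw [colVec_apply, colVec_apply, RCLike.inner_apply, Complex.conj_ofReal, mul_comm,
    Complex.ofReal_mul]

lemma memℓp_sqrt_latticeWt (h : Admissible a b c q) :
    Memℓp (fun i : ℕ ⊕ ℕ => ((latticeSign i * √(latticeWt a b c q i) : ℝ) : ℂ)) 2 := by
  refine memℓp_gen ((h.hasSum_latticeWt_mul_eval 1).summable.congr fun i => ?_)
  rw [Complex.norm_real, ENNReal.toReal_ofNat, Real.rpow_two, Real.norm_eq_abs, sq_abs, sq,
    mul_mul_mul_comm, latticeSign_mul_self, Real.mul_self_sqrt (h.latticeWt_pos i).le, eval_one,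
    mul_one, one_mul]

/-- Multiplying `g` by the square roots of the weights gives a summable family of point masses on
the lattice; orthogonality to all columns says that its moments vanish. -/
theorem eq_zero_of_inner_colVec (h : Admissible a b c q) (g : lp (fun _ : ℕ ⊕ ℕ => ℂ) 2)
    (hg : ∀ m, inner ℂ (h.colVec m) g = 0) : g = 0 := by
  let s : ℕ ⊕ ℕ → ℝ := fun i => latticeSign i * √(latticeWt a b c q i)
  have hs (i) : (s i : ℂ) ≠ 0 := Complex.ofReal_ne_zero.2 <|
    mul_ne_zero (left_ne_zero_of_mul_eq_one (latticeSign_mul_self i))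
      (Real.sqrt_pos.2 (h.latticeWt_pos i)).ne'
  have hsummable : Summable fun i => ‖(s i : ℂ) * g i‖ := by
    simp only [norm_mul]
    exact lp.summable_mul (by rw [Real.holderConjugate_iff]; norm_num)
      (⟨_, h.memℓp_sqrt_latticeWt⟩ : lp (fun _ : ℕ ⊕ ℕ => ℂ) 2) g
  have hmom : moment h.latticePt_mem_Icc hsummable = 0 := by
    refine LinearMap.ext_on h.span_jacobiPoly ?_
    rintro _ ⟨m, rfl⟩
    have hv : ((√(vWeight m a b c q) : ℝ) : ℂ) ≠ 0 :=
      Complex.ofReal_ne_zero.2 (Real.sqrt_pos.2 (h.vWeight_pos m)).ne'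
    refine mul_left_cancel₀ hv ?_
    rw [LinearMap.zero_apply, mul_zero, ← hg m, moment_apply, lp.inner_eq_tsum, ← tsum_mul_left]
    refine tsum_congr fun i => ?_
    rw [colVec_apply, RCLike.inner_apply, Complex.conj_ofReal, jacobiCol, h.rFun_latticePt]
    push_cast [s]
    ring
  ext i
  obtain ⟨δ, hδ, hiso⟩ := h.latticePt_isolated i
  exact (mul_eq_zero.1 (eq_zero_of_moment_eq_zero _ _ hmom hδ hiso)).resolve_left (hs i)

/-- The Hilbert basis of `ℓ²(ℕ ⊕ ℕ)` given by the big `q`-Jacobi polynomials. -/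
def colBasis (h : Admissible a b c q) : HilbertBasis ℕ ℂ (lp (fun _ : ℕ ⊕ ℕ => ℂ) 2) :=
  HilbertBasis.mkOfOrthogonalEqBot h.orthonormal_colVec <|
    (Submodule.eq_bot_iff _).2 fun g hg => h.eq_zero_of_inner_colVec g fun m =>
      (Submodule.mem_orthogonal _ g).1 hg _ (Submodule.subset_span ⟨m, rfl⟩)

lemma colBasis_repr_single (h : Admissible a b c q) (i : ℕ ⊕ ℕ) (m : ℕ) :
    h.colBasis.repr (lp.single 2 i (1 : ℂ)) m = (jacobiCol a b c q m i : ℂ) := by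
  rw [HilbertBasis.repr_apply_apply, colBasis, HilbertBasis.coe_mkOfOrthogonalEqBot,
    lp.inner_single_right, colVec_apply, RCLike.inner_apply, Complex.conj_ofReal, one_mul]

end Admissible

end Completeness

section QDifferenceEquation

variable {a b c q : ℝ}

/-- The coefficient of `y(qx) - y(x)` in the `q`-difference equation. -/
def raiseCoeff (a b c q x : ℝ) : ℝ := a * q * (1 - x) * (b * x - c) / x ^ 2

/-- The coefficient of `y(x/q) - y(x)` in the `q`-difference equation. -/
def lowerCoeff (a c q x : ℝ) : ℝ := -((x - a * q) * (x - c * q)) / x ^ 2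

/-- Minus the eigenvalue of the `q`-difference operator on polynomials of degree `m`. -/
def diffEigenvalue (a b q : ℝ) (m : ℕ) : ℝ := (q ^ m)⁻¹ * (1 - q ^ m) * (1 - a * b * q ^ (m + 1))

/-- The `q`-difference operator is upper triangular in the basis `(x; q)_k`. -/
lemma qPoch_difference (hq : q ≠ 0) (a b c : ℝ) {x : ℝ} (hx : x ≠ 0) (k : ℕ) :
    raiseCoeff a b c q x * (qPoch (q * x) q k - qPoch x q k) +
      lowerCoeff a c q x * (qPoch (x / q) q k - qPoch x q k) =
    (q ^ k)⁻¹ * (1 - q ^ k) * ((1 - a * q ^ k) * (1 - c * q ^ k)) * qPoch x q (k - 1) -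
      diffEigenvalue a b q k * qPoch x q k := by
  rcases k with _ | k
  · simp [qPoch, diffEigenvalue]
  have hqk := pow_ne_zero k hq
  have shift_div : qPoch (x / q) q (k + 1) = (1 - x / q) * qPoch x q k := by
    rw [qPoch_succ', div_mul_cancel₀ _ hq]
  have shift_mul : (1 - x) * qPoch (q * x) q k = qPoch x q k * (1 - x * q ^ k) := by
    rw [mul_comm q x, ← qPoch_succ', qPoch_succ]
  have raise : raiseCoeff a b c q x * (qPoch (q * x) q (k + 1) - qPoch x q (k + 1)) =
      a * q * (b * x - c) / x ^ 2 * (qPoch x q k * (1 - x * q ^ k)) * (x * (1 - q ^ (k + 1))) := by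
    rw [qPoch_succ (q * x), qPoch_succ x, raiseCoeff, ← shift_mul]
    ring
  rw [raise, shift_div, qPoch_succ x, Nat.add_sub_cancel, lowerCoeff, diffEigenvalue, pow_succ q k]
  field_simp
  ring

lemma jacobiCoeff_succ (h : Admissible a b c q) (m k : ℕ) :
    jacobiCoeff a b c q m (k + 1) * ((q ^ (k + 1))⁻¹ * (1 - q ^ (k + 1)) *
      ((1 - a * q ^ (k + 1)) * (1 - c * q ^ (k + 1)))) =
    jacobiCoeff a b c q m k * (diffEigenvalue a b q k - diffEigenvalue a b q m) := by
  have hqpow (j : ℕ) := pow_ne_zero j h.q_pos.ne'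
  have hfactor {s : ℝ} (hs : s * q < 1) : 1 - s * q * q ^ k ≠ 0 ∧ qPoch (s * q) q k ≠ 0 :=
    ⟨(sub_pos.2 (mul_pow_lt_one h.q_pos h.q_lt_one hs k)).ne', h.qPoch_ne_zero hs k⟩
  obtain ⟨hq', hQ⟩ := hfactor (s := 1) (by rw [one_mul]; exact h.q_lt_one)
  obtain ⟨ha', hA⟩ := hfactor h.aq_lt_one
  obtain ⟨hc', hC⟩ := hfactor h.cq_lt_one
  have regroup (s : ℝ) : s * q ^ (k + 1) = s * q * q ^ k := by ring
  rw [one_mul] at hq' hQ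
  rw [jacobiCoeff, jacobiCoeff, diffEigenvalue, diffEigenvalue, qPoch_succ, qPoch_succ, qPoch_succ,
    qPoch_succ, qPoch_succ, regroup a, regroup c, pow_succ' q k]
  generalize qPoch (a * q) q k = A at *
  generalize qPoch (c * q) q k = C at *
  generalize qPoch q q k = Q at *
  generalize 1 - q * q ^ k = u at *
  generalize 1 - a * q * q ^ k = v at *
  generalize 1 - c * q * q ^ k = w at *
  have := hqpow k
  have := hqpow m
  have := h.q_pos.ne'
  rw [pow_succ q m]
  field_simp
  ring

theorem jacobiPoly_difference (h : Admissible a b c q) (m : ℕ) {x : ℝ} (hx : x ≠ 0) :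
    raiseCoeff a b c q x *
        ((jacobiPoly a b c q m).eval (q * x) - (jacobiPoly a b c q m).eval x) +
      lowerCoeff a c q x *
        ((jacobiPoly a b c q m).eval (x / q) - (jacobiPoly a b c q m).eval x) =
    -diffEigenvalue a b q m * (jacobiPoly a b c q m).eval x := by
  simp only [eval_jacobiPoly_eq_sum, ← Finset.sum_sub_distrib, Finset.mul_sum,
    ← Finset.sum_add_distrib]
  let D : ℕ → ℝ := fun k => (q ^ k)⁻¹ * (1 - q ^ k) * ((1 - a * q ^ k) * (1 - c * q ^ k))
  let J : ℕ → ℝ := jacobiCoeff a b c q m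
  have hterm (k) : raiseCoeff a b c q x * (J k * qPoch (q * x) q k - J k * qPoch x q k) +
      lowerCoeff a c q x * (J k * qPoch (x / q) q k - J k * qPoch x q k) =
      J k * D k * qPoch x q (k - 1) - J k * diffEigenvalue a b q k * qPoch x q k := by
    linear_combination J k * qPoch_difference h.q_pos.ne' a b c hx k
  have hlower : ∑ k ∈ Finset.range (m + 1), J k * D k * qPoch x q (k - 1) =
      ∑ k ∈ Finset.range (m + 1),
        J k * (diffEigenvalue a b q k - diffEigenvalue a b q m) * qPoch x q k := by
    have hD : D 0 = 0 := by simp [D]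
    rw [Finset.sum_range_succ', Finset.sum_range_succ, hD, sub_self]
    simp only [mul_zero, zero_mul, add_zero, Nat.add_sub_cancel]
    exact Finset.sum_congr rfl fun k _ => by rw [jacobiCoeff_succ h m k]
  rw [Finset.sum_congr rfl fun k _ => hterm k, Finset.sum_sub_distrib, hlower,
    ← Finset.sum_sub_distrib]
  exact Finset.sum_congr rfl fun k _ => by ring

namespace Admissible

lemma uWeight_mul (h : Admissible a b c q) {x : ℝ} (hx : x < 1) (hbx : b / c * x < 1) :
    uWeight (q * x) a b c q * ((1 - x / a) * (1 - x / c)) =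
      uWeight x a b c q * ((1 - x) * (1 - b / c * x)) := by
  have hsplit (y : ℝ) : qPochInf y q = (1 - y) * qPochInf (y * q) q :=
    qPochInf_eq_one_sub_mul h.q_pos h.q_lt_one y
  have hcancel {r y z t s : ℝ} (hy : y ≠ 0) (hz : z ≠ 0) :
      r / (y * t * (z * s)) * (y * z) = r / (t * s) := by
    rw [mul_mul_mul_comm, mul_comm (y * z), ← div_div, div_mul_cancel₀ _ (mul_ne_zero hy hz)]
  rw [uWeight, uWeight, show q * x / a = x / a * q by ring, show q * x / c = x / c * q by ring,
    show b * (q * x) / c = b / c * x * q by ring, show b * x / c = b / c * x by ring, mul_comm q x,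
    hsplit (x / a), hsplit (x / c), hsplit x, hsplit (b / c * x),
    hcancel (sub_pos.2 hx).ne' (sub_pos.2 hbx).ne']
  ring

lemma latticePt_lt_one (h : Admissible a b c q) (i : ℕ ⊕ ℕ) : latticePt a c q i < 1 := by
  simpa only [one_mul] using h.poleFree_one.mul_latticePt_lt_one h.q_pos h.q_lt_one i

lemma b_div_c_mul_latticePt_lt_one (h : Admissible a b c q) (i : ℕ ⊕ ℕ) :
    b / c * latticePt a c q i < 1 :=
  h.poleFree_b_div_c.mul_latticePt_lt_one h.q_pos h.q_lt_one i

lemma raiseCoeff_eq (h : Admissible a b c q) (x : ℝ) :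
    raiseCoeff a b c q x = a * q * -c * ((1 - x) * (1 - b / c * x)) / x ^ 2 := by
  rw [raiseCoeff, show b * x - c = -c * (1 - b / c * x) by have := h.c_neg.ne; field_simp; ring]
  ring

lemma raiseCoeff_latticePt_nonneg (h : Admissible a b c q) (i : ℕ ⊕ ℕ) :
    0 ≤ raiseCoeff a b c q (latticePt a c q i) := by
  rw [h.raiseCoeff_eq]
  exact div_nonneg (mul_nonneg
    (mul_nonneg (mul_pos h.a_pos h.q_pos).le (neg_pos.2 h.c_neg).le)
    (mul_nonneg (sub_pos.2 (h.latticePt_lt_one i)).le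
      (sub_pos.2 (h.b_div_c_mul_latticePt_lt_one i)).le)) (sq_nonneg _)

/-- Detailed balance between neighbouring lattice points: it makes the `q`-difference operator
symmetric. -/
lemma latticeWt_mul_lowerCoeff (h : Admissible a b c q) {i j : ℕ ⊕ ℕ}
    (hij : latticePt a c q j = q * latticePt a c q i) :
    latticeWt a b c q j * lowerCoeff a c q (latticePt a c q j) =
      latticeWt a b c q i * raiseCoeff a b c q (latticePt a c q i) := by
  rw [latticeWt, latticeWt, hij, h.raiseCoeff_eq]
  have hu := h.uWeight_mul (h.latticePt_lt_one i) (h.b_div_c_mul_latticePt_lt_one i)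
  have hx := h.latticePt_ne_zero i
  generalize latticePt a c q i = x at *
  have hlower : lowerCoeff a c q (q * x) = -(a * c) / x ^ 2 * ((1 - x / a) * (1 - x / c)) := by
    have := h.q_pos.ne'
    have := h.a_pos.ne'
    have := h.c_neg.ne
    rw [lowerCoeff]
    field_simp
    ring
  rw [hlower, abs_mul, abs_of_pos h.q_pos]
  linear_combination (q * |x| * (-(a * c) / x ^ 2)) * hu

lemma lowerCoeff_latticePt_nonneg (h : Admissible a b c q) {i j : ℕ ⊕ ℕ}
    (hij : latticePt a c q j = q * latticePt a c q i) :
    0 ≤ lowerCoeff a c q (latticePt a c q j) := by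
  refine nonneg_of_mul_nonneg_right ?_ (h.latticeWt_pos j)
  rw [h.latticeWt_mul_lowerCoeff hij]
  exact mul_nonneg (h.latticeWt_pos i).le (h.raiseCoeff_latticePt_nonneg i)

end Admissible

lemma mul_sqrt_of_balance {u v r l κ A : ℝ} (hu : 0 ≤ u) (hv : 0 ≤ v) (hr : 0 ≤ r) (hκ : 0 ≤ κ)
    (hA : 0 ≤ A) (hbal : v * l = u * r) (hA2 : A ^ 2 = κ ^ 2 * (r * l)) :
    A * √v = κ * r * √u := by
  rw [← sq_eq_sq₀ (by positivity) (by positivity), mul_pow, mul_pow _ √u, Real.sq_sqrt hv,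
    Real.sq_sqrt hu, hA2]
  linear_combination κ ^ 2 * r * hbal

namespace Admissible

lemma mul_sqrt_latticeWt_succ (h : Admissible a b c q) {i j : ℕ ⊕ ℕ}
    (hij : latticePt a c q j = q * latticePt a c q i) {κ A : ℝ} (hκ : 0 ≤ κ) (hA : 0 ≤ A)
    (hA2 : A ^ 2 = κ ^ 2 * (raiseCoeff a b c q (latticePt a c q i) *
      lowerCoeff a c q (latticePt a c q j))) :
    A * √(latticeWt a b c q j) =
      κ * raiseCoeff a b c q (latticePt a c q i) * √(latticeWt a b c q i) :=
  mul_sqrt_of_balance (h.latticeWt_pos i).le (h.latticeWt_pos j).le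
    (h.raiseCoeff_latticePt_nonneg i) hκ hA (h.latticeWt_mul_lowerCoeff hij) hA2

lemma mul_sqrt_latticeWt_pred (h : Admissible a b c q) {i j : ℕ ⊕ ℕ}
    (hij : latticePt a c q j = q * latticePt a c q i) {κ A : ℝ} (hκ : 0 ≤ κ) (hA : 0 ≤ A)
    (hA2 : A ^ 2 = κ ^ 2 * (raiseCoeff a b c q (latticePt a c q i) *
      lowerCoeff a c q (latticePt a c q j))) :
    A * √(latticeWt a b c q i) =
      κ * lowerCoeff a c q (latticePt a c q j) * √(latticeWt a b c q j) :=
  mul_sqrt_of_balance (h.latticeWt_pos j).le (h.latticeWt_pos i).le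
    (h.lowerCoeff_latticePt_nonneg hij) hκ hA (h.latticeWt_mul_lowerCoeff hij).symm
    (by rw [hA2, mul_comm (raiseCoeff _ _ _ _ _)])

theorem rFun_recurrence (h : Admissible a b c q) {i j k : ℕ ⊕ ℕ}
    (hij : latticePt a c q j = q * latticePt a c q i)
    (hjk : latticePt a c q k = q * latticePt a c q j) {κ A B : ℝ} (hκ : 0 ≤ κ) (hA : 0 ≤ A)
    (hB : 0 ≤ B)
    (hA2 : A ^ 2 = κ ^ 2 * (raiseCoeff a b c q (latticePt a c q i) *
      lowerCoeff a c q (latticePt a c q j)))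
    (hB2 : B ^ 2 = κ ^ 2 * (raiseCoeff a b c q (latticePt a c q j) *
      lowerCoeff a c q (latticePt a c q k))) (m : ℕ) :
    A * rFun (latticePt a c q i) m a b c q + B * rFun (latticePt a c q k) m a b c q =
      κ * (raiseCoeff a b c q (latticePt a c q j) + lowerCoeff a c q (latticePt a c q j) -
        diffEigenvalue a b q m) * rFun (latticePt a c q j) m a b c q := by
  have hpred := h.mul_sqrt_latticeWt_pred hij hκ hA hA2
  have hsucc := h.mul_sqrt_latticeWt_succ hjk hκ hB hB2
  have hdiff := jacobiPoly_difference h m (h.latticePt_ne_zero j)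
  rw [← hjk, show latticePt a c q j / q = latticePt a c q i by
    rw [hij, mul_div_cancel_left₀ _ h.q_pos.ne']] at hdiff
  rw [h.rFun_latticePt, h.rFun_latticePt, h.rFun_latticePt]
  linear_combination
    (√(vWeight m a b c q) * (jacobiPoly a b c q m).eval (latticePt a c q i)) * hpred +
    (√(vWeight m a b c q) * (jacobiPoly a b c q m).eval (latticePt a c q k)) * hsucc +
    (κ * √(latticeWt a b c q j) * √(vWeight m a b c q)) * hdiff

theorem rFun_recurrence_end (h : Admissible a b c q) {j k : ℕ ⊕ ℕ}
    (hj : lowerCoeff a c q (latticePt a c q j) = 0)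
    (hjk : latticePt a c q k = q * latticePt a c q j) {κ B : ℝ} (hκ : 0 ≤ κ) (hB : 0 ≤ B)
    (hB2 : B ^ 2 = κ ^ 2 * (raiseCoeff a b c q (latticePt a c q j) *
      lowerCoeff a c q (latticePt a c q k))) (m : ℕ) :
    B * rFun (latticePt a c q k) m a b c q =
      κ * (raiseCoeff a b c q (latticePt a c q j) - diffEigenvalue a b q m) *
        rFun (latticePt a c q j) m a b c q := by
  have hsucc := h.mul_sqrt_latticeWt_succ hjk hκ hB hB2
  have hdiff := jacobiPoly_difference h m (h.latticePt_ne_zero j)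
  rw [← hjk, hj, zero_mul, add_zero] at hdiff
  rw [h.rFun_latticePt, h.rFun_latticePt]
  linear_combination
    (√(vWeight m a b c q) * (jacobiPoly a b c q m).eval (latticePt a c q k)) * hsucc +
    (κ * √(latticeWt a b c q j) * √(vWeight m a b c q)) * hdiff

end Admissible

end QDifferenceEquation

section TensorProduct

/-- The generators of `𝒰_q` act on the basis vectors `e_n` by weighted shifts: `K` and `K⁻¹` by the
weights `w` and `w'`, `E` by `e_n ↦ e(n) e_{s n}` and `F` by `e_n ↦ f(n) e_{t n}`. -/
structure ShiftRep {q : ℝ} {ι : Type} (π : Uq q →ₐ[ℂ] Module.End ℂ (ι →₀ ℂ)) (w w' : ι → ℝ)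
    (s t : ι → ι) (e f : ι → ℝ) : Prop where
  K_eq : π (gen q .K) = wmap (fun n => n) w
  Kinv_eq : π (gen q .Kinv) = wmap (fun n => n) w'
  E_eq : π (gen q .E) = wmap s e
  F_eq : π (gen q .F) = wmap t f

lemma wmap_single_smul {ι : Type*} (s : ι → ι) (c : ι → ℝ) (n : ι) :
    wmap s c (Finsupp.single n 1) = (c n : ℂ) • Finsupp.single (s n) (1 : ℂ) := by
  rw [wmap_single, Finsupp.smul_single, smul_eq_mul, mul_one]

section

variable {q : ℝ} (hq : q ≠ 0) {V W : Type} [AddCommGroup V] [Module ℂ V] [AddCommGroup W]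
  [Module ℂ W] (π₁ : Uq q →ₐ[ℂ] Module.End ℂ V) (π₂ : Uq q →ₐ[ℂ] Module.End ℂ W) (v : V) (w : W)

lemma tensorRep_K_tmul : tensorRep hq π₁ π₂ (gen q .K) (v ⊗ₜ w) =
    π₁ (gen q .K) v ⊗ₜ π₂ (gen q .K) w := by
  simp [tensorRep, comul, Uq.lift_gen, genImage, Module.endTensorEndAlgHom_apply]

lemma tensorRep_Kinv_tmul : tensorRep hq π₁ π₂ (gen q .Kinv) (v ⊗ₜ w) =
    π₁ (gen q .Kinv) v ⊗ₜ π₂ (gen q .Kinv) w := by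
  simp [tensorRep, comul, Uq.lift_gen, genImage, Module.endTensorEndAlgHom_apply]

lemma tensorRep_E_tmul : tensorRep hq π₁ π₂ (gen q .E) (v ⊗ₜ w) =
    π₁ (gen q .K) v ⊗ₜ π₂ (gen q .E) w + π₁ (gen q .E) v ⊗ₜ π₂ (gen q .Kinv) w := by
  simp [tensorRep, comul, Uq.lift_gen, genImage, Module.endTensorEndAlgHom_apply]

lemma tensorRep_F_tmul : tensorRep hq π₁ π₂ (gen q .F) (v ⊗ₜ w) =
    π₁ (gen q .K) v ⊗ₜ π₂ (gen q .F) w + π₁ (gen q .F) v ⊗ₜ π₂ (gen q .Kinv) w := by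
  simp [tensorRep, comul, Uq.lift_gen, genImage, Module.endTensorEndAlgHom_apply]

end

lemma casimir_eq_smul (q : ℝ) : casimir q = ((((q⁻¹ - q) ^ 2)⁻¹ : ℝ) : ℂ) •
    (((q⁻¹ : ℝ) : ℂ) • (gen q .K * gen q .K) + (q : ℂ) • (gen q .Kinv * gen q .Kinv) +
      (-2 : ℂ) • 1) + gen q .E * gen q .F := by
  have htwo : (-2 : ℂ) • (1 : Uq q) = -2 := by
    rw [← Algebra.algebraMap_eq_smul_one]
    exact (map_neg (algebraMap ℂ (Uq q)) 2).trans (by rw [map_ofNat])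
  rw [casimir, htwo, pow_two (gen q .K), pow_two (gen q .Kinv), sub_eq_add_neg (_ + _)]

theorem tensorRep_casimir_single {q : ℝ} (hq : q ≠ 0) {ι κ : Type}
    {π₁ : Uq q →ₐ[ℂ] Module.End ℂ (ι →₀ ℂ)} {π₂ : Uq q →ₐ[ℂ] Module.End ℂ (κ →₀ ℂ)}
    {w₁ w₁' : ι → ℝ} {s₁ t₁ : ι → ι} {e₁ f₁ : ι → ℝ}
    {w₂ w₂' : κ → ℝ} {s₂ t₂ : κ → κ} {e₂ f₂ : κ → ℝ}
    (h₁ : ShiftRep π₁ w₁ w₁' s₁ t₁ e₁ f₁) (h₂ : ShiftRep π₂ w₂ w₂' s₂ t₂ e₂ f₂)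
    (i : ι) (j : κ) :
    tensorRep hq π₁ π₂ (casimir q) (Finsupp.single i 1 ⊗ₜ Finsupp.single j 1) =
      ((((q⁻¹ - q) ^ 2)⁻¹ * (q⁻¹ * (w₁ i * w₂ j) ^ 2 + q * (w₁' i * w₂' j) ^ 2 - 2) : ℝ) : ℂ) •
        (Finsupp.single i (1 : ℂ) ⊗ₜ[ℂ] Finsupp.single j (1 : ℂ)) +
      ((w₁ i ^ 2 * (f₂ j * e₂ (t₂ j)) : ℝ) : ℂ) •
        (Finsupp.single i (1 : ℂ) ⊗ₜ[ℂ] Finsupp.single (s₂ (t₂ j)) (1 : ℂ)) +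
      ((w₁ i * e₁ i * (f₂ j * w₂' (t₂ j)) : ℝ) : ℂ) •
        (Finsupp.single (s₁ i) (1 : ℂ) ⊗ₜ[ℂ] Finsupp.single (t₂ j) (1 : ℂ)) +
      ((f₁ i * w₁ (t₁ i) * (w₂' j * e₂ j) : ℝ) : ℂ) •
        (Finsupp.single (t₁ i) (1 : ℂ) ⊗ₜ[ℂ] Finsupp.single (s₂ j) (1 : ℂ)) +
      ((f₁ i * e₁ (t₁ i) * w₂' j ^ 2 : ℝ) : ℂ) •
        (Finsupp.single (s₁ (t₁ i)) (1 : ℂ) ⊗ₜ[ℂ] Finsupp.single j (1 : ℂ)) := by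
  rw [casimir_eq_smul]
  simp only [map_add, map_smul, map_mul, map_one, LinearMap.add_apply, LinearMap.smul_apply,
    Module.End.mul_apply, Module.End.one_apply, tensorRep_K_tmul, tensorRep_Kinv_tmul,
    tensorRep_E_tmul, tensorRep_F_tmul, h₁.K_eq, h₁.Kinv_eq, h₁.E_eq, h₁.F_eq, h₂.K_eq, h₂.Kinv_eq,
    h₂.E_eq, h₂.F_eq, wmap_single_smul, ← TensorProduct.smul_tmul', TensorProduct.tmul_smul,
    smul_smul]
  push_cast
  module

end TensorProduct

section Closure

variable (l p : ℤ)

/-- The vectors `f⁻_{p,n}` and `f⁺_{p,n}` of `A_p` as one family. -/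
def fVec : ℕ ⊕ ℕ → subA l p := Sum.elim (fMinus l p) (fPlus l p)

/-- The index of `f^∓_{p,n}` in the standard basis of the Hilbert space. -/
def fIdx : ℕ ⊕ ℕ → (ℕ × ℤ) ⊕ (ℤ × ℕ) :=
  Sum.elim (fun n => .inl (n, (n : ℤ) + p)) fun n => .inr (l - (n : ℤ) + p, n)

lemma fIdx_injective : Function.Injective (fIdx l p) := by
  rintro (m | m) (n | n) h <;> simp_all [fIdx]

lemma coe_inclA_fVec (i : ℕ ⊕ ℕ) :
    (inclA l p (fVec l p i) : Hilb) = lp.single 2 (fIdx l p i) (1 : ℂ) := by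
  rcases i with n | n <;> simp [inclA, toHilb, fVec, fMinus, fPlus, vecMinus, vecPlus, fIdx]

lemma orthonormal_inclA_fVec : Orthonormal ℂ fun i => inclA l p (fVec l p i) := by
  classical
  rw [orthonormal_iff_ite]
  intro i j
  rw [Submodule.coe_inner, coe_inclA_fVec, coe_inclA_fVec, lp.inner_single_left, lp.single_apply]
  by_cases h : i = j
  · subst h; simp
  · rw [if_neg h, Pi.single_eq_of_ne fun e => h (fIdx_injective l p e), inner_zero_right]

lemma span_range_fVec : Submodule.span ℂ (Set.range (fVec l p)) = ⊤ := by
  apply Submodule.map_injective_of_injective (subA l p).injective_subtype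
  rw [Submodule.map_top, Submodule.range_subtype, Submodule.map_span, ← Set.range_comp, fVec,
    Sum.comp_elim, Set.Sum.elim_range, Submodule.span_union]
  rfl

lemma denseRange_inclA : DenseRange (inclA l p) := by
  rw [DenseRange, Subtype.dense_iff, ← Set.range_comp]
  refine closure_mono ?_
  rintro _ ⟨x, hx, rfl⟩
  exact ⟨⟨x, hx⟩, rfl⟩

/-- The Hilbert basis of the closure of `A_p` given by the vectors `f^∓_{p,n}`. -/
def fBasis : HilbertBasis (ℕ ⊕ ℕ) ℂ (closureA l p) :=
  HilbertBasis.mk (orthonormal_inclA_fVec l p) <| by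
    rw [Set.range_comp' (inclA l p), ← Submodule.map_span, span_range_fVec, Submodule.map_top]
    exact fun x _ => denseRange_inclA l p x

lemma fBasis_repr (i : ℕ ⊕ ℕ) :
    (fBasis l p).repr (inclA l p (fVec l p i)) = lp.single 2 i (1 : ℂ) := by
  simpa only [fBasis, HilbertBasis.coe_mk] using (fBasis l p).repr_self i

end Closure

section Intertwiner

variable {a b c q : ℝ}

/-- The unitary operator sending `f⁻_{p,n}` and `f⁺_{p,n}` to the functions `m ↦ ± r_x(m)`. -/
def intertwiner (h : Admissible a b c q) (l p : ℤ) : closureA l p ≃ₗᵢ[ℂ] L2N :=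
  (fBasis l p).repr.trans h.colBasis.repr

/-- The restriction of the unitary operator to `A_p`. -/
def theta (h : Admissible a b c q) (l p : ℤ) : subA l p →ₗ[ℂ] L2N :=
  (intertwiner h l p).toLinearEquiv.toLinearMap ∘ₗ inclA l p

lemma theta_fVec (h : Admissible a b c q) (l p : ℤ) (i : ℕ ⊕ ℕ) (m : ℕ) :
    theta h l p (fVec l p i) m = (jacobiCol a b c q m i : ℂ) := by
  rw [← h.colBasis_repr_single, ← fBasis_repr l p i]
  rfl

lemma theta_fMinus (h : Admissible a b c q) (l p : ℤ) (n m : ℕ) :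
    theta h l p (fMinus l p n) m = ((rFun (latticePt a c q (.inl n)) m a b c q : ℝ) : ℂ) := by
  rw [← one_mul (rFun _ _ _ _ _ _)]
  exact theta_fVec h l p (.inl n) m

lemma theta_fPlus (h : Admissible a b c q) (l p : ℤ) (n m : ℕ) :
    theta h l p (fPlus l p n) m =
      (((-1) ^ n * rFun (latticePt a c q (.inr n)) m a b c q : ℝ) : ℂ) :=
  theta_fVec h l p (.inr n) m

end Intertwiner

section JacobiMatrix

variable {V W : Type*} [AddCommMonoid V] [Module ℂ V] [AddCommMonoid W] [Module ℂ W]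

/-- The action on the family `v` of the Jacobi matrix with diagonal entries `d n` and entries `e n`
between `n` and `n + 1`. -/
def jacobiMatrix (d e : ℕ → ℝ) (v : ℕ → V) : ℕ → V
  | 0 => (e 0 : ℂ) • v 1 + (d 0 : ℂ) • v 0
  | n + 1 => (e (n + 1) : ℂ) • v (n + 2) + (d (n + 1) : ℂ) • v (n + 1) + (e n : ℂ) • v n

lemma map_jacobiMatrix (T : V →ₗ[ℂ] W) (d e : ℕ → ℝ) (v : ℕ → V) (n : ℕ) :
    T (jacobiMatrix d e v n) = jacobiMatrix d e (fun k => T (v k)) n := by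
  rcases n with _ | n <;> simp only [jacobiMatrix, map_add, map_smul]

/-- The sign `τ` allows for off-diagonal entries of either sign. -/
theorem Admissible.jacobiMatrix_rFun {a b c q : ℝ} (h : Admissible a b c q) {σ : ℕ → ℕ ⊕ ℕ}
    (hσ : ∀ n, latticePt a c q (σ (n + 1)) = q * latticePt a c q (σ n))
    (h0 : lowerCoeff a c q (latticePt a c q (σ 0)) = 0) {κ μ τ : ℝ} (hκ : 0 ≤ κ)
    (hτ : τ * τ = 1) {d e : ℕ → ℝ} (he : ∀ n, 0 ≤ τ * e n)
    (he2 : ∀ n, e n ^ 2 = κ ^ 2 * (raiseCoeff a b c q (latticePt a c q (σ n)) *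
      lowerCoeff a c q (latticePt a c q (σ (n + 1)))))
    (hd : ∀ n, d n = -κ * (raiseCoeff a b c q (latticePt a c q (σ n)) +
      lowerCoeff a c q (latticePt a c q (σ n))) + μ) (m n : ℕ) :
    jacobiMatrix d e (fun k => ((τ ^ k * rFun (latticePt a c q (σ k)) m a b c q : ℝ) : ℂ)) n =
      ((-κ * diffEigenvalue a b q m + μ : ℝ) : ℂ) *
        ((τ ^ n * rFun (latticePt a c q (σ n)) m a b c q : ℝ) : ℂ) := by
  have he2' (k) := (mul_pow τ (e k) 2).trans (by rw [sq τ, hτ, one_mul, he2 k])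
  rcases n with _ | n <;> simp only [jacobiMatrix, smul_eq_mul] <;> norm_cast
  · have hrec := h.rFun_recurrence_end h0 (hσ 0) hκ (he 0) (he2' 0) m
    rw [hd, h0]
    linear_combination hrec
  · have hrec := h.rFun_recurrence (hσ n) (hσ (n + 1)) hκ (he n) (he (n + 1)) (he2' n)
      (he2' (n + 1)) m
    rw [hd]
    linear_combination τ ^ (n + 1) * hrec -
      e n * τ ^ n * rFun (latticePt a c q (σ n)) m a b c q * hτ

end JacobiMatrix

section MatrixElements

variable {q : ℝ}

lemma rpow_two_mul_sub_one (hq : 0 < q) (k : ℝ) : q ^ (2 * k - 1) = (q ^ k) ^ 2 / q := by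
  rw [Real.rpow_sub hq, mul_comm, Real.rpow_mul hq.le, Real.rpow_two, Real.rpow_one]

lemma rpow_one_sub_two_mul (hq : 0 < q) (k : ℝ) : q ^ (1 - 2 * k) = q / (q ^ k) ^ 2 := by
  rw [← neg_sub, Real.rpow_neg hq.le, rpow_two_mul_sub_one hq, inv_div]

lemma inv_sub_self_pos (hq : 0 < q) (hq1 : q < 1) : 0 < q⁻¹ - q :=
  sub_pos.2 (hq1.trans ((one_lt_inv₀ hq).2 hq1))

lemma discWeight_eq (hq : 0 < q) (k : ℝ) (n : ℕ) : discWeight q k n = q ^ k * q ^ n := by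
  rw [discWeight, Real.rpow_add hq, Real.rpow_natCast]

lemma discDown_zero (q k : ℝ) : discDown q k 0 = 0 := by simp [discDown]

lemma discDown_succ (q k : ℝ) (n : ℕ) : discDown q k (n + 1) = -discUp q k n := by
  rw [discDown, discUp, show 1 / 2 - k - ((n + 1 : ℕ) : ℝ) = -(1 / 2) - k - n by push_cast; ring,
    show 2 * ((n + 1 : ℕ) : ℝ) = 2 * n + 2 by push_cast; ring,
    show 4 * k + (2 * (n : ℝ) + 2) - 2 = 4 * k + 2 * n by ring]

lemma discUp_nonneg (hq : 0 < q) (hq1 : q < 1) (k : ℝ) (n : ℕ) : 0 ≤ discUp q k n := by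
  have := inv_sub_self_pos hq hq1
  unfold discUp; positivity

lemma discUp_sq (hq : 0 < q) (hq1 : q < 1) {k : ℝ} (hk : 0 < k) (n : ℕ) :
    discUp q k n ^ 2 = ((q⁻¹ - q) ^ 2)⁻¹ * (q * (q ^ k * q ^ n) ^ 2 +
      q⁻¹ * ((q ^ k * q ^ n) ^ 2)⁻¹ - ((q ^ k) ^ 2 / q + q / (q ^ k) ^ 2)) := by
  have h := disc_up_down hq hq1 hk n
  rw [discDown_succ, discWeight_eq hq, rpow_two_mul_sub_one hq, rpow_one_sub_two_mul hq] at h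
  linear_combination -h

lemma discDown_mul_discUp (hq : 0 < q) (hq1 : q < 1) {k : ℝ} (hk : 0 < k) (n : ℕ) :
    discDown q k n * discUp q k (n - 1) = -(((q⁻¹ - q) ^ 2)⁻¹ *
      (q⁻¹ * (q ^ k * q ^ n) ^ 2 + q * ((q ^ k * q ^ n) ^ 2)⁻¹ -
        ((q ^ k) ^ 2 / q + q / (q ^ k) ^ 2))) := by
  rcases n with _ | n
  · rw [discDown_zero, pow_zero, mul_one]
    ring
  · rw [Nat.add_sub_cancel, discDown_succ, neg_mul, ← sq, discUp_sq hq hq1 hk, pow_succ q n]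
    congr 2
    field_simp

lemma strangeWeight_pos (hq : 0 < q) (ε : ℝ) (n : ℤ) : 0 < strangeWeight q ε n :=
  Real.rpow_pos_of_pos hq _

lemma strangeWeight_add_one (hq : 0 < q) (ε : ℝ) (n : ℤ) :
    strangeWeight q ε (n + 1) = q * strangeWeight q ε n := by
  rw [strangeWeight, strangeWeight, mul_comm, ← Real.rpow_add_one hq.ne']
  congr 1; push_cast; ring

lemma strangeDown_add_one (q σ ε : ℝ) (n : ℤ) :
    strangeDown q σ ε (n + 1) = -strangeUp q σ ε n := by
  rw [strangeDown, strangeUp,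
    show 1 / 2 - ((n + 1 : ℤ) : ℝ) - ε = -(1 / 2) - n - ε by push_cast; ring,
    show 2 * ((n + 1 : ℤ) : ℝ) + 2 * ε + 2 * σ - 1 = 2 * n + 2 * ε + 2 * σ + 1 by
      push_cast; ring,
    show 2 * ((n + 1 : ℤ) : ℝ) + 2 * ε - 2 * σ - 1 = 2 * n + 2 * ε - 2 * σ + 1 by
      push_cast; ring]

lemma strangeDown_eq (q σ ε : ℝ) (n : ℤ) : strangeDown q σ ε n = -strangeUp q σ ε (n - 1) := by
  rw [← strangeDown_add_one, sub_add_cancel]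

lemma strangeUp_nonneg (hq : 0 < q) (hq1 : q < 1) (σ ε : ℝ) (n : ℤ) :
    0 ≤ strangeUp q σ ε n := by
  have := inv_sub_self_pos hq hq1
  unfold strangeUp; positivity

lemma strangeUp_sq (hq : 0 < q) (k ε : ℝ) (n : ℤ) :
    strangeUp q (k - 1 / 2) ε n ^ 2 = ((q⁻¹ - q) ^ 2)⁻¹ * (q * strangeWeight q ε n ^ 2 +
      q⁻¹ * (strangeWeight q ε n ^ 2)⁻¹ + ((q ^ k) ^ 2 / q + q / (q ^ k) ^ 2)) := by
  have h := strange_up_down hq (k - 1 / 2) ε n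
  rw [strangeDown_add_one, show 2 * (k - 1 / 2) = 2 * k - 1 by ring, neg_sub,
    rpow_two_mul_sub_one hq, rpow_one_sub_two_mul hq] at h
  linear_combination -h

lemma strangeDown_mul_strangeUp (hq : 0 < q) (k ε : ℝ) (n : ℤ) :
    strangeDown q (k - 1 / 2) ε n * strangeUp q (k - 1 / 2) ε (n - 1) =
      -(((q⁻¹ - q) ^ 2)⁻¹ * (q⁻¹ * strangeWeight q ε n ^ 2 + q * (strangeWeight q ε n ^ 2)⁻¹ +
        ((q ^ k) ^ 2 / q + q / (q ^ k) ^ 2))) := by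
  have hw := strangeWeight_add_one hq ε (n - 1)
  have hpos := strangeWeight_pos hq ε (n - 1)
  rw [sub_add_cancel] at hw
  rw [strangeDown_eq, neg_mul, ← sq, strangeUp_sq hq, hw]
  congr 2
  field_simp

lemma negRep_shiftRep {k : ℝ} (hq : 0 < q) (hq1 : q < 1) (hk : 0 < k) :
    ShiftRep (negRep hq hq1 hk) (fun n => (discWeight q k n)⁻¹) (discWeight q k)
      (fun n => n - 1) (fun n => n + 1) (discDown q k) (discUp q k) :=
  ⟨Uq.lift_gen _ _, Uq.lift_gen _ _, Uq.lift_gen _ _, Uq.lift_gen _ _⟩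

lemma posRep_shiftRep {k : ℝ} (hq : 0 < q) (hq1 : q < 1) (hk : 0 < k) :
    ShiftRep (posRep hq hq1 hk) (discWeight q k) (fun n => (discWeight q k n)⁻¹)
      (fun n => n + 1) (fun n => n - 1) (discUp q k) (discDown q k) :=
  ⟨Uq.lift_gen _ _, Uq.lift_gen _ _, Uq.lift_gen _ _, Uq.lift_gen _ _⟩

lemma strangeRep_shiftRep (hq : 0 < q) (hq1 : q < 1) (σ ε : ℝ) :
    ShiftRep (strangeRep hq hq1 σ ε) (strangeWeight q ε) (fun n => (strangeWeight q ε n)⁻¹)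
      (fun n => n + 1) (fun n => n - 1) (strangeUp q σ ε) (strangeDown q σ ε) :=
  ⟨Uq.lift_gen _ _, Uq.lift_gen _ _, Uq.lift_gen _ _, Uq.lift_gen _ _⟩

end MatrixElements

section CasimirAction

variable {q k₁ k₂ ε : ℝ}

/-- The matrix element of the Casimir element between `f⁻_{p,n}` and `f⁻_{p,n+1}`. -/
def minusOff (q k₁ k₂ ε : ℝ) (p : ℤ) (n : ℕ) : ℝ :=
  discUp q k₁ n * (discWeight q k₁ (n + 1))⁻¹ *
    ((strangeWeight q (ε + k₂) (n + p))⁻¹ * strangeUp q (k₂ - 1 / 2) (ε + k₂) (n + p))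

/-- The diagonal matrix element of the Casimir element at `f⁻_{p,n}`. -/
def minusDiag (q k₁ k₂ ε : ℝ) (p : ℤ) (n : ℕ) : ℝ :=
  ((q⁻¹ - q) ^ 2)⁻¹ * (q⁻¹ * ((discWeight q k₁ n)⁻¹ * strangeWeight q (ε + k₂) (n + p)) ^ 2 +
      q * (discWeight q k₁ n * (strangeWeight q (ε + k₂) (n + p))⁻¹) ^ 2 - 2) +
    (discWeight q k₁ n)⁻¹ ^ 2 * (strangeDown q (k₂ - 1 / 2) (ε + k₂) (n + p) *
      strangeUp q (k₂ - 1 / 2) (ε + k₂) (n + p - 1)) +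
    discUp q k₁ n * discDown q k₁ (n + 1) * (strangeWeight q (ε + k₂) (n + p))⁻¹ ^ 2

/-- The matrix element of the Casimir element between `f⁺_{p,n}` and `f⁺_{p,n+1}`. -/
def plusOff (q k₁ k₂ ε : ℝ) (l p : ℤ) (n : ℕ) : ℝ :=
  -(strangeUp q (k₁ - 1 / 2) (-ε - k₁) (l - n + p - 1) *
    strangeWeight q (-ε - k₁) (l - n + p - 1) * ((discWeight q k₂ n)⁻¹ * discUp q k₂ n))

/-- The diagonal matrix element of the Casimir element at `f⁺_{p,n}`. -/
def plusDiag (q k₁ k₂ ε : ℝ) (l p : ℤ) (n : ℕ) : ℝ :=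
  ((q⁻¹ - q) ^ 2)⁻¹ * (q⁻¹ * (strangeWeight q (-ε - k₁) (l - n + p) * discWeight q k₂ n) ^ 2 +
      q * ((strangeWeight q (-ε - k₁) (l - n + p))⁻¹ * (discWeight q k₂ n)⁻¹) ^ 2 - 2) +
    strangeWeight q (-ε - k₁) (l - n + p) ^ 2 * (discDown q k₂ n * discUp q k₂ (n - 1)) +
    strangeDown q (k₁ - 1 / 2) (-ε - k₁) (l - n + p) *
      strangeUp q (k₁ - 1 / 2) (-ε - k₁) (l - n + p - 1) * (discWeight q k₂ n)⁻¹ ^ 2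

lemma minusOff_nonneg (hq : 0 < q) (hq1 : q < 1) (k₁ k₂ ε : ℝ) (p : ℤ) (n : ℕ) :
    0 ≤ minusOff q k₁ k₂ ε p n :=
  mul_nonneg (mul_nonneg (discUp_nonneg hq hq1 _ _)
    (inv_nonneg.2 (Real.rpow_pos_of_pos hq _).le))
    (mul_nonneg (inv_nonneg.2 (strangeWeight_pos hq _ _).le) (strangeUp_nonneg hq hq1 _ _ _))

lemma plusOff_nonpos (hq : 0 < q) (hq1 : q < 1) (k₁ k₂ ε : ℝ) (l p : ℤ) (n : ℕ) :
    plusOff q k₁ k₂ ε l p n ≤ 0 :=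
  neg_nonpos.2 <| mul_nonneg
    (mul_nonneg (strangeUp_nonneg hq hq1 _ _ _) (strangeWeight_pos hq _ _).le)
    (mul_nonneg (inv_nonneg.2 (Real.rpow_pos_of_pos hq _).le) (discUp_nonneg hq hq1 _ _))

lemma repT'_inl (hq : 0 < q) (hq1 : q < 1) (hk₁ : 0 < k₁) (hk₂ : 0 < k₂) (ε : ℝ) (X : Uq q)
    (v : (ℕ →₀ ℂ) ⊗[ℂ] (ℤ →₀ ℂ)) : repT' hq hq1 hk₁ hk₂ ε X (v, 0) =
      (tensorRep hq.ne' (negRep hq hq1 hk₁) (strangeRep hq hq1 (k₂ - 1 / 2) (ε + k₂)) X v, 0) :=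
  Prod.ext rfl (map_zero (tensorRep hq.ne' _ _ X))

lemma repT'_inr (hq : 0 < q) (hq1 : q < 1) (hk₁ : 0 < k₁) (hk₂ : 0 < k₂) (ε : ℝ) (X : Uq q)
    (v : (ℤ →₀ ℂ) ⊗[ℂ] (ℕ →₀ ℂ)) : repT' hq hq1 hk₁ hk₂ ε X (0, v) =
      (0, tensorRep hq.ne' (strangeRep hq hq1 (k₁ - 1 / 2) (-ε - k₁)) (posRep hq hq1 hk₂) X v) :=
  Prod.ext (map_zero (tensorRep hq.ne' _ _ X)) rfl

theorem repT'_casimir_vecMinus (hq : 0 < q) (hq1 : q < 1) (hk₁ : 0 < k₁) (hk₂ : 0 < k₂) (ε : ℝ)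
    (p : ℤ) (n : ℕ) : repT' hq hq1 hk₁ hk₂ ε (casimir q) (vecMinus p n) =
      jacobiMatrix (minusDiag q k₁ k₂ ε p) (minusOff q k₁ k₂ ε p) (vecMinus p) n := by
  have cast_succ (j : ℕ) : ((j + 1 : ℕ) : ℤ) + p = j + p + 1 := by push_cast; ring
  rw [vecMinus, repT'_inl, tensorRep_casimir_single hq.ne' (negRep_shiftRep hq hq1 hk₁)
    (strangeRep_shiftRep hq hq1 (k₂ - 1 / 2) (ε + k₂))]
  rcases n with _ | n <;>
  · simp only [jacobiMatrix, vecMinus, minusDiag, minusOff, Prod.smul_mk, Prod.mk_add_mk,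
      smul_zero, add_zero, Nat.add_sub_cancel, sub_add_cancel, add_sub_cancel_right, discDown_zero,
      discDown_succ, strangeDown_add_one, cast_succ, zero_add]
    congr 1
    push_cast
    module

theorem repT'_casimir_vecPlus (hq : 0 < q) (hq1 : q < 1) (hk₁ : 0 < k₁) (hk₂ : 0 < k₂) (ε : ℝ)
    (l p : ℤ) (n : ℕ) : repT' hq hq1 hk₁ hk₂ ε (casimir q) (vecPlus l p n) =
      jacobiMatrix (plusDiag q k₁ k₂ ε l p) (plusOff q k₁ k₂ ε l p) (vecPlus l p) n := by
  have cast_succ (j : ℕ) : l - ((j + 1 : ℕ) : ℤ) + p = l - j + p - 1 := by push_cast; ring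
  rw [vecPlus, repT'_inr, tensorRep_casimir_single hq.ne'
    (strangeRep_shiftRep hq hq1 (k₁ - 1 / 2) (-ε - k₁)) (posRep_shiftRep hq hq1 hk₂)]
  rcases n with _ | n <;>
  · simp only [jacobiMatrix, vecPlus, plusDiag, plusOff, Prod.smul_mk, Prod.mk_add_mk, smul_zero,
      add_zero, Nat.add_sub_cancel, sub_add_cancel, discDown_zero, discDown_succ,
      strangeDown_eq, cast_succ, zero_add]
    congr 1
    push_cast
    module

end CasimirAction

section Parameters

variable {q k₁ k₂ ε : ℝ}

/-- The parameters `a` (for `k = k₁`) and `b` (for `k = k₂`), with respect to the base `q²`. -/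
def paramAB (q k : ℝ) : ℝ := q ^ (4 * k - 2)

/-- The parameter `c`, with respect to the base `q²`. -/
def paramC (q k₁ ε : ℝ) (p : ℤ) : ℝ := -q ^ (4 * k₁ - 2 * p - 2 * ε - 2)

/-- The points `q^{2n+4k₁}` and `-q^{2n+4k₁-2p-2ε}` attached to `f⁻_{p,n}` and `f⁺_{p,n}`. -/
def paramPt (q k₁ ε : ℝ) (p : ℤ) : ℕ ⊕ ℕ → ℝ :=
  latticePt (paramAB q k₁) (paramC q k₁ ε p) (q ^ 2)

/-- The coefficient of `y(q²x) - y(x)` in the `q`-difference equation at a lattice point `x`. -/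
def paramRaise (q k₁ k₂ ε : ℝ) (p : ℤ) (i : ℕ ⊕ ℕ) : ℝ :=
  raiseCoeff (paramAB q k₁) (paramAB q k₂) (paramC q k₁ ε p) (q ^ 2) (paramPt q k₁ ε p i)

/-- The coefficient of `y(q⁻²x) - y(x)` in the `q`-difference equation at a lattice point `x`. -/
def paramLower (q k₁ ε : ℝ) (p : ℤ) (i : ℕ ⊕ ℕ) : ℝ :=
  lowerCoeff (paramAB q k₁) (paramC q k₁ ε p) (q ^ 2) (paramPt q k₁ ε p i)

lemma paramAB_eq (hq : 0 < q) (k : ℝ) : paramAB q k = (q ^ k) ^ 4 / q ^ 2 := by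
  rw [paramAB, Real.rpow_sub hq, mul_comm, Real.rpow_mul hq.le, Real.rpow_two]
  norm_cast

lemma paramC_eq (hq : 0 < q) (k₁ ε : ℝ) (p : ℤ) :
    paramC q k₁ ε p = -((q ^ k₁) ^ 4 / ((q ^ (ε + p)) ^ 2 * q ^ 2)) := by
  rw [paramC, show 4 * k₁ - 2 * p - 2 * ε - 2 = 4 * k₁ - 2 - (ε + p) * 2 by ring,
    Real.rpow_sub hq, ← paramAB, paramAB_eq hq, Real.rpow_mul hq.le, Real.rpow_two, div_div,
    mul_comm (q ^ 2)]

lemma admissible_params (hq : 0 < q) (hq1 : q < 1) (hk₁ : 0 < k₁) (hk₂ : 0 < k₂) (ε : ℝ) (p : ℤ) :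
    Admissible (paramAB q k₁) (paramAB q k₂) (paramC q k₁ ε p) (q ^ 2) := by
  have mul_sq_lt_one {k : ℝ} (hk : 0 < k) : paramAB q k * q ^ 2 < 1 := by
    rw [paramAB_eq hq, div_mul_cancel₀ _ (pow_pos hq 2).ne']
    exact pow_lt_one₀ (Real.rpow_pos_of_pos hq k).le (Real.rpow_lt_one hq.le hq1 hk) four_ne_zero
  exact ⟨pow_pos hq 2, pow_lt_one₀ hq.le hq1 two_ne_zero, Real.rpow_pos_of_pos hq _,
    mul_sq_lt_one hk₁, Real.rpow_pos_of_pos hq _, mul_sq_lt_one hk₂,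
    neg_neg_of_pos (Real.rpow_pos_of_pos hq _)⟩

lemma rpow_mul_sq_pow_succ (hq : 0 < q) (s : ℝ) (n : ℕ) :
    q ^ s * (q ^ 2) ^ (n + 1) = q ^ (s + 2 * n + 2) := by
  rw [← pow_mul, ← Real.rpow_natCast, ← Real.rpow_add hq]
  congr 1; push_cast; ring

lemma paramPt_inl (hq : 0 < q) (k₁ ε : ℝ) (p : ℤ) (n : ℕ) :
    paramPt q k₁ ε p (.inl n) = q ^ (2 * n + 4 * k₁) :=
  (rpow_mul_sq_pow_succ hq _ n).trans (by congr 1; ring)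

lemma paramPt_inr (hq : 0 < q) (k₁ ε : ℝ) (p : ℤ) (n : ℕ) :
    paramPt q k₁ ε p (.inr n) = -q ^ (2 * n + 4 * k₁ - 2 * p - 2 * ε) :=
  (neg_mul _ _).trans <| congrArg Neg.neg <|
    (rpow_mul_sq_pow_succ hq _ n).trans (by congr 1; ring)

lemma paramPt_inl_succ (q k₁ ε : ℝ) (p : ℤ) (n : ℕ) :
    paramPt q k₁ ε p (.inl (n + 1)) = q ^ 2 * paramPt q k₁ ε p (.inl n) := by
  simp only [paramPt, latticePt, Sum.elim_inl]
  ring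

lemma paramPt_inr_succ (q k₁ ε : ℝ) (p : ℤ) (n : ℕ) :
    paramPt q k₁ ε p (.inr (n + 1)) = q ^ 2 * paramPt q k₁ ε p (.inr n) := by
  simp only [paramPt, latticePt, Sum.elim_inr]
  ring

lemma paramRaise_inl (hq : 0 < q) (k₁ k₂ ε : ℝ) (p : ℤ) (n : ℕ) :
    paramRaise q k₁ k₂ ε p (.inl n) = (1 - (q ^ k₁) ^ 4 * (q ^ n) ^ 2) *
      ((q ^ k₂) ^ 4 * (q ^ n) ^ 2 + ((q ^ (ε + p)) ^ 2)⁻¹) / (q ^ 2 * (q ^ n) ^ 4) := by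
  have hK := Real.rpow_pos_of_pos hq k₁
  have hR := Real.rpow_pos_of_pos hq (ε + p)
  simp only [paramRaise, raiseCoeff, paramPt, latticePt, Sum.elim_inl, paramAB_eq hq,
    paramC_eq hq]
  generalize q ^ k₁ = K at *
  generalize q ^ k₂ = L
  generalize q ^ (ε + p) = R at *
  rw [pow_right_comm, pow_succ q n]
  field_simp
  ring

lemma paramRaise_inr (hq : 0 < q) (k₁ k₂ ε : ℝ) (p : ℤ) (n : ℕ) :
    paramRaise q k₁ k₂ ε p (.inr n) = ((q ^ (ε + p)) ^ 2 + (q ^ k₁) ^ 4 * (q ^ n) ^ 2) *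
      (1 - (q ^ k₂) ^ 4 * (q ^ n) ^ 2) / (q ^ 2 * (q ^ n) ^ 4) := by
  have hK := Real.rpow_pos_of_pos hq k₁
  have hR := Real.rpow_pos_of_pos hq (ε + p)
  simp only [paramRaise, raiseCoeff, paramPt, latticePt, Sum.elim_inr, paramAB_eq hq,
    paramC_eq hq]
  generalize q ^ k₁ = K at *
  generalize q ^ k₂ = L
  generalize q ^ (ε + p) = R at *
  rw [pow_right_comm, pow_succ q n]
  field_simp
  ring

lemma paramLower_inl (hq : 0 < q) (k₁ ε : ℝ) (p : ℤ) (n : ℕ) :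
    paramLower q k₁ ε p (.inl n) =
      (1 - (q ^ n) ^ 2) * ((q ^ n) ^ 2 + ((q ^ (ε + p)) ^ 2)⁻¹) / (q ^ n) ^ 4 := by
  have hK := Real.rpow_pos_of_pos hq k₁
  have hR := Real.rpow_pos_of_pos hq (ε + p)
  simp only [paramLower, lowerCoeff, paramPt, latticePt, Sum.elim_inl, paramAB_eq hq,
    paramC_eq hq]
  generalize q ^ k₁ = K at *
  generalize q ^ (ε + p) = R at *
  rw [pow_right_comm, pow_succ q n]
  field_simp
  ring

lemma paramLower_inr (hq : 0 < q) (k₁ ε : ℝ) (p : ℤ) (n : ℕ) :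
    paramLower q k₁ ε p (.inr n) =
      ((q ^ n) ^ 2 + (q ^ (ε + p)) ^ 2) * (1 - (q ^ n) ^ 2) / (q ^ n) ^ 4 := by
  have hK := Real.rpow_pos_of_pos hq k₁
  have hR := Real.rpow_pos_of_pos hq (ε + p)
  simp only [paramLower, lowerCoeff, paramPt, latticePt, Sum.elim_inr, paramAB_eq hq,
    paramC_eq hq]
  generalize q ^ k₁ = K at *
  generalize q ^ (ε + p) = R at *
  rw [pow_right_comm, pow_succ q n]
  field_simp
  ring

end Parameters

section CasimirCoefficients

variable {q k₁ k₂ ε : ℝ}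

/-- The eigenvalue of the Casimir element attached to the coordinate `m`. -/
def casimirEigenvalue (q k₁ k₂ : ℝ) (m : ℕ) : ℝ :=
  -((q⁻¹ - q) ^ 2)⁻¹ * (q ^ (2 * k₁ + 2 * k₂ - 1 + 2 * m) +
    q ^ (-(2 * k₁ + 2 * k₂ - 1 + 2 * m)) + 2)

/-- The factor between the Casimir element and minus the `q`-difference operator; the remaining
constant term is `casimirEigenvalue q k₁ k₂ 0`. -/
def casimirScale (q k₁ k₂ : ℝ) : ℝ :=
  ((q⁻¹ - q) ^ 2)⁻¹ * (q / ((q ^ k₁) ^ 2 * (q ^ k₂) ^ 2))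

lemma casimirScale_nonneg (hq : 0 < q) (k₁ k₂ : ℝ) : 0 ≤ casimirScale q k₁ k₂ :=
  mul_nonneg (inv_nonneg.2 (sq_nonneg _)) (by positivity)

lemma casimirEigenvalue_eq (hq : 0 < q) (k₁ k₂ : ℝ) (m : ℕ) :
    casimirEigenvalue q k₁ k₂ m = -((q⁻¹ - q) ^ 2)⁻¹ *
      ((q ^ k₁) ^ 2 * (q ^ k₂) ^ 2 / q * (q ^ 2) ^ m +
        q / ((q ^ k₁) ^ 2 * (q ^ k₂) ^ 2 * (q ^ 2) ^ m) + 2) := by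
  have exponent : q ^ (2 * k₁ + 2 * k₂ - 1 + 2 * m) =
      (q ^ k₁) ^ 2 * (q ^ k₂) ^ 2 / q * (q ^ 2) ^ m := by
    rw [Real.rpow_add hq, Real.rpow_sub hq, Real.rpow_add hq, mul_comm 2 k₁, mul_comm 2 k₂,
      Real.rpow_mul hq.le, Real.rpow_mul hq.le, Real.rpow_one, Real.rpow_mul hq.le 2,
      Real.rpow_natCast, Real.rpow_two, Real.rpow_two, Real.rpow_two]
  rw [casimirEigenvalue, Real.rpow_neg hq.le, exponent, div_mul_eq_mul_div, inv_div]

lemma casimirEigenvalue_eq_diffEigenvalue (hq : 0 < q) (k₁ k₂ : ℝ) (m : ℕ) :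
    -casimirScale q k₁ k₂ * diffEigenvalue (paramAB q k₁) (paramAB q k₂) (q ^ 2) m +
      casimirEigenvalue q k₁ k₂ 0 = casimirEigenvalue q k₁ k₂ m := by
  rw [casimirEigenvalue_eq hq, casimirEigenvalue_eq hq, casimirScale, diffEigenvalue,
    paramAB_eq hq, paramAB_eq hq, pow_succ (q ^ 2) m, pow_zero]
  have hK := Real.rpow_pos_of_pos hq k₁
  have hL := Real.rpow_pos_of_pos hq k₂
  have hX := pow_pos (pow_pos hq 2) m
  generalize q ^ k₁ = K at *
  generalize q ^ k₂ = L at *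
  generalize (q ^ 2) ^ m = X at *
  generalize ((q⁻¹ - q) ^ 2)⁻¹ = G
  field_simp
  ring

lemma strangeWeight_minus (hq : 0 < q) (k ε : ℝ) (p : ℤ) (n : ℕ) :
    strangeWeight q (ε + k) (n + p) = q ^ n * q ^ (ε + p) * q ^ k := by
  rw [strangeWeight, ← Real.rpow_natCast q n, ← Real.rpow_add hq, ← Real.rpow_add hq]
  congr 1; push_cast; ring

lemma strangeWeight_plus (hq : 0 < q) (k : ℝ) {l : ℤ} (hε : 2 * ε = l) (p : ℤ) (n : ℕ) :
    strangeWeight q (-ε - k) (l - n + p) = q ^ (ε + p) / (q ^ n * q ^ k) := by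
  rw [strangeWeight, ← Real.rpow_natCast q n, ← Real.rpow_add hq, ← Real.rpow_sub hq]
  congr 1; push_cast; rw [← hε]; ring

lemma strangeWeight_plus_sub_one (hq : 0 < q) (k : ℝ) {l : ℤ} (hε : 2 * ε = l) (p : ℤ) (n : ℕ) :
    strangeWeight q (-ε - k) (l - n + p - 1) = q⁻¹ * (q ^ (ε + p) / (q ^ n * q ^ k)) := by
  have hw := strangeWeight_add_one hq (-ε - k) (l - n + p - 1)
  rw [sub_add_cancel, strangeWeight_plus hq k hε] at hw
  rw [hw, inv_mul_cancel_left₀ hq.ne']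

lemma minusOff_sq (hq : 0 < q) (hq1 : q < 1) (hk₁ : 0 < k₁) (k₂ ε : ℝ) (p : ℤ) (n : ℕ) :
    minusOff q k₁ k₂ ε p n ^ 2 = casimirScale q k₁ k₂ ^ 2 *
      (paramRaise q k₁ k₂ ε p (.inl n) * paramLower q k₁ ε p (.inl (n + 1))) := by
  rw [minusOff, mul_pow, mul_pow, mul_pow, discUp_sq hq hq1 hk₁, strangeUp_sq hq,
    strangeWeight_minus hq, discWeight_eq hq, casimirScale, paramRaise_inl hq, paramLower_inl hq,
    pow_succ q n]
  have hK := Real.rpow_pos_of_pos hq k₁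
  have hL := Real.rpow_pos_of_pos hq k₂
  have hR := Real.rpow_pos_of_pos hq (ε + p)
  have hX := pow_pos hq n
  generalize q ^ k₁ = K at *
  generalize q ^ k₂ = L at *
  generalize q ^ (ε + p) = R at *
  generalize q ^ n = X at *
  generalize ((q⁻¹ - q) ^ 2)⁻¹ = G
  field_simp
  ring

lemma minusDiag_eq (hq : 0 < q) (hq1 : q < 1) (hk₁ : 0 < k₁) (k₂ ε : ℝ) (p : ℤ) (n : ℕ) :
    minusDiag q k₁ k₂ ε p n = -casimirScale q k₁ k₂ *
      (paramRaise q k₁ k₂ ε p (.inl n) + paramLower q k₁ ε p (.inl n)) +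
        casimirEigenvalue q k₁ k₂ 0 := by
  rw [minusDiag, strangeDown_mul_strangeUp hq, discDown_succ, mul_neg (discUp q k₁ n), ← sq,
    discUp_sq hq hq1 hk₁, strangeWeight_minus hq, discWeight_eq hq, casimirScale,
    casimirEigenvalue_eq hq, paramRaise_inl hq, paramLower_inl hq, pow_zero]
  have hK := Real.rpow_pos_of_pos hq k₁
  have hL := Real.rpow_pos_of_pos hq k₂
  have hR := Real.rpow_pos_of_pos hq (ε + p)
  have hX := pow_pos hq n
  generalize q ^ k₁ = K at *
  generalize q ^ k₂ = L at *
  generalize q ^ (ε + p) = R at *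
  generalize q ^ n = X at *
  generalize ((q⁻¹ - q) ^ 2)⁻¹ = G
  field_simp
  ring

lemma plusOff_sq (hq : 0 < q) (hq1 : q < 1) (hk₂ : 0 < k₂) (k₁ : ℝ) {l : ℤ} (hε : 2 * ε = l)
    (p : ℤ) (n : ℕ) : plusOff q k₁ k₂ ε l p n ^ 2 = casimirScale q k₁ k₂ ^ 2 *
      (paramRaise q k₁ k₂ ε p (.inr n) * paramLower q k₁ ε p (.inr (n + 1))) := by
  rw [plusOff, neg_sq, mul_pow, mul_pow, mul_pow, discUp_sq hq hq1 hk₂, strangeUp_sq hq,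
    strangeWeight_plus_sub_one hq k₁ hε, discWeight_eq hq, casimirScale, paramRaise_inr hq,
    paramLower_inr hq, pow_succ q n]
  have hK := Real.rpow_pos_of_pos hq k₁
  have hL := Real.rpow_pos_of_pos hq k₂
  have hR := Real.rpow_pos_of_pos hq (ε + p)
  have hX := pow_pos hq n
  generalize q ^ k₁ = K at *
  generalize q ^ k₂ = L at *
  generalize q ^ (ε + p) = R at *
  generalize q ^ n = X at *
  generalize ((q⁻¹ - q) ^ 2)⁻¹ = G
  field_simp
  ring

lemma plusDiag_eq (hq : 0 < q) (hq1 : q < 1) (hk₂ : 0 < k₂) (k₁ : ℝ) {l : ℤ} (hε : 2 * ε = l)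
    (p : ℤ) (n : ℕ) : plusDiag q k₁ k₂ ε l p n = -casimirScale q k₁ k₂ *
      (paramRaise q k₁ k₂ ε p (.inr n) + paramLower q k₁ ε p (.inr n)) +
        casimirEigenvalue q k₁ k₂ 0 := by
  rw [plusDiag, strangeDown_mul_strangeUp hq, discDown_mul_discUp hq hq1 hk₂,
    strangeWeight_plus hq k₁ hε, discWeight_eq hq, casimirScale, casimirEigenvalue_eq hq,
    paramRaise_inr hq, paramLower_inr hq, pow_zero]
  have hK := Real.rpow_pos_of_pos hq k₁
  have hL := Real.rpow_pos_of_pos hq k₂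
  have hR := Real.rpow_pos_of_pos hq (ε + p)
  have hX := pow_pos hq n
  generalize q ^ k₁ = K at *
  generalize q ^ k₂ = L at *
  generalize q ^ (ε + p) = R at *
  generalize q ^ n = X at *
  generalize ((q⁻¹ - q) ^ 2)⁻¹ = G
  field_simp
  ring

end CasimirCoefficients

section Diagonalization

variable {q k₁ k₂ ε : ℝ} {l : ℤ} (hq : 0 < q) (hq1 : q < 1) (hk₁ : 0 < k₁) (hk₂ : 0 < k₂)

lemma repT'_casimir_vecMinus_eq_coe (ε : ℝ) (l p : ℤ) (n : ℕ) :
    repT' hq hq1 hk₁ hk₂ ε (casimir q) (vecMinus p n) =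
      jacobiMatrix (minusDiag q k₁ k₂ ε p) (minusOff q k₁ k₂ ε p) (fMinus l p) n := by
  rw [← Submodule.subtype_apply, map_jacobiMatrix]
  exact repT'_casimir_vecMinus hq hq1 hk₁ hk₂ ε p n

lemma repT'_casimir_vecPlus_eq_coe (ε : ℝ) (l p : ℤ) (n : ℕ) :
    repT' hq hq1 hk₁ hk₂ ε (casimir q) (vecPlus l p n) =
      jacobiMatrix (plusDiag q k₁ k₂ ε l p) (plusOff q k₁ k₂ ε l p) (fPlus l p) n := by
  rw [← Submodule.subtype_apply, map_jacobiMatrix]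
  exact repT'_casimir_vecPlus hq hq1 hk₁ hk₂ ε l p n

theorem repT'_casimir_mem_subA (ε : ℝ) (l p : ℤ) :
    ∀ x ∈ subA l p, repT' hq hq1 hk₁ hk₂ ε (casimir q) x ∈ subA l p := by
  suffices subA l p ≤ (subA l p).comap (repT' hq hq1 hk₁ hk₂ ε (casimir q)) from this
  refine sup_le ?_ ?_ <;> rw [Submodule.span_le] <;> rintro _ ⟨n, rfl⟩
  · rw [SetLike.mem_coe, Submodule.mem_comap, repT'_casimir_vecMinus_eq_coe hq hq1 hk₁ hk₂ ε l p n]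
    exact Subtype.prop _
  · rw [SetLike.mem_coe, Submodule.mem_comap, repT'_casimir_vecPlus_eq_coe hq hq1 hk₁ hk₂ ε l p n]
    exact Subtype.prop _

/-- The action of the Casimir element on `A_p`. -/
def casimirA (ε : ℝ) (l p : ℤ) : Module.End ℂ (subA l p) :=
  (repT' hq hq1 hk₁ hk₂ ε (casimir q)).restrict (repT'_casimir_mem_subA hq hq1 hk₁ hk₂ ε l p)

lemma theta_casimirA_fMinus (ε : ℝ) (l p : ℤ) (n m : ℕ) :
    theta (admissible_params hq hq1 hk₁ hk₂ ε p) l p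
        (casimirA hq hq1 hk₁ hk₂ ε l p (fMinus l p n)) m =
      casimirEigenvalue q k₁ k₂ m *
        theta (admissible_params hq hq1 hk₁ hk₂ ε p) l p (fMinus l p n) m := by
  have h := admissible_params hq hq1 hk₁ hk₂ ε p
  have casimirA_fMinus : casimirA hq hq1 hk₁ hk₂ ε l p (fMinus l p n) =
      jacobiMatrix (minusDiag q k₁ k₂ ε p) (minusOff q k₁ k₂ ε p) (fMinus l p) n :=
    Subtype.ext (repT'_casimir_vecMinus_eq_coe hq hq1 hk₁ hk₂ ε l p n)
  have eigen := h.jacobiMatrix_rFun (σ := Sum.inl) (τ := 1)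
    (paramPt_inl_succ q k₁ ε p) ((paramLower_inl hq k₁ ε p 0).trans (by simp))
    (casimirScale_nonneg hq k₁ k₂) (one_mul 1)
    (fun n => (one_mul (minusOff q k₁ k₂ ε p n)).symm ▸ minusOff_nonneg hq hq1 k₁ k₂ ε p n)
    (minusOff_sq hq hq1 hk₁ k₂ ε p) (minusDiag_eq hq hq1 hk₁ k₂ ε p) m n
  rw [casimirEigenvalue_eq_diffEigenvalue hq] at eigen
  simp only [one_pow, one_mul, ← theta_fMinus h l p] at eigen
  rw [casimirA_fMinus, ← eigen]
  exact map_jacobiMatrix (lp.evalₗ _ _ m ∘ₗ theta h l p) _ _ _ n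

lemma theta_casimirA_fPlus (hε : 2 * ε = l) (p : ℤ) (n m : ℕ) :
    theta (admissible_params hq hq1 hk₁ hk₂ ε p) l p
        (casimirA hq hq1 hk₁ hk₂ ε l p (fPlus l p n)) m =
      casimirEigenvalue q k₁ k₂ m *
        theta (admissible_params hq hq1 hk₁ hk₂ ε p) l p (fPlus l p n) m := by
  have h := admissible_params hq hq1 hk₁ hk₂ ε p
  have casimirA_fPlus : casimirA hq hq1 hk₁ hk₂ ε l p (fPlus l p n) =
      jacobiMatrix (plusDiag q k₁ k₂ ε l p) (plusOff q k₁ k₂ ε l p) (fPlus l p) n :=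
    Subtype.ext (repT'_casimir_vecPlus_eq_coe hq hq1 hk₁ hk₂ ε l p n)
  have eigen := h.jacobiMatrix_rFun (σ := Sum.inr) (τ := -1)
    (paramPt_inr_succ q k₁ ε p) ((paramLower_inr hq k₁ ε p 0).trans (by simp))
    (casimirScale_nonneg hq k₁ k₂) (by norm_num)
    (fun n => mul_nonneg_of_nonpos_of_nonpos (by norm_num)
      (plusOff_nonpos hq hq1 k₁ k₂ ε l p n))
    (plusOff_sq hq hq1 hk₂ k₁ hε p) (plusDiag_eq hq hq1 hk₂ k₁ hε p) m n
  rw [casimirEigenvalue_eq_diffEigenvalue hq] at eigen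
  simp only [← theta_fPlus h l p] at eigen
  rw [casimirA_fPlus, ← eigen]
  exact map_jacobiMatrix (lp.evalₗ _ _ m ∘ₗ theta h l p) _ _ _ n

theorem theta_casimirA (hε : 2 * ε = l) (p : ℤ) (x : subA l p) (m : ℕ) :
    theta (admissible_params hq hq1 hk₁ hk₂ ε p) l p (casimirA hq hq1 hk₁ hk₂ ε l p x) m =
      casimirEigenvalue q k₁ k₂ m * theta (admissible_params hq hq1 hk₁ hk₂ ε p) l p x m := by
  set Θm : subA l p →ₗ[ℂ] ℂ :=
    lp.evalₗ _ _ m ∘ₗ theta (admissible_params hq hq1 hk₁ hk₂ ε p) l p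
  suffices Θm ∘ₗ casimirA hq hq1 hk₁ hk₂ ε l p = (casimirEigenvalue q k₁ k₂ m : ℂ) • Θm from
    LinearMap.congr_fun this x
  refine LinearMap.ext_on_range (span_range_fVec l p) ?_
  rintro (n | n)
  · exact theta_casimirA_fMinus hq hq1 hk₁ hk₂ ε l p n m
  · exact theta_casimirA_fPlus hq hq1 hk₁ hk₂ hε p n m

end Diagonalization

end QSU

end

theorem proposition3p4 (q k₁ k₂ ε : ℝ) (hq : 0 < q) (hq1 : q < 1) (hk₁ : 0 < k₁) (hk₂ : 0 < k₂)
    (l : ℤ) (hε : 2 * ε = l) (p : ℤ) :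
    ∃ Θ : QSU.subA l p →ₗ[ℂ] QSU.L2N,
      (∀ n m : ℕ, Θ (QSU.fMinus l p n) m =
        ((QSU.rFun (q ^ (2 * n + 4 * k₁)) m (q ^ (4 * k₁ - 2)) (q ^ (4 * k₂ - 2))
          (-q ^ (4 * k₁ - 2 * p - 2 * ε - 2)) (q ^ 2) : ℝ) : ℂ)) ∧
      (∀ n m : ℕ, Θ (QSU.fPlus l p n) m =
        (((-1) ^ n * QSU.rFun (-q ^ (2 * n + 4 * k₁ - 2 * p - 2 * ε)) m (q ^ (4 * k₁ - 2))
          (q ^ (4 * k₂ - 2)) (-q ^ (4 * k₁ - 2 * p - 2 * ε - 2)) (q ^ 2) : ℝ) : ℂ)) ∧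
      (∃ U : QSU.closureA l p ≃ₗᵢ[ℂ] QSU.L2N, ∀ x, U (QSU.inclA l p x) = Θ x) ∧
      ∃ hA : ∀ x ∈ QSU.subA l p,
          QSU.repT' hq hq1 hk₁ hk₂ ε (QSU.casimir q) x ∈ QSU.subA l p,
        ∀ (x : QSU.subA l p) (m : ℕ),
          Θ ((QSU.repT' hq hq1 hk₁ hk₂ ε (QSU.casimir q)).restrict hA x) m =
            ((-((q⁻¹ - q) ^ 2)⁻¹ * (q ^ (2 * k₁ + 2 * k₂ - 1 + 2 * m) +
              q ^ (-(2 * k₁ + 2 * k₂ - 1 + 2 * m)) + 2) : ℝ) : ℂ) * Θ x m := by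
  have h := QSU.admissible_params hq hq1 hk₁ hk₂ ε p
  refine ⟨QSU.theta h l p, fun n m => ?_, fun n m => ?_, ⟨QSU.intertwiner h l p, fun _ => rfl⟩,
    QSU.repT'_casimir_mem_subA hq hq1 hk₁ hk₂ ε l p, QSU.theta_casimirA hq hq1 hk₁ hk₂ hε p⟩
  · rw [← QSU.paramPt_inl hq]
    exact QSU.theta_fMinus h l p n m
  · rw [← QSU.paramPt_inr hq]
    exact QSU.theta_fPlus h l p n m
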